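/- **Cubes.** A sub-cube of the $n$-cube $[n]=[-1,1]^n$ is a word $x=x_1\cdots x_n$ in the symbols $-,0,+$, naming the geometric cube $|x|=\{p\in[-1,1]^n: p_i=\pm1 \text{ whenever } x_i=\pm\}$. Its dimension $\dim x$ is the number of its $0$'s; the word $0\cdots0$ is also written $[n]$. For a sub-cube $y$ of the $(\dim x)$-cube, $x*y$ is obtained from $x$ by replacing its $j$-th symbol $0$ by the $j$-th symbol of $y$. For a word $x$ let $\lambda_0x=x-$, $\mu_0x=x0$, $\nu_0x=x+$. **Blocks.** A $0$-block is a sub-cube of $[n]$, and a $k$-block ($k\ge1$) is a finite sequence of $(k-1)$-blocks, consecutive ones being separated by the sign $*_{k-1}$. Juxtaposition of sequences is written $|$. For $j\le k$ a $j$-block is also a $k$-block (as a one-term sequence, repeatedly). The dimension of a block is the largest dimension of its entries. The full $j$-sub-blocks of a $k$-block ($j\le k$) are the maximal segments containing no $*_l$ with $l\ge j$, i.e. its constituent $j$-blocks. **Sources and targets.** The $k$-blocks $\sigma_k[n]$, $\tau_k[n]$ are defined by induction. If $k\ge n$ then $\sigma_k[n]=\tau_k[n]=[n]$; $\sigma_0[n]=-\cdots-$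 and $\tau_0[n]=+\cdots+$; and for $1\le k<n$ $$\sigma_k[n]=\mu_{k-1}\sigma_{k-1}[n-1]\;|\;\nu_{k-1}\sigma_k[n-1],\qquad \tau_k[n]=\lambda_{k-1}\tau_k[n-1]\;|\;\mu_{k-1}\tau_{k-1}[n-1]\qquad(k\text{ odd}),$$ $$\sigma_k[n]=\mu_{k-1}\sigma_{k-1}[n-1]\;|\;\lambda_{k-1}\sigma_k[n-1],\qquad \tau_k[n]=\nu_{k-1}\tau_k[n-1]\;|\;\mu_{k-1}\tau_{k-1}[n-1]\qquad(k\text{ even}).$$ Here $\lambda_k,\nu_k$ (from $k$-blocks of $[n]$ to $k$-blocks of $[n+1]$) and $\mu_k$ (from $k$-blocks of $[n]$ to $(k+1)$-blocks of $[n+1]$) are given for $k\ge1$ and $\alpha=(\alpha_1,\dots,\alpha_t)$ by $$\lambda_k\alpha=\lambda_{k-1}\alpha_1|\cdots|\lambda_{k-1}\alpha_t|\mu_{k-1}\tau_{k-1}[n],\qquad \nu_k\alpha=\mu_{k-1}\sigma_{k-1}[n]|\nu_{k-1}\alpha_1|\cdots|\nu_{k-1}\alpha_t\qquad(k\text{ odd}),$$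 $$\lambda_k\alpha=\mu_{k-1}\sigma_{k-1}[n]|\lambda_{k-1}\alpha_1|\cdots|\lambda_{k-1}\alpha_t,\qquad \nu_k\alpha=\nu_{k-1}\alpha_1|\cdots|\nu_{k-1}\alpha_t|\mu_{k-1}\tau_{k-1}[n]\qquad(k\text{ even});$$ they are applied to blocks of higher order by applying them to every sub-$k$-block; and $\mu_k\alpha$ is the sequence of $t$ $k$-blocks whose $i$-th term is $$\lambda_{k-1}\tau_k\alpha_1|\cdots|\lambda_{k-1}\tau_k\alpha_{i-1}|\mu_{k-1}\alpha_i|\nu_{k-1}\sigma_k\alpha_{i+1}|\cdots|\nu_{k-1}\sigma_k\alpha_t\quad(k\text{ odd}),$$ $$\nu_{k-1}\tau_k\alpha_1|\cdots|\nu_{k-1}\tau_k\alpha_{i-1}|\mu_{k-1}\alpha_i|\lambda_{k-1}\sigma_k\alpha_{i+1}|\cdots|\lambda_{k-1}\sigma_k\alpha_t\quad(k\text{ even}).$$ The $k$-block $\sigma_k(\alpha)$ of a $j$-block $\alpha=(\alpha_1,\dots,\alpha_t)$ is defined as follows, and $\tau_k(\alpha)$ likewise. For a cube, $\sigma_k(x)=x*\sigma_k[\dim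 x]$. If $j>k$, $\sigma_k(\alpha)$ is $\sigma_k$ of the first (for $\tau_k$: $\tau_k$ of the last) sub-$k$-block. If $j=k\geq 1$, $\sigma_k(\alpha)=\sigma_k(\alpha_1)|\cdots|\sigma_k(\alpha_t)$. If $1\le j<k$ and $\dim\alpha\le k$, $\sigma_k(\alpha)=\alpha$. If $1\le j<k$ and $\dim\alpha>k$, let $\alpha_i$ be the $(j-1)$-block of dimension $>k$ (in the blocks that occur there is only one); $\sigma_k(\alpha)$ arises from $\sigma_k(\alpha_i)$ by replacing each of its sub-$j$-blocks $\delta$ by $\alpha_1|\cdots|\alpha_{i-1}|\delta|\alpha_{i+1}|\cdots|\alpha_t$. **Equality of sources and targets.** A block lists its cubes in one of several admissible orders. Two $i$-blocks $\alpha,\beta$ *represent the same cell*, written $\alpha\equiv\beta$, if for every $l\le i$ the $l$-dimensional cubes of $\sigma_l(\alpha)$ and of $\sigma_l(\beta)$ are the same, with the same multiplicities, and likewise for $\tau_l(\alpha)$ and $\tau_l(\beta)$. **Piles.** The source and target $k$-faces $\psi_k[n]$, $\omega_k[n]$ are the sets of sub-cubes with $\psi_k[n]=\omega_k[n]=\{[n]\}$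 for $k\ge n$, $\psi_0[n]=\{-\cdots-\}$, $\omega_0[n]=\{+\cdots+\}$ and, for $1\le k<n$, $\psi_k[n]=\mu_0\psi_{k-1}[n-1]\cup\epsilon\,\psi_k[n-1]$, $\omega_k[n]=\epsilon'\omega_k[n-1]\cup\mu_0\omega_{k-1}[n-1]$, where $(\epsilon,\epsilon')=(\lambda_0,\nu_0)$ for $k$ even and $(\nu_0,\lambda_0)$ for $k$ odd. For a sub-cube $x$ put $\psi_k(x)=x*\psi_k[\dim x]$, $\omega_k(x)=x*\omega_k[\dim x]$. An $(n,n)$-pile is a sequence $v_0,\dots,v_n$ where $v_j$ is a set of $\binom nj$ sub-cubes of $[n]$ of dimension $j$. A cube $x$ is applicable to it if $\psi_j(x)\subseteq v_j$ for all $j\le\dim x$, and then it replaces $v_j$ by $(v_j\setminus\psi_j(x))\cup\omega_j(x)$ for all $j\le\dim x$. The sign $*_i$ is applicable if $v_j=\omega_j[n]$ for all $j<i$, and then replaces these $v_j$ by $\psi_j[n]$. For $k\le n$, the cubes and signs of $\sigma_k[n]$, read in order, are applied to the pile $(\psi_0[n],\dots,\psi_n[n])$, and those of $\tau_k[n]$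 to the same pile with $\psi_k[n]$ replaced by $\omega_k[n]$. The cocycle blocks of $[n]$ are the case $k=n-1$. **Proposition 6.2.** Let $n\ge0$. (i) If $i<j<k$ and $\alpha$ is a full $j$-sub-block of $\sigma_k[n]$ or of $\tau_k[n]$, then $\sigma_i(\alpha)\equiv\sigma_i[n]$ and $\tau_i(\alpha)\equiv\tau_i[n]$. (ii) If $\alpha *_j\beta$ is an occurrence of consecutive full $j$-sub-blocks of $\sigma_k[n]$ (separated by $*_j$), then $\sigma_j(\beta)\equiv\tau_j(\alpha)$, and the union of the geometric sub-cubes in $\sigma_j(\beta)$ is homeomorphic to the closed $j$-disk. (iii) Let $k\le n$. When the symbols of $\sigma_k[n]$ (or of $\tau_k[n]$) are applied in order as above, each of them is applicable when its turn comes, and every sequence $v_0,\dots,v_n$ that arises, including the initial one, is an $(n,n)$-pile whose unions $V_l=\bigcup_{x\in v_l}|x|$ form a nested sequence $V_0\subseteq V_1\subseteq\cdots\subseteq V_n$. For each $l\le n$ there is a homeomorphism from the closed $l$-disk onto $V_l$ that takes the boundary sphere onto $\partial V_l=|\sigma_{l-1}[n]|\cup|\tau_{l-1}[n]|$ (which is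 empty for $l=0$), where $|\cdot|$ of a block is the union of the geometric sub-cubes in it. -/

import Mathlib

namespace Cubical

/-! ### Sub-cubes of the `n`-cube as words in `-`, `0`, `+` -/

/-- A sub-cube of the `n`-cube `[-1,1]ⁿ`: a word of length `n` in the symbols `-`, `0`, `+`
(the constructors of `SignType`), where `0` stands for the whole interval. -/
abbrev Cube (n : ℕ) : Type := Fin n → SignType

/-- The dimension of a sub-cube: the number of its `0`s. -/
def dim {n : ℕ} (x : Cube n) : ℕ := (Finset.univ.filter fun i => x i = 0).card

/-- The `n`-cube itself, the word `0⋯0`. -/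
def full (n : ℕ) : Cube n := fun _ => 0

/-- Append `-` to a word (the "old" copy). -/
def lamC {n : ℕ} (x : Cube n) : Cube (n + 1) := Fin.snoc (α := fun _ => SignType) x (-1)

/-- Append `0` to a word (the "thickened" copy). -/
def muC {n : ℕ} (x : Cube n) : Cube (n + 1) := Fin.snoc (α := fun _ => SignType) x 0

/-- Append `+` to a word (the "new" copy). -/
def nuC {n : ℕ} (x : Cube n) : Cube (n + 1) := Fin.snoc (α := fun _ => SignType) x 1

theorem dim_le {n : ℕ} (x : Cube n) : dim x ≤ n := by
  simpa [dim] using Finset.card_le_univ (Finset.univ.filter fun i => x i = 0)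

theorem rank_lt {n : ℕ} (x : Cube n) (i : Fin n) (h : x i = 0) :
    (Finset.univ.filter fun j => j < i ∧ x j = 0).card < dim x := by
  apply Finset.card_lt_card
  rw [Finset.ssubset_iff_of_subset]
  · exact ⟨i, by simp [h], by simp⟩
  · intro j hj
    simp only [Finset.mem_filter, Finset.mem_univ, true_and] at hj ⊢
    exact hj.2

/-- The operation `x * y`: the `j`-th symbol `0` of `x` is replaced by the `j`-th symbol of `y`. -/
def place {n : ℕ} (x : Cube n) (y : Cube (dim x)) : Cube n := fun i =>
  if h : x i = 0 then
    y ⟨(Finset.univ.filter fun j => j < i ∧ x j = 0).card, rank_lt x i h⟩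
  else x i

/-- The geometric sub-cube of `[-1,1]ⁿ ⊆ ℝⁿ` named by a word. -/
def body {n : ℕ} (x : Cube n) : Set (Fin n → ℝ) :=
  {p | ∀ i, p i ∈ Set.Icc (-1 : ℝ) 1 ∧ (x i ≠ 0 → p i = (x i : ℝ))}

/-! ### Blocks -/

/-- `Block n k` is the type of `(n, k)`-blocks: a `0`-block is a sub-cube of the `n`-cube, and a
`(k+1)`-block is a sequence of `k`-blocks (written as a column if `k+1` is odd, as a row if
`k+1` is even); consecutive `k`-blocks are separated by `*ₖ` in linear notation. -/
def Block (n : ℕ) : ℕ → Type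
  | 0 => Cube n
  | k + 1 => List (Block n k)

namespace Block

/-- A cube regarded as a `k`-block. -/
def ofCube {n : ℕ} : (k : ℕ) → Cube n → Block n k
  | 0, x => x
  | k + 1, x => ([ofCube k x] : List (Block n k))

instance {n k : ℕ} : Inhabited (Block n k) := ⟨ofCube k (full n)⟩

/-- The natural inclusion of `j`-blocks in `k`-blocks for `j ≤ k`. -/
def incl {n j k : ℕ} (h : j ≤ k) (a : Block n j) : Block n k :=
  Nat.leRec (motive := fun k _ => Block n k) a
    (fun k _ b => ([b] : List (Block n k))) h

/-- Apply `f` to each sub-`j`-block of a `k`-block, `j ≤ k`. -/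
def mapSub {n j k : ℕ} (h : j ≤ k) (f : Block n j → Block n j) : Block n k → Block n k :=
  Nat.leRec (motive := fun k _ => Block n k → Block n k) f
    (fun k _ g => (List.map g : List (Block n k) → List (Block n k))) h

/-- Apply a map of cubes to each entry of a block. -/
def map {m n : ℕ} (f : Cube m → Cube n) : (k : ℕ) → Block m k → Block n k
  | 0, x => f x
  | k + 1, (a : List (Block m k)) => (a.map (map f k) : List (Block n k))

/-- The entries of a block, in the order in which the block is read. -/
def cubes {n : ℕ} : (k : ℕ) → Block n k → List (Cube n)
  | 0, x => [x]
  | k + 1, (a : List (Block n k)) => a.flatMap (cubes k)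

/-- The dimension of a block: the maximum of the dimensions of its entries. -/
def bdim {n k : ℕ} (a : Block n k) : ℕ := ((cubes k a).map dim).foldr max 0

end Block

/-- The two kinds of faces: sources (`σ`) and targets (`τ`). -/
inductive Side
  | src
  | tgt

/-- Extension of the `k`-source (`s = src`) or `k`-target (`s = tgt`) from cubes to `j`-blocks of
sub-cubes of the `n`-cube, with value a `k`-block. The argument `E` gives the `k`-source and
`k`-target of cubes. For a `j`-block `a`:
* if `k < j`, pass to the first (for targets: the last) sub-`k`-block of `a`;
* if `k = j`, juxtapose the values on the consecutive `(j-1)`-blocks of `a`;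
* if `j < k` and `a` has dimension at most `k`, the value is `a` itself;
* if `j < k` and `a` has dimension more than `k`, take the `(j-1)`-block `c` of `a` of dimension
  more than `k` (there is only one in a distinguished block) and insert the `(j-1)`-blocks
  preceding and following `c` in `a` before and after each sub-`j`-block of the value on `c`. -/
def bdry {n : ℕ} (E : Side → (k : ℕ) → Cube n → Block n k) (s : Side) :
    (j k : ℕ) → Block n j → Block n k
  | 0, k, x => E s k x
  | j + 1, k, (a : List (Block n j)) =>
    if hlt : k < j + 1 then
      match s with
      | .src => (a.head?.map (bdry E .src j k)).getD default
      | .tgt => (a.getLast?.map (bdry E .tgt j k)).getD default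
    else if heq : j + 1 = k then
      heq ▸ (a.flatMap (bdry E s j (j + 1)) : List (Block n j))
    else
      match a.dropWhile (fun b => decide (b.bdim ≤ k)) with
      | [] => Block.incl (j := j + 1) (not_lt.mp hlt) a
      | c :: post =>
        Block.mapSub (j := j + 1) (not_lt.mp hlt)
          (fun (d : List (Block n j)) =>
            (a.takeWhile (fun b => decide (b.bdim ≤ k)) ++ d ++ post : List (Block n j)))
          (bdry E s j k c)

/-- From a list `a₁, …, aₜ` form the `t` lists
`before a₁ ++ ⋯ ++ before aᵢ₋₁ ++ here aᵢ ++ after aᵢ₊₁ ++ ⋯ ++ after aₜ`. -/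
def sweep {α β : Type} (before here after : α → List β) : List α → List (List β)
  | [] => []
  | c :: post =>
    (here c ++ post.flatMap after) ::
      (sweep before here after post).map (fun l => before c ++ l)

mutual

/-- The operation `λₖ` on `k`-blocks. Here `S` gives the sources and targets of the `n`-cube and
`E` those of its sub-cubes. -/
def lamB {n : ℕ} (S : Side → (k : ℕ) → Block n k) (E : Side → (k : ℕ) → Cube n → Block n k) :
    (k : ℕ) → Block n k → Block (n + 1) k
  | 0, x => lamC x
  | k + 1, (a : List (Block n k)) =>
    if Odd (k + 1) then
      (a.map (lamB S E k) ++ muB S E k (S .tgt k) : List (Block (n + 1) k))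
    else
      (muB S E k (S .src k) ++ a.map (lamB S E k) : List (Block (n + 1) k))
termination_by structural k => k

/-- The operation `νₖ` on `k`-blocks. -/
def nuB {n : ℕ} (S : Side → (k : ℕ) → Block n k) (E : Side → (k : ℕ) → Cube n → Block n k) :
    (k : ℕ) → Block n k → Block (n + 1) k
  | 0, x => nuC x
  | k + 1, (a : List (Block n k)) =>
    if Odd (k + 1) then
      (muB S E k (S .src k) ++ a.map (nuB S E k) : List (Block (n + 1) k))
    else
      (a.map (nuB S E k) ++ muB S E k (S .tgt k) : List (Block (n + 1) k))
termination_by structural k => k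

/-- The thickening `μₖ`, from `k`-blocks to `(k+1)`-blocks. -/
def muB {n : ℕ} (S : Side → (k : ℕ) → Block n k) (E : Side → (k : ℕ) → Cube n → Block n k) :
    (k : ℕ) → Block n k → List (Block (n + 1) k)
  | 0, x => [muC x]
  | k + 1, (a : List (Block n k)) =>
    if Odd (k + 1) then
      sweep
        (fun b => List.map (lamB S E k) (bdry E .tgt k (k + 1) b : List (Block n k)))
        (muB S E k)
        (fun b => List.map (nuB S E k) (bdry E .src k (k + 1) b : List (Block n k))) a
    else
      sweep
        (fun b => List.map (nuB S E k) (bdry E .tgt k (k + 1) b : List (Block n k)))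
        (muB S E k)
        (fun b => List.map (lamB S E k) (bdry E .src k (k + 1) b : List (Block n k))) a
termination_by structural k => k

end

/-- The inductive step in the definition of the `k`-source and `k`-target of the `(n+1)`-cube. -/
def stdStep {n : ℕ} (S : Side → (k : ℕ) → Block n k) (E : Side → (k : ℕ) → Cube n → Block n k)
    (s : Side) (k : ℕ) : Block (n + 1) k :=
  if n + 1 ≤ k then Block.ofCube k (full (n + 1))
  else
    match s, k with
    | .src, 0 => lamC (S .src 0)
    | .tgt, 0 => nuC (S .tgt 0)
    | .src, k + 1 =>
      (muB S E k (S .src k) ++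
        List.map (if Odd (k + 1) then nuB S E k else lamB S E k)
          (S .src (k + 1) : List (Block n k)) :
        List (Block (n + 1) k))
    | .tgt, k + 1 =>
      (List.map (if Odd (k + 1) then lamB S E k else nuB S E k)
          (S .tgt (k + 1) : List (Block n k)) ++
        muB S E k (S .tgt k) : List (Block (n + 1) k))

/-- The `k`-source `σₖ[n]` (for `s = src`) and the `k`-target `τₖ[n]` (for `s = tgt`) of the
`n`-cube, as a `k`-block; it is `[n]` itself if `n ≤ k`. For a sub-cube `x` the `k`-source and
`k`-target are `x * σₖ[dim x]` and `x * τₖ[dim x]`. -/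
def std : (n : ℕ) → Side → (k : ℕ) → Block n k
  | 0 => fun _ k => Block.ofCube k (full 0)
  | n + 1 => fun s k =>
    stdStep (std n) (fun s k x => Block.map (place x) k (std (dim x) s k)) s k
termination_by n => n
decreasing_by
  · exact Nat.lt_succ_self n
  · exact Nat.lt_succ_of_le (dim_le x)

/-- The `k`-source `σₖ(a)` or `k`-target `τₖ(a)` of a `j`-block `a`. -/
def bd {n j : ℕ} (s : Side) (k : ℕ) (a : Block n j) : Block n k :=
  bdry (fun s k x => Block.map (place x) k (std (dim x) s k)) s j k a

/-- `IsFullSub a k b`: the `j`-block `a` is one of the full `j`-sub-blocks of the `k`-block `b`,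
i.e. a maximal segment of `b` in which no separator `*ₗ` with `l ≥ j` occurs. -/
inductive IsFullSub {n j : ℕ} (a : Block n j) : (k : ℕ) → Block n k → Prop
  | refl : IsFullSub a j a
  | step {k : ℕ} (b : Block n k) (c : List (Block n k)) (hb : b ∈ c)
      (h : IsFullSub a k b) : IsFullSub a (k + 1) c

/-- The cubes of dimension exactly `k` in a `k`-block. -/
def cells {n k : ℕ} (a : Block n k) : List (Cube n) :=
  (Block.cubes k a).filter (fun x => decide (dim x = k))

/-- Two `i`-blocks represent the same `i`-cell: in each dimension `l ≤ i` their `l`-sources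
consist of the same `l`-cubes, and so do their `l`-targets (counted with multiplicity).
The order in which a block lists its cubes and the lower-dimensional cubes
used to fill out its sub-blocks are conventions and are not compared. -/
def SameCell {n i : ℕ} (a b : Block n i) : Prop :=
  ∀ l ≤ i, ∀ s : Side, (cells (bd s l a)).Perm (cells (bd s l b))

/-- The union in `ℝⁿ` of all sub-cubes occurring in a block. -/
def blockBody {n k : ℕ} (a : Block n k) : Set (Fin n → ℝ) :=
  {p | ∃ x ∈ Block.cubes k a, p ∈ body x}

/-- `V` is a `k`-disk with boundary sphere `B`. -/
def IsDiskWithBoundary {X : Type*} [TopologicalSpace X] (k : ℕ) (V B : Set X) : Prop :=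
  ∃ e : Metric.closedBall (0 : EuclideanSpace ℝ (Fin k)) 1 ≃ₜ V,
    (fun p => (e p : X)) '' {p | ‖(p : EuclideanSpace ℝ (Fin k))‖ = 1} = B

/-- `V` is a `k`-disk. -/
def IsDisk {X : Type*} [TopologicalSpace X] (k : ℕ) (V : Set X) : Prop :=
  Nonempty (Metric.closedBall (0 : EuclideanSpace ℝ (Fin k)) 1 ≃ₜ V)

/-! ### Piles -/

/-- The source `k`-face `ψₖ[n]` and the target `k`-face `ωₖ[n]` of the `n`-cube. -/
def faceSet : Side → (n k : ℕ) → Finset (Cube n)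
  | _, 0, _ => {full 0}
  | .src, _ + 1, 0 => {fun _ => -1}
  | .tgt, _ + 1, 0 => {fun _ => 1}
  | .src, n + 1, k + 1 =>
    if n ≤ k then {full (n + 1)}
    else (faceSet .src n k).image muC ∪
      (faceSet .src n (k + 1)).image (if Even (k + 1) then lamC else nuC)
  | .tgt, n + 1, k + 1 =>
    if n ≤ k then {full (n + 1)}
    else (faceSet .tgt n (k + 1)).image (if Even (k + 1) then nuC else lamC) ∪
      (faceSet .tgt n k).image muC

/-- The source and target `k`-faces of a sub-cube `x` of the `n`-cube. -/
def faceSetAt {n : ℕ} (s : Side) (x : Cube n) (k : ℕ) : Finset (Cube n) :=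
  (faceSet s (dim x) k).image (place x)

/-- A sequence `v₀, v₁, …` of finite sets of sub-cubes of the `n`-cube; only `v₀, …, vₙ` matter. -/
abbrev PrePile (n : ℕ) : Type := ℕ → Finset (Cube n)

/-- `v₀, …, vₙ` is an `(n, n)`-pile. -/
def IsPile {n : ℕ} (v : PrePile n) : Prop :=
  ∀ j ≤ n, (v j).card = n.choose j ∧ ∀ x ∈ v j, dim x = j

/-- The symbols of the linear form of a block: cubes `x` and separators `*ᵢ`. -/
inductive Move (n : ℕ)
  | cube (x : Cube n)
  | star (i : ℕ)

/-- The linear form of a block, with `*ₖ` between consecutive `k`-blocks. -/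
def word {n : ℕ} : (k : ℕ) → Block n k → List (Move n)
  | 0, x => [.cube x]
  | k + 1, (a : List (Block n k)) => List.intercalate [.star k] (a.map (word k))

/-- When a symbol can be applied to a pile: for a cube `x`, the source faces of `x` of all
dimensions lie in the pile; for `*ᵢ`, the sets `vⱼ` with `j < i` are the target faces. -/
def Move.Applicable {n : ℕ} (m : Move n) (v : PrePile n) : Prop :=
  match m with
  | .cube x => ∀ j ≤ dim x, faceSetAt .src x j ⊆ v j
  | .star i => ∀ j < i, v j = faceSet .tgt n j

/-- The action of a symbol on a pile: a cube `x` acts by `πₓ`, replacing its source faces by its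
target faces in all dimensions up to that of `x`; the separator `*ᵢ` rewrites the target `j`-face
as the source `j`-face for all `j < i`. -/
def Move.act {n : ℕ} (m : Move n) (v : PrePile n) : PrePile n :=
  match m with
  | .cube x => fun j =>
      if j ≤ dim x then (v j \ faceSetAt .src x j) ∪ faceSetAt .tgt x j else v j
  | .star i => fun j => if j < i then faceSet .src n j else v j

/-- The pile on which `σₖ[n]` or `τₖ[n]` acts: the source faces of the `n`-cube in all dimensions,
except that for `τₖ[n]` the target face is taken in dimension `k`. -/
def initialPile (n : ℕ) (s : Side) (k : ℕ) : PrePile n := fun j =>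
  if j = k then faceSet s n k else faceSet .src n j

/-- The pile obtained by applying the symbols of a word consecutively. -/
def run {n : ℕ} (v : PrePile n) (w : List (Move n)) : PrePile n :=
  w.foldl (fun u m => m.act u) v

/-- The geometric realization `Vₖ` of the `k`-th set of a pile. -/
def pileBody {n : ℕ} (v : PrePile n) (k : ℕ) : Set (Fin n → ℝ) :=
  {p | ∃ x ∈ v k, p ∈ body x}

/-- The set `σₖ₋₁[n] ∪ τₖ₋₁[n]` in `ℝⁿ`, which is empty for `k = 0`. -/
def bdBody (n : ℕ) : ℕ → Set (Fin n → ℝ)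
  | 0 => ∅
  | k + 1 => blockBody (std n .src k) ∪ blockBody (std n .tgt k)

/-- The realizations of a pile are nested disks `V₀ ⊆ V₁ ⊆ ⋯ ⊆ Vₙ`, where `Vₖ` is a `k`-disk with
boundary `σₖ₋₁[n] ∪ τₖ₋₁[n]`. -/
def NestedDisks {n : ℕ} (v : PrePile n) : Prop :=
  (∀ k < n, pileBody v k ⊆ pileBody v (k + 1)) ∧
    ∀ k ≤ n, IsDiskWithBoundary k (pileBody v k) (bdBody n k)

end Cubical

-- Combinatorics and geometry meet in one explicit formula. The source or target `l`-faces of a cube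
-- `x` correspond to the `l`-element subsets `R` of its zeros. Every other zero `i` of `x` receives
-- a sign that depends on the side and alternates with the number of elements of `R` below `i`
-- (`faces`).
--
-- Combinatorics. A block is `Globular` if at every order its constituents, seen through the
-- multisets of faces of their cubes, form a path from the prescribed sources to the prescribed
-- targets, and a constituent of order `l` has at most one cube of dimension above `l`. A cube has
-- no faces above its own dimension, so the lower-dimensional cubes that fill out a block are
-- invisible to this condition. Sources and targets of globular blocks are globular (`bdry_spec`),
-- and `λ`, `μ`, `ν` preserve globularity (`opSpec`); hence all `σₖ[n]` and `τₖ[n]` are globular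
-- (`isStandard_std`). Since `≡` compares only multisets of faces, (i) and the first half of (ii)
-- follow.
--
-- For applicability, a signed count telescopes along the path and shows that each `k`-set of
-- directions lies in exactly one cube of a globular `k`-block (`countP_cubes`). So the `k`-faces of
-- distinct cubes have distinct sets of directions, and the cubes can be applied one after another
-- (`Globular.runs`).
--
-- Geometry. Project `ℝⁿ` to `ℝˡ` by the moments `∑ pᵢ iᵗ`, `t < l`. Polynomials with prescribed
-- roots show, as for cyclic zonotopes, that the points of the source and of the target `l`-faces of
-- a cube are exactly the extremal points for the next moment on the fibres of the projected cube
-- (`moment_le_of_mem_facesBody`, `exists_mem_facesBody`). Both unions are therefore sections over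
-- the same image. Applying a cube exchanges one section for the other, so every level of a pile
-- remains a section over the projection of the whole cube (`isSection_flipAt`). That projection is
-- a convex body, so a compact section is a disk; its boundary lies over the frontier, and this part
-- consists of the source and target faces one dimension lower (`IsSection.frontier_eq`). This gives
-- (iii). For the second half of (ii), the block `β` is met in some state of the pile, and `σⱼ(β)`
-- then fills level `j` of that state.

namespace Cubical

open Finset

/-! ### Explicit description of the faces of a cube -/

/-- The set of positions of the symbol `0` in a word. -/
def zeros {n : ℕ} (x : Cube n) : Finset (Fin n) := univ.filter fun i => x i = 0

theorem mem_zeros {n : ℕ} {x : Cube n} {i : Fin n} : i ∈ zeros x ↔ x i = 0 := by simp [zeros]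

theorem card_zeros {n : ℕ} (x : Cube n) : (zeros x).card = dim x := rfl

/-- The sign at a position preceded by `k` chosen positions, in a source or target face. -/
def Side.sign : Side → ℕ → SignType
  | .src, k => if Even k then -1 else 1
  | .tgt, k => if Even k then 1 else -1

theorem Side.sign_ne_zero (s : Side) (k : ℕ) : s.sign k ≠ 0 := by
  cases s <;> simp only [Side.sign] <;> split_ifs <;> decide

/-- The number of elements of `R` below `i`. -/
def rankIn {n : ℕ} (R : Finset (Fin n)) (i : Fin n) : ℕ := (R.filter (· < i)).card

/-- The source or target face of `x` with set of zeros `R ⊆ zeros x`. -/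
def face {n : ℕ} (s : Side) (x : Cube n) (R : Finset (Fin n)) : Cube n := fun i =>
  if i ∈ R then 0 else if x i = 0 then s.sign (rankIn R i) else x i

theorem zeros_face {n : ℕ} (s : Side) (x : Cube n) (R : Finset (Fin n)) :
    zeros (face s x R) = R := by
  ext i
  rw [mem_zeros, face]
  by_cases hi : i ∈ R
  · simp [hi]
  · by_cases hx : x i = 0 <;> simp [hi, hx, s.sign_ne_zero]

/-- The source or target `l`-faces of a cube; there are none if `l` exceeds the dimension. -/
def faces {n : ℕ} (s : Side) (l : ℕ) (x : Cube n) : Finset (Cube n) :=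
  (powersetCard l (zeros x)).image (face s x)

theorem mem_faces {n : ℕ} {s : Side} {l : ℕ} {x y : Cube n} :
    y ∈ faces s l x ↔ ∃ R ⊆ zeros x, R.card = l ∧ face s x R = y := by
  simp [faces, mem_powersetCard, and_assoc]

theorem dim_of_mem_faces {n : ℕ} {s : Side} {l : ℕ} {x y : Cube n} (h : y ∈ faces s l x) :
    dim y = l := by
  obtain ⟨R, hR, rfl, rfl⟩ := mem_faces.1 h
  rw [← card_zeros, zeros_face s x R]

theorem zeros_subset_of_mem_faces {n : ℕ} {s : Side} {l : ℕ} {x y : Cube n}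
    (h : y ∈ faces s l x) : zeros y ⊆ zeros x := by
  obtain ⟨R, hR, rfl, rfl⟩ := mem_faces.1 h
  rwa [zeros_face s x R]

theorem card_faces {n : ℕ} (s : Side) (l : ℕ) (x : Cube n) :
    (faces s l x).card = (dim x).choose l := by
  rw [faces, card_image_of_injOn, card_powersetCard, card_zeros]
  intro R _ R' _ h
  rw [← zeros_face s x R, h, zeros_face s x R']

theorem faces_eq_empty {n : ℕ} (s : Side) {l : ℕ} {x : Cube n} (h : dim x < l) :
    faces s l x = ∅ := by
  rw [← card_eq_zero, card_faces, Nat.choose_eq_zero_of_lt h]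

theorem face_zeros {n : ℕ} (s : Side) (x : Cube n) : face s x (zeros x) = x := by
  funext i
  by_cases hi : x i = 0 <;> simp [face, mem_zeros, hi]

theorem faces_dim {n : ℕ} (s : Side) (x : Cube n) : faces s (dim x) x = {x} := by
  rw [faces, ← card_zeros, powersetCard_self, image_singleton, face_zeros]

/-- The subset `R` is recovered as `zeros y`, so being a face becomes a condition on each coordinate
separately. This form makes appending a symbol and placing in a cube easy to compare. -/
theorem mem_faces_iff {n : ℕ} {s : Side} {l : ℕ} {x y : Cube n} :
    y ∈ faces s l x ↔ dim y = l ∧ (∀ i, x i ≠ 0 → y i = x i) ∧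
      ∀ i, x i = 0 → y i ≠ 0 → y i = s.sign (rankIn (zeros y) i) := by
  constructor
  · intro h
    refine ⟨dim_of_mem_faces h, ?_⟩
    obtain ⟨R, hR, rfl, rfl⟩ := mem_faces.1 h
    rw [zeros_face s x R]
    refine ⟨fun i hi => ?_, fun i hi hy => ?_⟩
    · have : i ∉ R := fun h => hi (mem_zeros.1 (hR h))
      simp [face, hi, this]
    · have : i ∉ R := fun h => hy (by simp [face, h])
      simp [face, hi, this]
  · rintro ⟨h1, h2, h3⟩
    refine mem_faces.2 ⟨zeros y, fun i hi => ?_, h1, ?_⟩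
    · rw [mem_zeros] at hi ⊢
      by_contra h
      exact h (h2 i h ▸ hi)
    · funext i
      by_cases hi : y i = 0
      · simp [face, mem_zeros, hi]
      · by_cases hx : x i = 0
        · rw [face, if_neg (by rwa [mem_zeros]), if_pos hx, h3 i hx hi]
        · rw [face, if_neg (by rwa [mem_zeros]), if_neg hx, h2 i hx]

/-! ### Appending a symbol -/

/-- Append a symbol to a word. -/
def app {n : ℕ} (c : SignType) (x : Cube n) : Cube (n + 1) :=
  Fin.snoc (α := fun _ => SignType) x c

theorem lamC_eq {n : ℕ} : (lamC : Cube n → _) = app (-1) := rfl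
theorem muC_eq {n : ℕ} : (muC : Cube n → _) = app 0 := rfl
theorem nuC_eq {n : ℕ} : (nuC : Cube n → _) = app 1 := rfl

@[simp] theorem app_castSucc {n : ℕ} (c : SignType) (x : Cube n) (i : Fin n) :
    app c x i.castSucc = x i := by simp [app]

@[simp] theorem app_last {n : ℕ} (c : SignType) (x : Cube n) :
    app c x (Fin.last n) = c := by simp [app]

theorem app_injective {n : ℕ} (c : SignType) : Function.Injective (app c : Cube n → _) := by
  intro x y h
  funext i
  simpa using congrFun h i.castSucc

theorem exists_eq_app {n : ℕ} (y : Cube (n + 1)) : ∃ d x, y = app d x :=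
  ⟨y (Fin.last n), fun i => y i.castSucc, by
    funext i; refine Fin.lastCases ?_ (fun i => ?_) i <;> simp⟩

theorem app_inj {n : ℕ} {c d : SignType} {x y : Cube n} : app c x = app d y ↔ c = d ∧ x = y := by
  constructor
  · intro h
    have h1 : c = d := by simpa using congrFun h (Fin.last n)
    subst h1
    exact ⟨rfl, app_injective _ h⟩
  · rintro ⟨rfl, rfl⟩; rfl

theorem filter_univ_castSucc {n : ℕ} (p : Fin (n + 1) → Prop) [DecidablePred p] :
    (univ.filter p).card = (univ.filter fun i : Fin n => p i.castSucc).card +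
      if p (Fin.last n) then 1 else 0 := by
  simp only [card_filter]
  exact Fin.sum_univ_castSucc _

theorem dim_app {n : ℕ} (c : SignType) (x : Cube n) :
    dim (app c x) = dim x + if c = 0 then 1 else 0 := by
  rw [dim, filter_univ_castSucc]
  simp [dim]

theorem rankIn_zeros {n : ℕ} (x : Cube n) (i : Fin n) :
    rankIn (zeros x) i = (univ.filter fun j => j < i ∧ x j = 0).card := by
  rw [rankIn, zeros, filter_filter]
  simp only [and_comm]

theorem rankIn_app_castSucc {n : ℕ} (c : SignType) (x : Cube n) (i : Fin n) :
    rankIn (zeros (app c x)) i.castSucc = rankIn (zeros x) i := by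
  rw [rankIn_zeros, rankIn_zeros, filter_univ_castSucc]
  have : ¬ (Fin.last n < i.castSucc) := by simp [Fin.le_last]
  simp [this]

theorem rankIn_app_last {n : ℕ} (c : SignType) (x : Cube n) :
    rankIn (zeros (app c x)) (Fin.last n) = dim x := by
  rw [rankIn_zeros, filter_univ_castSucc]
  simp [dim]

/-- The appended coordinate is the last one, so it changes no earlier rank. If it is not a direction
of the face, all `l` directions precede it, and its sign is `s.sign l`. -/
theorem app_mem_faces_app {n : ℕ} {s : Side} {l : ℕ} {c d : SignType} {x y : Cube n} :
    app d y ∈ faces s l (app c x) ↔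
      if c = 0 then (d = 0 ∧ ∃ m, l = m + 1 ∧ y ∈ faces s m x) ∨ (d = s.sign l ∧ y ∈ faces s l x)
      else d = c ∧ y ∈ faces s l x := by
  simp only [mem_faces_iff, Fin.forall_fin_succ', app_castSucc, app_last, rankIn_app_castSucc,
    rankIn_app_last, dim_app]
  by_cases hc : c = 0
  · subst hc
    by_cases hd : d = 0
    · subst hd
      have := s.sign_ne_zero l
      simp only [if_true, ne_eq, not_true_eq_false, false_imp_iff, and_true, true_and, imp_true_iff]
      constructor
      · rintro ⟨rfl, h⟩
        exact .inl ⟨_, rfl, rfl, h⟩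
      · rintro (⟨m, rfl, rfl, h⟩ | ⟨h, _⟩)
        · exact ⟨rfl, h⟩
        · exact absurd h.symm this
    · simp only [hd, if_true, if_false, ne_eq, not_true_eq_false, false_imp_iff, and_true,
        not_false_eq_true, true_imp_iff, false_and, false_or, add_zero]
      constructor
      · rintro ⟨rfl, h1, h2, h3⟩; exact ⟨h3, rfl, h1, h2⟩
      · rintro ⟨h3, rfl, h1, h2⟩; exact ⟨rfl, h1, h2, h3⟩
  · by_cases hd : d = c
    · subst hd; simp [hc]
    · simp [hc, hd]

theorem nodup_map_add_map {n : ℕ} {c d : SignType} (h : c ≠ d) {A B : Multiset (Cube n)}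
    (hA : A.Nodup) (hB : B.Nodup) : (A.map (app c) + B.map (app d)).Nodup := by
  rw [Multiset.nodup_add]
  refine ⟨hA.map (app_injective c), hB.map (app_injective d), ?_⟩
  rw [Multiset.disjoint_left]
  intro y hy hy'
  obtain ⟨a, -, rfl⟩ := Multiset.mem_map.1 hy
  obtain ⟨b, -, hb⟩ := Multiset.mem_map.1 hy'
  exact h (app_inj.1 hb).1.symm

/-- The faces of dimension `l - 1`, none for `l = 0`. -/
def predFaces {n : ℕ} (s : Side) (l : ℕ) (x : Cube n) : Multiset (Cube n) :=
  match l with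
  | 0 => 0
  | l + 1 => (faces s l x).val

/-- This recursion has the same shape as the one defining `σₖ[n]` and `τₖ[n]`: thickened faces of
one dimension less, plus one signed copy of the faces of the same dimension. -/
theorem faces_muC_val {n : ℕ} (s : Side) (l : ℕ) (x : Cube n) :
    (faces s l (muC x)).val =
      (predFaces s l x).map muC + (faces s l x).val.map (app (s.sign l)) := by
  have hn : (predFaces s l x).Nodup := by
    cases l with
    | zero => exact Multiset.nodup_zero
    | succ l => exact (faces s l x).nodup
  refine (Multiset.Nodup.ext (Finset.nodup _)
    (nodup_map_add_map (s.sign_ne_zero l).symm hn (Finset.nodup _))).2 fun y => ?_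
  obtain ⟨d, y, rfl⟩ := exists_eq_app y
  rw [Finset.mem_val, muC_eq, app_mem_faces_app, if_pos rfl, Multiset.mem_add, Multiset.mem_map,
    Multiset.mem_map]
  simp only [app_inj]
  refine or_congr ⟨?_, ?_⟩ ⟨?_, ?_⟩
  · rintro ⟨rfl, m, rfl, h⟩; exact ⟨y, h, rfl, rfl⟩
  · rintro ⟨y', h, rfl, rfl⟩
    cases l with
    | zero => simp [predFaces] at h
    | succ l => exact ⟨rfl, l, rfl, h⟩
  · rintro ⟨rfl, h⟩; exact ⟨y, h, rfl, rfl⟩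
  · rintro ⟨y', h, rfl, rfl⟩; exact ⟨rfl, h⟩

theorem faces_app_val {n : ℕ} (s : Side) (l : ℕ) {c : SignType} (hc : c ≠ 0) (x : Cube n) :
    (faces s l (app c x)).val = (faces s l x).val.map (app c) := by
  refine (Multiset.Nodup.ext (Finset.nodup _) ((Finset.nodup _).map (app_injective c))).2
    fun y => ?_
  obtain ⟨d, y, rfl⟩ := exists_eq_app y
  rw [Finset.mem_val, app_mem_faces_app, if_neg hc, Multiset.mem_map]
  simp only [app_inj]
  constructor
  · rintro ⟨rfl, h⟩; exact ⟨y, h, rfl, rfl⟩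
  · rintro ⟨y', h, rfl, rfl⟩; exact ⟨rfl, h⟩

theorem muC_full (n : ℕ) : muC (full n) = full (n + 1) := by
  funext i; refine Fin.lastCases ?_ (fun i => ?_) i <;> simp [muC_eq, full]

theorem dim_full (n : ℕ) : dim (full n) = n := by simp [dim, full]

/-- The bound `k ≤ n` is essential: above dimension `n` the recursive definition returns the cube
itself, whereas `faces` is empty. -/
theorem faceSet_eq_faces {n k : ℕ} (s : Side) (h : k ≤ n) : faceSet s n k = faces s k (full n) := by
  induction n generalizing k with
  | zero =>
    obtain rfl : k = 0 := by omega
    have := faces_dim s (full 0)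
    rw [dim_full] at this
    rw [this]
    cases s <;> rfl
  | succ n ih =>
    apply Finset.val_injective
    cases k with
    | zero =>
      have h0 := ih (Nat.zero_le n)
      rw [← muC_full, faces_muC_val]
      cases n with
      | zero =>
        have := faces_dim s (full 0)
        rw [dim_full] at this
        rw [this]
        cases s
        · simp only [faceSet, Finset.singleton_val, predFaces, Multiset.map_zero, zero_add, Multiset.map_singleton, Side.sign]
          congr 1
        · simp only [faceSet, Finset.singleton_val, predFaces, Multiset.map_zero, zero_add, Multiset.map_singleton, Side.sign]
          congr 1
      | succ n =>
        rw [← h0]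
        cases s
        · simp only [faceSet, Finset.singleton_val, predFaces, Multiset.map_zero, zero_add, Multiset.map_singleton, Side.sign]
          congr 1
          funext i
          refine Fin.lastCases ?_ (fun i => ?_) i <;> simp
        · simp only [faceSet, Finset.singleton_val, predFaces, Multiset.map_zero, zero_add, Multiset.map_singleton, Side.sign]
          congr 1
          funext i
          refine Fin.lastCases ?_ (fun i => ?_) i <;> simp
    | succ k =>
      by_cases hk : n ≤ k
      · obtain rfl : k = n := by omega
        have := faces_dim s (full (k + 1))
        rw [dim_full] at this
        rw [this]
        cases s <;> simp [faceSet]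
      · have e : faceSet s (n + 1) (k + 1) = (faceSet s n k).image muC ∪
            (faceSet s n (k + 1)).image (app (s.sign (k + 1))) := by
          cases s
          · simp only [faceSet, if_neg hk, Side.sign, lamC_eq, nuC_eq, apply_ite app]
          · simp only [faceSet, if_neg hk, Side.sign, lamC_eq, nuC_eq, apply_ite app]
            rw [Finset.union_comm]
        rw [e, ih (by omega), ih (by omega)]
        refine (Multiset.Nodup.ext (Finset.nodup _) (Finset.nodup _)).2 fun y => ?_
        rw [← muC_full, faces_muC_val]
        simp [predFaces]

/-! ### Placing a cube in a cube -/

/-- The increasing enumeration of the zeros of a word. -/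
def zeroEmb {n : ℕ} (x : Cube n) : Fin (dim x) ↪o Fin n := (zeros x).orderEmbOfFin rfl

theorem apply_zeroEmb {n : ℕ} (x : Cube n) (j : Fin (dim x)) : x (zeroEmb x j) = 0 :=
  mem_zeros.1 ((zeros x).orderEmbOfFin_mem rfl j)

theorem exists_zeroEmb {n : ℕ} {x : Cube n} {i : Fin n} (h : x i = 0) : ∃ j, zeroEmb x j = i := by
  have : i ∈ Set.range ((zeros x).orderEmbOfFin rfl) := by
    rw [range_orderEmbOfFin]; exact mem_zeros.2 h
  exact this

theorem map_zeroEmb_rank {n : ℕ} (x : Cube n) (p : Fin (dim x) → Prop) [DecidablePred p]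
    (q : Fin n → Prop) [DecidablePred q] (hq : ∀ j, q (zeroEmb x j) ↔ p j)
    (hx : ∀ i, q i → x i = 0) :
    (univ.filter q).card = (univ.filter p).card := by
  rw [← card_map (zeroEmb x).toEmbedding]
  congr 1
  ext i
  simp only [mem_filter, mem_univ, true_and, mem_map, RelEmbedding.coe_toEmbedding]
  constructor
  · intro hi
    obtain ⟨j, rfl⟩ := exists_zeroEmb (hx i hi)
    exact ⟨j, (hq j).1 hi, rfl⟩
  · rintro ⟨j, hj, rfl⟩
    exact (hq j).2 hj

theorem place_zeroEmb {n : ℕ} (x : Cube n) (y : Cube (dim x)) (j : Fin (dim x)) :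
    place x y (zeroEmb x j) = y j := by
  rw [place, dif_pos (apply_zeroEmb x j)]
  congr 1
  apply Fin.ext
  have := map_zeroEmb_rank x (fun j' => j' < j) (fun i => i < zeroEmb x j ∧ x i = 0)
    (fun j' => by simp [apply_zeroEmb]) (fun i hi => hi.2)
  simp only [this]
  rw [show (univ.filter fun j' => j' < j) = Finset.Iio j by ext; simp]
  simp

theorem place_of_ne {n : ℕ} {x : Cube n} (y : Cube (dim x)) {i : Fin n} (h : x i ≠ 0) :
    place x y i = x i := by
  rw [place, dif_neg h]

theorem place_injective {n : ℕ} (x : Cube n) : Function.Injective (place x) := by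
  intro y z h
  funext j
  rw [← place_zeroEmb x y, h, place_zeroEmb]

theorem dim_place {n : ℕ} (x : Cube n) (y : Cube (dim x)) : dim (place x y) = dim y := by
  refine map_zeroEmb_rank x _ _ (fun j => by rw [place_zeroEmb]) fun i hi => ?_
  by_contra h
  exact h (place_of_ne y h ▸ hi)

theorem place_full {n : ℕ} (x : Cube n) : place x (full (dim x)) = x := by
  funext i
  by_cases h : x i = 0
  · rw [place, dif_pos h, h]; rfl
  · exact place_of_ne _ h

theorem exists_place {n : ℕ} {x y : Cube n} (h : ∀ i, x i ≠ 0 → y i = x i) :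
    ∃ z, y = place x z := by
  refine ⟨fun j => y (zeroEmb x j), ?_⟩
  funext i
  by_cases hi : x i = 0
  · obtain ⟨j, rfl⟩ := exists_zeroEmb hi
    rw [place_zeroEmb]
  · rw [place_of_ne _ hi, h i hi]

theorem rankIn_place {n : ℕ} (x : Cube n) (y : Cube (dim x)) (j : Fin (dim x)) :
    rankIn (zeros (place x y)) (zeroEmb x j) = rankIn (zeros y) j := by
  rw [rankIn_zeros, rankIn_zeros]
  refine map_zeroEmb_rank x _ _ (fun j => by simp [place_zeroEmb]) fun i hi => ?_
  by_contra h
  exact h (place_of_ne y h ▸ hi.2)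

/-- All zeros of `place x z` are zeros of `x`, and these are enumerated in increasing order by
`zeroEmb x`. Ranks, and with them the sign rule, are transported unchanged. -/
theorem faces_place {n : ℕ} (s : Side) (l : ℕ) (x : Cube n) (z : Cube (dim x)) :
    faces s l (place x z) = (faces s l z).image (place x) := by
  have key : ∀ y : Cube (dim x), place x y ∈ faces s l (place x z) ↔ y ∈ faces s l z := by
    intro y
    rw [mem_faces_iff, mem_faces_iff, dim_place]
    refine and_congr_right fun _ => and_congr ⟨fun h j hj => ?_, fun h i hi => ?_⟩
      ⟨fun h j hj hj' => ?_, fun h i hi hi' => ?_⟩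
    · simpa only [place_zeroEmb] using h (zeroEmb x j) (by rwa [place_zeroEmb])
    · by_cases hx : x i = 0
      · obtain ⟨j, rfl⟩ := exists_zeroEmb hx
        simp only [place_zeroEmb] at hi ⊢
        exact h j hi
      · rw [place_of_ne _ hx, place_of_ne _ hx]
    · simpa only [place_zeroEmb, rankIn_place] using
        h (zeroEmb x j) (by rwa [place_zeroEmb]) (by rwa [place_zeroEmb])
    · by_cases hx : x i = 0
      · obtain ⟨j, rfl⟩ := exists_zeroEmb hx
        simp only [place_zeroEmb, rankIn_place] at hi hi' ⊢
        exact h j hi hi'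
      · rw [place_of_ne _ hx] at hi; exact absurd hi hx
  ext y
  rw [mem_image]
  constructor
  · intro h
    obtain ⟨w, rfl⟩ := exists_place (x := x) (y := y) fun i hi => by
      rw [(mem_faces_iff.1 h).2.1 i (by rwa [place_of_ne _ hi]), place_of_ne _ hi]
    exact ⟨w, (key w).1 h, rfl⟩
  · rintro ⟨w, hw, rfl⟩
    exact (key w).2 hw

theorem faces_place_val {n : ℕ} (s : Side) (l : ℕ) (x : Cube n) (z : Cube (dim x)) :
    (faces s l (place x z)).val = (faces s l z).val.map (place x) := by
  rw [faces_place, Finset.image_val_of_injOn (place_injective x).injOn]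

theorem faceSetAt_eq_faces {n : ℕ} (s : Side) (x : Cube n) {k : ℕ} (h : k ≤ dim x) :
    faceSetAt s x k = faces s k x := by
  rw [faceSetAt, faceSet_eq_faces s h, ← faces_place, place_full]


/-! ### The faces contributed by a block -/

/-- A list of `k`-blocks regarded as a `(k+1)`-block. -/
def ofList {n k : ℕ} (a : List (Block n k)) : Block n (k + 1) := a

/-- The list of `k`-blocks underlying a `(k+1)`-block. -/
def toList {n k : ℕ} (a : Block n (k + 1)) : List (Block n k) := a

@[simp] theorem toList_ofList {n k : ℕ} (a : List (Block n k)) : toList (ofList a) = a := rfl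

@[simp] theorem ofList_toList {n k : ℕ} (a : Block n (k + 1)) : ofList (toList a) = a := rfl

theorem ofList_rec {n k : ℕ} {p : Block n (k + 1) → Prop} (list : ∀ L, p (ofList L))
    (a : Block n (k + 1)) : p a := list (toList a)

theorem cubes_ofList {n k : ℕ} (a : List (Block n k)) :
    Block.cubes (k + 1) (ofList a) = a.flatMap (Block.cubes k) := rfl

open Block in
/-- The cubes of a block of dimension at least `l`, with multiplicity. -/
def hi {n k : ℕ} (l : ℕ) (a : Block n k) : Multiset (Cube n) :=
  Multiset.filter (fun x => l ≤ dim x) (cubes k a : Multiset (Cube n))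

/-- The sum of the sets of `l`-faces of the members of a multiset of cubes. -/
def sumFaces {n : ℕ} (s : Side) (l : ℕ) (M : Multiset (Cube n)) : Multiset (Cube n) :=
  M.bind fun x => (faces s l x).val

/-- The sum of the sets of `l`-faces of the cubes of a block. -/
def blockFaces {n k : ℕ} (s : Side) (l : ℕ) (a : Block n k) : Multiset (Cube n) :=
  sumFaces s l (Block.cubes k a : Multiset (Cube n))

/-- Cubes of dimension below `l` have no `l`-faces. This is what makes the fillers of a block
irrelevant for its sources and targets. -/
theorem sumFaces_filter {n : ℕ} (s : Side) {l m : ℕ} (h : m ≤ l) (M : Multiset (Cube n)) :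
    sumFaces s l (M.filter fun x => m ≤ dim x) = sumFaces s l M := by
  induction M using Multiset.induction_on with
  | empty => rfl
  | cons x M ih =>
    rw [sumFaces] at ih ⊢
    rw [sumFaces, Multiset.cons_bind]
    by_cases hx : m ≤ dim x
    · rw [Multiset.filter_cons_of_pos (p := fun x => m ≤ dim x) _ hx, Multiset.cons_bind, ih]; rfl
    · rw [Multiset.filter_cons_of_neg (p := fun x => m ≤ dim x) _ hx, faces_eq_empty s (by omega), ih]
      simp [sumFaces]

theorem sumFaces_add {n : ℕ} (s : Side) (l : ℕ) (M N : Multiset (Cube n)) :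
    sumFaces s l (M + N) = sumFaces s l M + sumFaces s l N := Multiset.add_bind _ _ _

@[simp] theorem sumFaces_zero {n : ℕ} (s : Side) (l : ℕ) :
    sumFaces s l (0 : Multiset (Cube n)) = 0 := rfl

theorem blockFaces_eq_hi {n k : ℕ} (s : Side) {l m : ℕ} (h : m ≤ l) (a : Block n k) :
    blockFaces s l a = sumFaces s l (hi m a) := (sumFaces_filter s h _).symm

theorem sumFaces_of_dim {n : ℕ} (s : Side) (l : ℕ) {M : Multiset (Cube n)}
    (h : ∀ x ∈ M, dim x = l) : sumFaces s l M = M := by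
  induction M using Multiset.induction_on with
  | empty => rfl
  | cons x M ih =>
    rw [sumFaces, Multiset.cons_bind, ← sumFaces, ih fun y hy => h y (Multiset.mem_cons_of_mem hy)]
    have := h x (Multiset.mem_cons_self _ _)
    subst this
    rw [faces_dim]
    rfl

theorem hi_hi {n k : ℕ} {l m : ℕ} (h : m ≤ l) (a : Block n k) :
    hi l a = (hi m a).filter fun x => l ≤ dim x := by
  rw [hi, hi, Multiset.filter_filter]
  exact Multiset.filter_congr fun x _ => ⟨fun hx => ⟨hx, h.trans hx⟩, fun hx => hx.1⟩

theorem hi_eq_zero_of_dim {n k : ℕ} {l m : ℕ} (h : m < l) {a : Block n k}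
    (ha : ∀ x ∈ hi m a, dim x = m) : hi l a = 0 := by
  rw [hi_hi h.le, Multiset.filter_eq_nil]
  intro x hx
  rw [ha x hx]
  omega

theorem dim_of_mem_blockFaces {n k : ℕ} {s : Side} {l : ℕ} {a : Block n k} {x : Cube n}
    (h : x ∈ blockFaces s l a) : dim x = l := by
  rw [blockFaces, sumFaces, Multiset.mem_bind] at h
  obtain ⟨y, -, hy⟩ := h
  exact dim_of_mem_faces (s := s) (x := y) hy

section lists
variable {n k : ℕ}

@[simp] theorem hi_nil (l : ℕ) : hi l (ofList ([] : List (Block n k))) = 0 := rfl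

@[simp] theorem hi_cons (l : ℕ) (b : Block n k) (a : List (Block n k)) :
    hi l (ofList (b :: a)) = hi l b + hi l (ofList a) := by
  simp [hi, cubes_ofList]

@[simp] theorem hi_append (l : ℕ) (a b : List (Block n k)) :
    hi l (ofList (a ++ b)) = hi l (ofList a) + hi l (ofList b) := by
  simp [hi, cubes_ofList]

theorem hi_map {m : ℕ} (l l' : ℕ) (f : Block n k → Block m k)
    (g : Multiset (Cube n) → Multiset (Cube m)) (g0 : g 0 = 0)
    (gadd : ∀ A B, g (A + B) = g A + g B) (a : List (Block n k))
    (h : ∀ b ∈ a, hi l (f b) = g (hi l' b)) :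
    hi l (ofList (a.map f)) = g (hi l' (ofList a)) := by
  induction a with
  | nil => exact g0.symm
  | cons b a ih =>
    rw [List.map_cons, hi_cons, hi_cons, gadd, h b List.mem_cons_self,
      ih fun c hc => h c (List.mem_cons_of_mem _ hc)]

@[simp] theorem blockFaces_cons (s : Side) (l : ℕ) (b : Block n k) (a : List (Block n k)) :
    blockFaces s l (ofList (b :: a)) =
      blockFaces s l b + blockFaces s l (ofList a) := by
  simp [blockFaces, cubes_ofList, sumFaces, ← Multiset.coe_add, Multiset.add_bind]

@[simp] theorem blockFaces_append (s : Side) (l : ℕ) (a b : List (Block n k)) :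
    blockFaces s l (ofList (a ++ b)) =
      blockFaces s l (ofList a) + blockFaces s l (ofList b) := by
  simp [blockFaces, cubes_ofList, sumFaces, ← Multiset.coe_add, Multiset.add_bind]

end lists

theorem blockFaces_eq_zero {n k : ℕ} (s : Side) {l : ℕ} {a : Block n k} (h : hi l a = 0) :
    blockFaces s l a = 0 := by
  rw [blockFaces_eq_hi s le_rfl, h, sumFaces_zero]

theorem hi_mono {n k : ℕ} {l m : ℕ} (h : m ≤ l) {a : Block n k} (ha : hi m a = 0) :
    hi l a = 0 := by
  rw [hi_hi h, ha, Multiset.filter_zero]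

/-- Only cubes of dimension exactly `l` contribute, and each is its own unique `l`-face. In
particular the source and target multisets coincide. -/
theorem blockFaces_of_hi_succ {n k : ℕ} (s : Side) {l : ℕ} {a : Block n k}
    (h : hi (l + 1) a = 0) : blockFaces s l a = hi l a := by
  rw [blockFaces_eq_hi s le_rfl, sumFaces_of_dim]
  intro x hx
  have h1 := (Multiset.mem_filter.1 hx).2
  rw [hi_hi l.le_succ, Multiset.filter_eq_nil] at h
  have := h x hx
  omega

/-! ### Globular blocks -/

/-- A list of `k`-blocks, each satisfying `p`, whose `k`-faces lead from `A` to `B`. -/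
def Path {n k : ℕ} (p : Block n k → Prop) :
    Multiset (Cube n) → Multiset (Cube n) → List (Block n k) → Prop
  | A, B, [] => A = B
  | A, B, b :: L => p b ∧ blockFaces .src k b = A ∧ Path p (blockFaces .tgt k b) B L

/-- A `k`-block is globular with respect to a family of sources and targets if the faces of its
constituents of each lower order lead from the given sources to the given targets, and each
constituent of order `l` has at most one cube of dimension exceeding `l`. -/
def Globular {n : ℕ} (F : Side → ℕ → Multiset (Cube n)) : (k : ℕ) → Block n k → Prop
  | 0, _ => True
  | k + 1, a =>
    toList a ≠ [] ∧
      Path (fun b => Globular F k b ∧ (hi (k + 1) b).card ≤ 1) (F .src k) (F .tgt k) (toList a)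

theorem Path.append {n k : ℕ} {p : Block n k → Prop} {A B C : Multiset (Cube n)}
    {L M : List (Block n k)} (h : Path p A B L) (h' : Path p B C M) : Path p A C (L ++ M) := by
  induction L generalizing A with
  | nil => cases h; exact h'
  | cons b L ih => exact ⟨h.1, h.2.1, ih h.2.2⟩

theorem Path.of_append {n k : ℕ} {p : Block n k → Prop} {A C : Multiset (Cube n)}
    {L M : List (Block n k)} (h : Path p A C (L ++ M)) : ∃ B, Path p A B L ∧ Path p B C M := by
  induction L generalizing A with
  | nil => exact ⟨A, rfl, h⟩
  | cons b L ih =>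
    obtain ⟨B, h1, h2⟩ := ih h.2.2
    exact ⟨B, ⟨h.1, h.2.1, h1⟩, h2⟩

theorem Path.mem {n k : ℕ} {p : Block n k → Prop} {A C : Multiset (Cube n)}
    {L : List (Block n k)} (h : Path p A C L) : ∀ b ∈ L, p b := by
  induction L generalizing A with
  | nil => simp
  | cons b L ih =>
    intro c hc
    rcases List.mem_cons.1 hc with rfl | hc
    · exact h.1
    · exact ih h.2.2 c hc

theorem Path.single {n k : ℕ} {p : Block n k → Prop} {b : Block n k} (h : p b) :
    Path p (blockFaces .src k b) (blockFaces .tgt k b) [b] := ⟨h, rfl, rfl⟩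

theorem Path.map {n m k : ℕ} {p : Block n k → Prop} {q : Block m k → Prop}
    {A C : Multiset (Cube n)} {L : List (Block n k)} (h : Path p A C L) (f : Block n k → Block m k)
    (g : Multiset (Cube n) → Multiset (Cube m)) (hq : ∀ b ∈ L, p b → q (f b))
    (hg : ∀ b ∈ L, p b → ∀ s, blockFaces s k (f b) = g (blockFaces s k b)) :
    Path q (g A) (g C) (L.map f) := by
  induction L generalizing A with
  | nil => exact congrArg g h
  | cons b L ih =>
    obtain ⟨h1, rfl, h3⟩ := h
    refine ⟨hq b List.mem_cons_self h1, hg b List.mem_cons_self h1 _, ?_⟩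
    rw [hg b List.mem_cons_self h1]
    exact ih h3 (fun c hc => hq c (List.mem_cons_of_mem _ hc))
      fun c hc => hg c (List.mem_cons_of_mem _ hc)

theorem Path.mono {n k : ℕ} {p q : Block n k → Prop} {A C : Multiset (Cube n)}
    {L : List (Block n k)} (h : Path p A C L) (hq : ∀ b ∈ L, p b → q b) : Path q A C L := by
  have := h.map (q := q) id id hq fun _ _ _ _ => rfl
  rwa [List.map_id] at this

theorem Path.flatMap {n m k : ℕ} {k' : ℕ} {p : Block n k → Prop} {q : Block m k' → Prop}
    {A C : Multiset (Cube n)} {L : List (Block n k)} (h : Path p A C L)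
    (f : Block n k → List (Block m k')) (g : Multiset (Cube n) → Multiset (Cube m))
    (hf : ∀ b ∈ L, p b → Path q (g (blockFaces .src k b)) (g (blockFaces .tgt k b)) (f b)) :
    Path q (g A) (g C) (L.flatMap f) := by
  induction L generalizing A with
  | nil => exact congrArg g h
  | cons b L ih =>
    obtain ⟨h1, rfl, h3⟩ := h
    rw [List.flatMap_cons]
    exact (hf b List.mem_cons_self h1).append (ih h3 fun c hc => hf c (List.mem_cons_of_mem _ hc))

theorem Globular.congr {n : ℕ} {F G : Side → ℕ → Multiset (Cube n)} {k : ℕ} {a : Block n k}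
    (h : Globular F k a) (hFG : ∀ s, ∀ l < k, F s l = G s l) : Globular G k a := by
  induction k with
  | zero => trivial
  | succ k ih =>
    refine ⟨h.1, ?_⟩
    rw [← hFG _ k k.lt_succ_self, ← hFG _ k k.lt_succ_self]
    exact h.2.mono fun b _ hb => ⟨ih hb.1 fun s l hl => hFG s l (hl.trans k.lt_succ_self), hb.2⟩

theorem Path.start {n k : ℕ} {p : Block n k → Prop} {A C : Multiset (Cube n)}
    {b : Block n k} {L : List (Block n k)} (h : Path p A C L) (hb : b ∈ L.head?) :
    blockFaces .src k b = A := by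
  cases L with
  | nil => simp at hb
  | cons c L => simp at hb; subst hb; exact h.2.1

theorem Path.finish {n k : ℕ} {p : Block n k → Prop} {A C : Multiset (Cube n)}
    {b : Block n k} {L : List (Block n k)} (h : Path p A C L) (hb : b ∈ L.getLast?) :
    blockFaces .tgt k b = C := by
  obtain ⟨L, rfl⟩ := List.getLast?_eq_some_iff.1 hb
  obtain ⟨B, -, h⟩ := h.of_append
  exact h.2.2

/-! ### Whiskering -/

theorem incl_self {n j : ℕ} (h : j ≤ j) (a : Block n j) : Block.incl h a = a := Nat.leRec_self _ _

theorem incl_succ {n j k : ℕ} (h : j ≤ k) (h' : j ≤ k + 1) (a : Block n j) :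
    Block.incl h' a = ofList [Block.incl h a] :=
  Nat.leRec_succ _ _ h

theorem mapSub_self {n j : ℕ} (h : j ≤ j) (f : Block n j → Block n j) : Block.mapSub h f = f := Nat.leRec_self _ _

theorem mapSub_succ {n j k : ℕ} (h : j ≤ k) (h' : j ≤ k + 1) (f : Block n j → Block n j)
    (a : List (Block n k)) : Block.mapSub h' f (ofList a) = ofList (a.map (Block.mapSub h f)) :=
  congrFun (Nat.leRec_succ (motive := fun k _ => Block n k → Block n k) f
    (fun k _ g => (List.map g : List (Block n k) → List (Block n k))) h) a

theorem hi_incl {n j k : ℕ} (h : j ≤ k) (a : Block n j) (l : ℕ) :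
    hi l (Block.incl h a) = hi l a := by
  induction k, h using Nat.le_induction with
  | base => rw [incl_self]
  | succ k hk ih =>
    rw [incl_succ hk, hi_cons, ih, hi_nil, add_zero]

/-- At orders `l ≥ j` the included block is a one-term sequence, so its endpoints there are the
faces of `a` itself; below `j` the old endpoints survive. -/
theorem globular_incl {n j k : ℕ} (h : j ≤ k) {F : Side → ℕ → Multiset (Cube n)} {a : Block n j}
    (ha : Globular F j a) (h1 : (hi (j + 1) a).card ≤ 1) :
    Globular (fun s l => if l < j then F s l else blockFaces s l a) k (Block.incl h a) := by
  induction k, h using Nat.le_induction with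
  | base =>
    rw [incl_self]
    exact ha.congr fun s l hl => by rw [if_pos hl]
  | succ k hk ih =>
    rw [incl_succ hk]
    refine ⟨by simp, ?_⟩
    simp only [if_neg (not_lt.2 hk)]
    have : ∀ s, blockFaces s k a = blockFaces s k (Block.incl hk a) := fun s => by
      rw [blockFaces_eq_hi s le_rfl, blockFaces_eq_hi s le_rfl, hi_incl]
    rw [this, this]
    refine Path.single ⟨ih, ?_⟩
    rw [hi_incl, hi_hi (Nat.succ_le_succ hk)]
    exact (Multiset.card_le_card (Multiset.filter_le _ _)).trans h1

/-- Juxtapose the terms of `pre` and `post` before and after those of a block. -/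
def whisker {n j : ℕ} (pre post : List (Block n j)) (d : Block n (j + 1)) : Block n (j + 1) :=
  ofList (pre ++ toList d ++ post)

/-- At order `j` the paths `pre`, block, `post` are concatenated. At higher orders `pre` and `post`
contain only cubes of dimension at most `j + 1`, so they add the same constant multiset to every
source and target of the path. -/
theorem globular_mapSub {n j : ℕ} {F G : Side → ℕ → Multiset (Cube n)} {pre post : List (Block n j)}
    (hpre : Path (fun b => Globular F j b ∧ (hi (j + 1) b).card ≤ 1) (F .src j) (G .src j) pre)
    (hpost : Path (fun b => Globular F j b ∧ (hi (j + 1) b).card ≤ 1) (G .tgt j) (F .tgt j) post)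
    (hpre' : hi (j + 2) (ofList pre) = 0) (hpost' : hi (j + 2) (ofList post) = 0)
    (hFG : ∀ s, ∀ l < j, G s l = F s l)
    {k : ℕ} (h : j + 1 ≤ k) (Γ : Block n k) (hΓ : Globular G k Γ) :
    Globular (fun s l => if l < j + 1 then F s l else
        G s l + (blockFaces s l (ofList pre) + blockFaces s l (ofList post))) k
      (Block.mapSub h (whisker pre post) Γ) ∧
    (∀ l, j + 2 ≤ l → hi l (Block.mapSub h (whisker pre post) Γ) = hi l Γ) ∧
    ∀ s, blockFaces s k (Block.mapSub h (whisker pre post) Γ) =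
      blockFaces s k Γ + (blockFaces s k (ofList pre) + blockFaces s k (ofList post)) := by
  induction k, h using Nat.le_induction with
  | base =>
    induction Γ using ofList_rec with | list L =>
    rw [mapSub_self, whisker]
    refine ⟨⟨?_, ?_⟩, fun l hl => ?_, fun s => ?_⟩
    · simp only [toList_ofList]
      simp [show L ≠ [] from hΓ.1]
    · simp only [if_pos j.lt_succ_self]
      refine Path.mono (p := fun b => Globular F j b ∧ (hi (j + 1) b).card ≤ 1) ?_ fun b _ hb =>
        ⟨hb.1.congr fun s l hl => by rw [if_pos (hl.trans j.lt_succ_self)], hb.2⟩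
      refine (hpre.append ?_).append hpost
      exact hΓ.2.mono fun b _ hb => ⟨hb.1.congr hFG, hb.2⟩
    · rw [toList_ofList, hi_append, hi_append, hi_mono hl hpre', hi_mono hl hpost', zero_add, add_zero]
    · rw [toList_ofList, blockFaces_append, blockFaces_append]
      abel
  | succ k hk ih =>
    induction Γ using ofList_rec with | list L =>
    have whiskers_eq : ∀ s, blockFaces s k (ofList pre) + blockFaces s k (ofList post) =
        hi k (ofList pre) + hi k (ofList post) := fun s => by
      rw [blockFaces_of_hi_succ s (hi_mono (Nat.succ_le_succ hk) hpre'),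
        blockFaces_of_hi_succ s (hi_mono (Nat.succ_le_succ hk) hpost')]
    have key : ∀ l, j + 2 ≤ l → hi l (Block.mapSub (hk.trans k.le_succ) (whisker pre post)
        (ofList L)) = hi l (ofList L) := by
      intro l hl
      rw [mapSub_succ hk]
      exact hi_map l l _ id rfl (fun _ _ => rfl) _ fun b hb => (ih b (hΓ.2.mem b hb).1).2.1 l hl
    refine ⟨?_, key, fun s => ?_⟩
    · rw [mapSub_succ hk]
      refine ⟨fun h => hΓ.1 (List.map_eq_nil_iff.1 h), ?_⟩
      simp only [if_neg (not_lt.2 hk), toList_ofList]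
      rw [whiskers_eq .src, whiskers_eq .tgt]
      refine hΓ.2.map _ (fun M => M + (hi k (ofList pre) + hi k (ofList post)))
        (fun b _ hb => ⟨(ih b hb.1).1, ?_⟩) fun b _ hb s => ?_
      · rw [(ih b hb.1).2.1 _ (Nat.succ_le_succ hk)]
        exact hb.2
      · rw [(ih b hb.1).2.2 s, whiskers_eq s]
    · rw [blockFaces_eq_hi s (show j + 2 ≤ k + 1 by omega), key _ le_rfl,
        ← blockFaces_eq_hi s (show j + 2 ≤ k + 1 by omega),
        blockFaces_eq_zero s (hi_mono (by omega) hpre'),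
        blockFaces_eq_zero s (hi_mono (by omega) hpost'), add_zero, add_zero]


/-! ### Sources and targets of globular blocks -/

/-- `E` assigns to every cube and every `k` a globular `k`-block made of its `k`-faces. -/
def IsBoundary {n : ℕ} (E : Side → (k : ℕ) → Cube n → Block n k) : Prop :=
  ∀ s k x, Globular (fun t l => (faces t l x).val) k (E s k x) ∧ hi k (E s k x) = (faces s k x).val

theorem cube_rec {n : ℕ} {p : Block n 0 → Prop} (cube : ∀ x : Cube n, p (Block.ofCube 0 x))
    (a : Block n 0) : p a := cube a

theorem cubes_zero {n : ℕ} (x : Cube n) : Block.cubes 0 (Block.ofCube 0 x) = [x] := rfl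

theorem hi_cube {n : ℕ} (l : ℕ) (x : Cube n) :
    hi l (Block.ofCube 0 x) = if l ≤ dim x then {x} else 0 := by
  rw [hi, cubes_zero]
  exact Multiset.filter_singleton _

theorem blockFaces_cube {n : ℕ} (s : Side) (l : ℕ) (x : Cube n) :
    blockFaces s l (Block.ofCube 0 x) = (faces s l x).val := by
  simp [blockFaces, cubes_zero, sumFaces]

theorem foldr_max_le {k : ℕ} (L : List ℕ) : L.foldr max 0 ≤ k ↔ ∀ x ∈ L, x ≤ k := by
  induction L with
  | nil => simp
  | cons b L ih => simp [ih]

theorem bdim_le_iff {n k l : ℕ} (a : Block n k) : a.bdim ≤ l ↔ hi (l + 1) a = 0 := by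
  rw [hi, Multiset.filter_eq_nil, Block.bdim, foldr_max_le]
  simp

section bdry
variable {n : ℕ} (E : Side → (k : ℕ) → Cube n → Block n k)

theorem bdry_of_lt_src {j k : ℕ} (h : k < j + 1) {a : List (Block n j)} {b : Block n j}
    (hb : a.head? = some b) : bdry E .src (j + 1) k (ofList a) = bdry E .src j k b := by
  have : bdry E .src (j + 1) k (ofList a) = (a.head?.map (bdry E .src j k)).getD default :=
    dif_pos h
  rw [this, hb]; rfl

theorem bdry_of_lt_tgt {j k : ℕ} (h : k < j + 1) {a : List (Block n j)} {b : Block n j}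
    (hb : a.getLast? = some b) : bdry E .tgt (j + 1) k (ofList a) = bdry E .tgt j k b := by
  have : bdry E .tgt (j + 1) k (ofList a) = (a.getLast?.map (bdry E .tgt j k)).getD default :=
    dif_pos h
  rw [this, hb]; rfl

theorem bdry_self (s : Side) (j : ℕ) (a : List (Block n j)) :
    bdry E s (j + 1) (j + 1) (ofList a) =
      ofList (a.flatMap fun b => toList (bdry E s j (j + 1) b)) := by
  exact (dif_neg (lt_irrefl _)).trans (dif_pos rfl)

theorem bdry_of_gt (s : Side) {j k : ℕ} (h : j + 1 < k) (a : List (Block n j)) :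
    bdry E s (j + 1) k (ofList a) =
      match a.dropWhile (fun b => decide (b.bdim ≤ k)) with
      | [] => Block.incl h.le (ofList a)
      | c :: post => Block.mapSub h.le
          (whisker (a.takeWhile (fun b => decide (b.bdim ≤ k))) post) (bdry E s j k c) :=
  (dif_neg (by omega)).trans (dif_neg (by omega))

theorem bdry_of_dim_le (s : Side) {j k : ℕ} (h : j + 1 < k) {a : List (Block n j)}
    (ha : hi (k + 1) (ofList a) = 0) : bdry E s (j + 1) k (ofList a) = Block.incl h.le (ofList a) := by
  have : a.dropWhile (fun b => decide (b.bdim ≤ k)) = [] := by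
    rw [List.dropWhile_eq_nil_iff]
    intro b hb
    rw [decide_eq_true_eq, bdim_le_iff]
    obtain ⟨u, v, rfl⟩ := List.append_of_mem hb
    simp at ha
    exact ha.2.1
  rw [bdry_of_gt _ _ h, this]

theorem bdry_of_dim_gt (s : Side) {j k : ℕ} (h : j + 1 < k) {pre post : List (Block n j)}
    {c : Block n j} (hpre : hi (k + 1) (ofList pre) = 0) (hc : hi (k + 1) c ≠ 0) :
    bdry E s (j + 1) k (ofList (pre ++ c :: post)) =
      Block.mapSub h.le (whisker pre post) (bdry E s j k c) := by
  have hall : ∀ b ∈ pre, decide (b.bdim ≤ k) = true := by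
    intro b hb
    rw [decide_eq_true_eq, bdim_le_iff]
    obtain ⟨u, v, rfl⟩ := List.append_of_mem hb
    simp at hpre
    exact hpre.2.1
  have hc' : decide (c.bdim ≤ k) = false := by
    rwa [decide_eq_false_iff_not, bdim_le_iff]
  rw [bdry_of_gt _ _ h, List.dropWhile_append_of_pos hall, List.takeWhile_append_of_pos hall,
    List.dropWhile_cons_of_neg (by simp [hc']), List.takeWhile_cons_of_neg (by simp [hc']),
    List.append_nil]

theorem exists_split {j l : ℕ} (a : List (Block n j)) (h : hi l (ofList a) ≠ 0) :
    ∃ pre c post, a = pre ++ c :: post ∧ hi l (ofList pre) = 0 ∧ hi l c ≠ 0 := by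
  induction a with
  | nil => exact absurd rfl h
  | cons b a ih =>
    by_cases hb : hi l b = 0
    · obtain ⟨pre, c, post, rfl, h1, h2⟩ := ih (by simpa [hb] using h)
      exact ⟨b :: pre, c, post, rfl, by simp [hb, h1], h2⟩
    · exact ⟨[], b, a, rfl, rfl, hb⟩

variable {E}

/-- The three cases of the description of `bdry E s j k a` for a globular block `a`. -/
theorem bdry_spec (hE : IsBoundary E) (s : Side) (k j : ℕ) {F : Side → ℕ → Multiset (Cube n)}
    (a : Block n j) (ha : Globular F j a) :
    (k < j → Globular F k (bdry E s j k a) ∧ hi k (bdry E s j k a) = F s k) ∧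
    (k = j → Globular F k (bdry E s j k a) ∧ hi k (bdry E s j k a) = blockFaces s k a) ∧
    (j < k → (hi (j + 1) a).card ≤ 1 →
      Globular (fun t l => if l < j then F t l else blockFaces t l a) k (bdry E s j k a) ∧
        hi k (bdry E s j k a) = blockFaces s k a) := by
  induction j generalizing F k with
  | zero =>
    refine ⟨fun h => absurd h (Nat.not_lt_zero _), ?_, fun h _ => ?_⟩
    · rintro rfl
      exact ⟨trivial, (hE s 0 a).2.trans (blockFaces_cube s 0 a).symm⟩
    · refine ⟨(hE s k a).1.congr fun t l _ => ?_, (hE s k a).2.trans (blockFaces_cube s k a).symm⟩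
      exact (blockFaces_cube t l a).symm
  | succ j ih =>
    induction a using ofList_rec with | list a =>
    have hmem := ha.2.mem
    refine ⟨fun h => ?_, ?_, fun h h1 => ?_⟩
    · have hne : a ≠ [] := ha.1
      -- The endpoint condition is needed only for `k = j`: the first constituent starts at `F .src
      -- j` and the last one ends at `F .tgt j`.
      have key : ∀ b ∈ a, blockFaces s j b = F s j ∨ k < j →
          Globular F k (bdry E s j k b) ∧ hi k (bdry E s j k b) = F s k := by
        intro b hb hb'
        rcases Nat.lt_succ_iff_lt_or_eq.1 h with h' | rfl
        · exact (ih k b (hmem b hb).1).1 h'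
        · have := (ih k b (hmem b hb).1).2.1 rfl
          rcases hb' with hb' | hb'
          · rwa [hb'] at this
          · exact absurd hb' (lt_irrefl _)
      cases s with
      | src =>
        obtain ⟨b, hb⟩ := Option.isSome_iff_exists.1 (List.isSome_head?.2 hne)
        rw [bdry_of_lt_src E h hb]
        exact key b (List.mem_of_head? hb) (.inl (ha.2.start hb))
      | tgt =>
        obtain ⟨b, hb⟩ : ∃ b, a.getLast? = some b := ⟨_, List.getLast?_eq_some_getLast hne⟩
        rw [bdry_of_lt_tgt E h hb]
        exact key b (List.mem_of_getLast? hb) (.inl (ha.2.finish hb))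
    · rintro rfl
      rw [bdry_self]
      have hb := fun b hb => (ih (j + 1) b (hmem b hb).1).2.2 j.lt_succ_self (hmem b hb).2
      refine ⟨⟨?_, ?_⟩, ?_⟩
      · obtain ⟨b, a', rfl⟩ := List.exists_cons_of_ne_nil ha.1
        have := (hb b List.mem_cons_self).1.1
        simp only [toList_ofList, List.flatMap_cons]
        exact List.append_ne_nil_of_left_ne_nil this _
      · refine ha.2.flatMap _ id fun b hba _ => ?_
        have h2 := (hb b hba).1.2
        simp only [lt_irrefl, if_false] at h2
        exact h2.mono fun c _ hc => ⟨hc.1.congr fun t l hl => if_pos hl, hc.2⟩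
      · clear ha
        induction a with
        | nil => rfl
        | cons b a iha =>
          rw [List.flatMap_cons, hi_append, blockFaces_cons, ofList_toList,
            (hb b List.mem_cons_self).2,
            iha (fun c hc => hmem c (List.mem_cons_of_mem _ hc))
              fun c hc => hb c (List.mem_cons_of_mem _ hc)]
    · by_cases h0 : hi (k + 1) (ofList a) = 0
      · rw [bdry_of_dim_le E s h h0]
        refine ⟨globular_incl h.le ha h1, ?_⟩
        rw [hi_incl, blockFaces_of_hi_succ s h0]
      · obtain ⟨pre, c, post, rfl, hpre, hc⟩ := exists_split a h0
        have hc2 : hi (j + 2) c ≠ 0 := fun h' => hc (hi_mono (by omega) h')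
        -- The single cube of dimension above `j + 1` allowed in `a` sits in `c`. So `pre` and
        -- `post` have none, as whiskering requires.
        have h1' : (hi (j + 2) (ofList pre)).card + ((hi (j + 2) c).card +
            (hi (j + 2) (ofList post)).card) ≤ 1 := by
          simpa using h1
        have hc3 := Multiset.card_pos.2 hc2
        have hpre2 : hi (j + 2) (ofList pre) = 0 := Multiset.card_eq_zero.1 (by omega)
        have hpost2 : hi (j + 2) (ofList post) = 0 := Multiset.card_eq_zero.1 (by omega)
        obtain ⟨B, p1, p2⟩ := ha.2.of_append
        obtain ⟨p3, rfl, p4⟩ := p2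
        obtain ⟨g1, g2⟩ := (ih k c p3.1).2.2 (by omega) p3.2
        rw [bdry_of_dim_gt E s h hpre hc]
        obtain ⟨w1, w2, w3⟩ := globular_mapSub
          (G := fun t l => if l < j then F t l else blockFaces t l c)
          (by simpa only [lt_irrefl, if_false] using p1)
          (by simpa only [lt_irrefl, if_false] using p4) hpre2 hpost2
          (fun t l hl => if_pos hl) h.le _ g1
        refine ⟨w1.congr fun t l hl => ?_, ?_⟩
        · by_cases hlj : l < j + 1
          · simp only [if_pos hlj]
          · simp only [if_neg hlj, if_neg (show ¬ l < j by omega), blockFaces_append,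
              blockFaces_cons]
            abel
        · rw [w2 k h, g2, blockFaces_append, blockFaces_cons,
            blockFaces_eq_zero s (hi_mono h hpre2), blockFaces_eq_zero s (hi_mono h hpost2),
            zero_add, add_zero]

end bdry


/-! ### The operations `λ`, `μ`, `ν` on globular blocks -/

/-- The source and target faces of the `n`-cube. -/
def frame (n : ℕ) (s : Side) (l : ℕ) : Multiset (Cube n) := (faces s l (full n)).val

/-- Append the sign of the `s`-face of order `k`, and add the thickened `(k-1)`-faces. -/
def extend {n : ℕ} (s : Side) (k : ℕ) (A : Multiset (Cube n)) : Multiset (Cube (n + 1)) :=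
  (predFaces s k (full n)).map muC + A.map (app (s.sign k))

theorem frame_succ (n : ℕ) (s : Side) (k : ℕ) : frame (n + 1) s k = extend s k (frame n s k) := by
  rw [frame, ← muC_full, faces_muC_val]; rfl

theorem dim_muC {n : ℕ} (x : Cube n) : dim (muC x) = dim x + 1 := by
  rw [muC_eq, dim_app, if_pos rfl]

theorem dim_app_of_ne {n : ℕ} {c : SignType} (hc : c ≠ 0) (x : Cube n) : dim (app c x) = dim x := by
  rw [dim_app, if_neg hc, add_zero]

theorem sumFaces_map_app {n : ℕ} (s : Side) (l : ℕ) {c : SignType} (hc : c ≠ 0)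
    (M : Multiset (Cube n)) : sumFaces s l (M.map (app c)) = (sumFaces s l M).map (app c) := by
  simp only [sumFaces, Multiset.bind_map, Multiset.map_bind, faces_app_val s l hc]

theorem sumFaces_map_muC {n : ℕ} (s : Side) (l : ℕ) (M : Multiset (Cube n)) :
    sumFaces s (l + 1) (M.map muC) =
      (sumFaces s l M).map muC + (sumFaces s (l + 1) M).map (app (s.sign (l + 1))) := by
  simp only [sumFaces, Multiset.bind_map, Multiset.map_bind, faces_muC_val, Multiset.bind_add]
  rfl

theorem dim_of_mem_predFaces {n k : ℕ} {s : Side} {x y : Cube n} (h : y ∈ predFaces s k x) :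
    dim y + 1 = k := by
  cases k with
  | zero => exact absurd h (Multiset.notMem_zero _)
  | succ k => rw [dim_of_mem_faces (s := s) (x := x) (Finset.mem_val ▸ h)]

theorem filter_map_app {n : ℕ} (l : ℕ) {c : SignType} (hc : c ≠ 0) (M : Multiset (Cube n)) :
    (M.map (app c)).filter (fun x => l ≤ dim x) = (M.filter fun x => l ≤ dim x).map (app c) := by
  rw [Multiset.filter_map]
  congr 1
  exact Multiset.filter_congr fun x _ => by simp [dim_app_of_ne hc]

theorem filter_map_muC {n : ℕ} (l : ℕ) (M : Multiset (Cube n)) :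
    (M.map muC).filter (fun x => l + 1 ≤ dim x) = (M.filter fun x => l ≤ dim x).map muC := by
  rw [Multiset.filter_map]
  congr 1
  exact Multiset.filter_congr fun x _ => by simp [dim_muC]

/-- The other side. -/
def Side.flip : Side → Side
  | .src => .tgt
  | .tgt => .src

theorem Side.sign_succ (s : Side) (k : ℕ) : s.sign (k + 1) = s.flip.sign k := by
  cases s <;> simp only [Side.sign, Side.flip, Nat.even_add_one] <;> split_ifs <;> simp_all

section operations
variable {n : ℕ} (S : Side → (k : ℕ) → Block n k) (E : Side → (k : ℕ) → Cube n → Block n k)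

/-- Whichever of `λₖ` and `νₖ` is used for the `s`-face of order `k`. -/
def faceOp (s : Side) (k : ℕ) : Block n k → Block (n + 1) k :=
  if s.sign k = -1 then lamB S E k else nuB S E k

theorem faceOp_zero (s : Side) (x : Cube n) :
    faceOp S E s 0 (Block.ofCube 0 x) = Block.ofCube 0 (app (s.sign 0) x) := by
  cases s <;> rfl

/-- The parity cases in the definitions of `λ` and `ν` merge once the operation is named by a side:
passing from order `k` to `k + 1` exchanges the two sides. -/
theorem faceOp_succ_src (k : ℕ) (a : List (Block n k)) :
    faceOp S E .src (k + 1) (ofList a) =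
      ofList (muB S E k (S .src k) ++ a.map (faceOp S E .tgt k)) := by
  by_cases hk : Even k
  · have h1 : Odd (k + 1) := hk.add_one
    have h2 : ¬ Even (k + 1) := Nat.not_even_iff_odd.2 h1
    simp only [faceOp, Side.sign, if_pos hk, if_neg h2]
    rw [if_neg (by decide), if_neg (by decide)]
    exact if_pos h1
  · have h1 : ¬ Odd (k + 1) := fun h => hk (by simpa [Nat.odd_add_one] using h)
    have h2 : Even (k + 1) := Nat.not_odd_iff_even.1 h1
    simp only [faceOp, Side.sign, if_neg hk, if_pos h2]
    exact if_neg h1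

theorem faceOp_succ_tgt (k : ℕ) (a : List (Block n k)) :
    faceOp S E .tgt (k + 1) (ofList a) =
      ofList (a.map (faceOp S E .src k) ++ muB S E k (S .tgt k)) := by
  by_cases hk : Even k
  · have h1 : Odd (k + 1) := hk.add_one
    have h2 : ¬ Even (k + 1) := Nat.not_even_iff_odd.2 h1
    simp only [faceOp, Side.sign, if_pos hk, if_neg h2]
    exact if_pos h1
  · have h1 : ¬ Odd (k + 1) := fun h => hk (by simpa [Nat.odd_add_one] using h)
    have h2 : Even (k + 1) := Nat.not_odd_iff_even.1 h1
    simp only [faceOp, Side.sign, if_neg hk, if_pos h2]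
    rw [if_neg (by decide), if_neg (by decide)]
    exact if_neg h1

theorem muB_succ (k : ℕ) (a : List (Block n k)) :
    muB S E (k + 1) (ofList a) =
      (sweep (fun b => (toList (bdry E .tgt k (k + 1) b)).map (faceOp S E .src k)) (muB S E k)
        (fun b => (toList (bdry E .src k (k + 1) b)).map (faceOp S E .tgt k)) a).map ofList := by
  refine Eq.trans ?_ (List.map_id _).symm
  by_cases hk : Even k
  · have h1 : Odd (k + 1) := hk.add_one
    simp only [faceOp, Side.sign, if_pos hk, if_neg (show ¬ (1 : SignType) = -1 by decide)]
    exact if_pos h1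
  · have h1 : ¬ Odd (k + 1) := fun h => hk (by simpa [Nat.odd_add_one] using h)
    simp only [faceOp, Side.sign, if_neg hk, if_neg (show ¬ (1 : SignType) = -1 by decide)]
    exact if_neg h1

/-- The recursion for `σₖ` and `τₖ` is itself an application of `λₖ` or `νₖ`, so the induction on
`n` needs nothing beyond the behaviour of these operations. -/
theorem stdStep_eq_faceOp (s : Side) {k : ℕ} (h : k ≤ n) :
    stdStep S E s k = faceOp S E s k (S s k) := by
  have h' : ¬ n + 1 ≤ k := by omega
  cases k with
  | zero => cases s <;> rfl
  | succ k =>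
    have hodd : Odd (k + 1) ↔ Even k := by
      rw [← Nat.not_even_iff_odd, Nat.even_add_one, not_not]
    cases s with
    | src =>
      refine Eq.trans ?_ (faceOp_succ_src S E k (toList (S .src (k + 1)))).symm
      refine (if_neg h').trans ?_
      by_cases hk : Even k
      · simp only [faceOp, Side.sign, if_pos hk, if_pos (hodd.2 hk)]
        rfl
      · simp only [faceOp, Side.sign, if_neg hk, if_neg (mt hodd.1 hk)]
        rfl
    | tgt =>
      refine Eq.trans ?_ (faceOp_succ_tgt S E k (toList (S .tgt (k + 1)))).symm
      refine (if_neg h').trans ?_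
      by_cases hk : Even k
      · simp only [faceOp, Side.sign, if_pos hk, if_pos (hodd.2 hk)]
        rfl
      · simp only [faceOp, Side.sign, if_neg hk, if_neg (mt hodd.1 hk)]
        rfl

end operations

-- Sweeps, and why thickening preserves paths

theorem sweep_map_append {α β : Type} (before here after : α → List β) (c : α) (L : List α)
    (pre : List β) :
    (sweep before here after (c :: L)).map (fun t => pre ++ t) =
      (pre ++ (here c ++ L.flatMap after)) ::
        (sweep before here after L).map (fun t => (pre ++ before c) ++ t) := by
  simp [sweep, Function.comp_def]

theorem hi_sweep {n m k : ℕ} {l l' : ℕ} {before here after : Block n k → List (Block m k)}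
    (g : Multiset (Cube n) → Multiset (Cube m)) (g0 : g 0 = 0)
    (gadd : ∀ A B, g (A + B) = g A + g B) (L : List (Block n k))
    (hb : ∀ b ∈ L, hi l (ofList (before b)) = 0) (ha : ∀ b ∈ L, hi l (ofList (after b)) = 0)
    (hh : ∀ b ∈ L, hi l (ofList (here b)) = g (hi l' b))
    (pre : List (Block m k)) (hpre : hi l (ofList pre) = 0) :
    hi l (ofList (((sweep before here after L).map fun t => pre ++ t).map ofList)) =
      g (hi l' (ofList L)) := by
  induction L generalizing pre with
  | nil => exact g0.symm
  | cons c L ih =>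
    have hafter : hi l (ofList (L.flatMap after)) = 0 := by
      clear ih hb hh
      induction L with
      | nil => rfl
      | cons d L ih =>
        rw [List.flatMap_cons, hi_append, ha d (by simp), zero_add]
        exact ih fun b hb => ha b (by simp only [List.mem_cons] at hb ⊢; tauto)
    rw [sweep_map_append, List.map_cons, hi_cons, hi_cons, gadd, hi_append, hi_append, hpre, hafter,
      hh c List.mem_cons_self, zero_add, add_zero]
    congr 1
    refine ih (fun b hb' => hb b (List.mem_cons_of_mem _ hb'))
      (fun b hb' => ha b (List.mem_cons_of_mem _ hb'))
      (fun b hb' => hh b (List.mem_cons_of_mem _ hb')) _ ?_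
    rw [hi_append, hpre, hb c List.mem_cons_self, zero_add]

/-- `S` assigns to every `k` globular `k`-blocks made of the `k`-faces of the `n`-cube. -/
def IsStandard {n : ℕ} (S : Side → (k : ℕ) → Block n k) : Prop :=
  ∀ s k, Globular (frame n) k (S s k) ∧ hi k (S s k) = frame n s k

/-- The constituents of order `k` of a globular block. -/
def Atom (n k : ℕ) (b : Block n k) : Prop := Globular (frame n) k b ∧ (hi (k + 1) b).card ≤ 1

section specs
variable {n : ℕ} {S : Side → (k : ℕ) → Block n k} {E : Side → (k : ℕ) → Cube n → Block n k}

/-- What `λ`, `ν` and `μ` do to globular `k`-blocks. -/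
structure OpSpec (S : Side → (k : ℕ) → Block n k) (E : Side → (k : ℕ) → Cube n → Block n k)
    (k : ℕ) : Prop where
  globular : ∀ s a, Globular (frame n) k a → Globular (frame (n + 1)) k (faceOp S E s k a)
  hi_faceOp : ∀ s a, Globular (frame n) k a → hi k (faceOp S E s k a) = extend s k (hi k a)
  path : ∀ a, Globular (frame n) k a → Path (Atom (n + 1) k) (extend .src k (blockFaces .src k a))
    (extend .tgt k (blockFaces .tgt k a)) (muB S E k a)
  hi_muB : ∀ a, Globular (frame n) k a → hi (k + 1) (ofList (muB S E k a)) = (hi k a).map muC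
  ne_nil : ∀ a, Globular (frame n) k a → muB S E k a ≠ []

namespace OpSpec
variable {k : ℕ}

/-- The thickened `(k-1)`-faces added by `λₖ` or `νₖ` have dimension exactly `k`, hence disappear
above `k`. -/
theorem hi_faceOp_of_lt (h : OpSpec S E k) (s : Side) {a : Block n k}
    (ha : Globular (frame n) k a) {l : ℕ} (hl : k < l) :
    hi l (faceOp S E s k a) = (hi l a).map (app (s.sign k)) := by
  rw [hi_hi hl.le, h.hi_faceOp s a ha, extend, Multiset.filter_add,
    filter_map_app l (s.sign_ne_zero k), ← hi_hi hl.le]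
  convert zero_add _
  rw [Multiset.filter_eq_nil]
  intro x hx
  obtain ⟨y, hy, rfl⟩ := Multiset.mem_map.1 hx
  rw [dim_muC, dim_of_mem_predFaces hy]
  omega

theorem blockFaces_faceOp (h : OpSpec S E k) (s t : Side) {a : Block n k}
    (ha : Globular (frame n) k a) :
    blockFaces t k (faceOp S E s k a) = extend s k (blockFaces t k a) := by
  rw [blockFaces_eq_hi t le_rfl, h.hi_faceOp s a ha, extend, sumFaces_add,
    sumFaces_map_app t k (s.sign_ne_zero k), ← blockFaces_eq_hi t le_rfl, sumFaces_of_dim, extend]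
  intro x hx
  obtain ⟨y, hy, rfl⟩ := Multiset.mem_map.1 hx
  rw [dim_muC, dim_of_mem_predFaces hy]

theorem atom (h : OpSpec S E k) (s : Side) {a : Block n k} (ha : Atom n k a) :
    Atom (n + 1) k (faceOp S E s k a) :=
  ⟨h.globular s a ha.1, by
    rw [h.hi_faceOp_of_lt s ha.1 k.lt_succ_self, Multiset.card_map]; exact ha.2⟩

theorem path_map (h : OpSpec S E k) (s : Side) {A B : Multiset (Cube n)} {L : List (Block n k)}
    (hL : Path (Atom n k) A B L) :
    Path (Atom (n + 1) k) (extend s k A) (extend s k B) (L.map (faceOp S E s k)) :=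
  hL.map _ _ (fun _ _ hb => h.atom s hb) fun _ _ hb t => h.blockFaces_faceOp s t hb.1

theorem hi_map_faceOp (h : OpSpec S E k) (s : Side) {L : List (Block n k)}
    (hL : ∀ b ∈ L, Globular (frame n) k b) {l : ℕ} (hl : k < l) :
    hi l (ofList (L.map (faceOp S E s k))) = (hi l (ofList L)).map (app (s.sign k)) :=
  hi_map l l _ (Multiset.map (app (s.sign k))) rfl (fun _ _ => Multiset.map_add _ _ _) L
    fun b hb => h.hi_faceOp_of_lt s (hL b hb) hl

theorem blockFaces_muB (h : OpSpec S E k) (s : Side) {a : Block n k}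
    (ha : Globular (frame n) k a) :
    blockFaces s (k + 1) (ofList (muB S E k a)) = (blockFaces s k a).map muC +
      (blockFaces s (k + 1) a).map (app (s.sign (k + 1))) := by
  rw [blockFaces_eq_hi s le_rfl, h.hi_muB a ha, sumFaces_map_muC, ← blockFaces_eq_hi s le_rfl,
    ← blockFaces_eq_hi s k.le_succ]

end OpSpec

/-- The source or target of an atom, as a path. -/
theorem atom_bdry (hE : IsBoundary E) (s : Side) {k : ℕ} {b : Block n k} (hb : Atom n k b) :
    Path (Atom n k) (blockFaces .src k b) (blockFaces .tgt k b) (toList (bdry E s k (k + 1) b)) ∧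
      hi (k + 1) (bdry E s k (k + 1) b) = blockFaces s (k + 1) b ∧
      hi (k + 2) (bdry E s k (k + 1) b) = 0 := by
  obtain ⟨h1, h2⟩ := (bdry_spec hE s (k + 1) k b hb.1).2.2 k.lt_succ_self hb.2
  have h3 := h1.2
  simp only [lt_irrefl, if_false] at h3
  refine ⟨h3.mono fun c _ hc => ⟨hc.1.congr fun t l hl => if_pos hl, hc.2⟩, h2, ?_⟩
  refine hi_eq_zero_of_dim (m := k + 1) (by omega) fun x hx => ?_
  rw [h2] at hx
  exact dim_of_mem_blockFaces hx

/-- In each row of the sweep one constituent `c` is being thickened, and `pre` holds the rows' part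
already swept. The target of the thickened `c` contains its `(k+1)`-target with the sign that
`before c` carries in the next row; its thickened `k`-target is the thickened `k`-source of the next
constituent, whose signed `(k+1)`-source already stands in `after`. So the target of each row is the
source of the next. -/
theorem opSpec_sweep {k : ℕ} (h : OpSpec S E k) (hE : IsBoundary E) {L : List (Block n k)}
    {A : Multiset (Cube n)} (hL : Path (Atom n k) A (frame n .tgt k) L)
    (pre : List (Block (n + 1) k))
    (hpre : Path (Atom (n + 1) k) (frame (n + 1) .src k) (extend .src k A) pre)
    (hpre' : hi (k + 2) (ofList pre) = 0) :
    Path (Atom (n + 1) (k + 1))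
      (hi (k + 1) (ofList pre) + (A.map muC +
        (blockFaces .src (k + 1) (ofList L)).map (app (Side.src.sign (k + 1)))))
      (hi (k + 1) (ofList pre) + ((frame n .tgt k).map muC +
        (blockFaces .tgt (k + 1) (ofList L)).map (app (Side.tgt.sign (k + 1)))))
      (((sweep (fun b => (toList (bdry E .tgt k (k + 1) b)).map (faceOp S E .src k)) (muB S E k)
        (fun b => (toList (bdry E .src k (k + 1) b)).map (faceOp S E .tgt k)) L).map
          fun t => pre ++ t).map ofList) := by
  induction L generalizing A pre with
  | nil =>
    cases hL
    exact rfl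
  | cons c L ih =>
    obtain ⟨hc, rfl, hL⟩ := hL
    rw [sweep_map_append, List.map_cons]
    have bd := fun s (b : Block n k) hb => atom_bdry (E := E) hE s (b := b) hb
    have hbefore := h.path_map .src (bd .tgt c hc).1
    have hbefore1 : hi (k + 1)
        (ofList ((toList (bdry E .tgt k (k + 1) c)).map (faceOp S E .src k))) =
        (blockFaces .tgt (k + 1) c).map (app (Side.src.sign k)) := by
      rw [h.hi_map_faceOp .src (fun b hb => ((bd .tgt c hc).1.mem b hb).1) k.lt_succ_self,
        ofList_toList, (bd .tgt c hc).2.1]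
    have hbefore2 : hi (k + 2)
        (ofList ((toList (bdry E .tgt k (k + 1) c)).map (faceOp S E .src k))) = 0 := by
      rw [h.hi_map_faceOp .src (fun b hb => ((bd .tgt c hc).1.mem b hb).1) (by omega),
        ofList_toList, (bd .tgt c hc).2.2]
      rfl
    have hafter : Path (Atom (n + 1) k) (extend .tgt k (blockFaces .tgt k c))
        (frame (n + 1) .tgt k)
        (L.flatMap fun b => (toList (bdry E .src k (k + 1) b)).map (faceOp S E .tgt k)) := by
      rw [frame_succ]
      exact hL.flatMap _ (extend .tgt k) fun b _ hb => h.path_map .tgt (bd .src b hb).1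
    have hafter12 : hi (k + 1) (ofList
          (L.flatMap fun b => (toList (bdry E .src k (k + 1) b)).map (faceOp S E .tgt k))) =
          (blockFaces .src (k + 1) (ofList L)).map (app (Side.tgt.sign k)) ∧
        hi (k + 2) (ofList
          (L.flatMap fun b => (toList (bdry E .src k (k + 1) b)).map (faceOp S E .tgt k))) = 0 := by
      have hm := hL.mem
      clear hL ih hafter
      induction L with
      | nil => exact ⟨rfl, rfl⟩
      | cons b L ih =>
        obtain ⟨i1, i2⟩ := ih fun b hb => hm b (List.mem_cons_of_mem _ hb)
        have hb := hm b List.mem_cons_self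
        have hg := fun d hd => ((bd .src b hb).1.mem d hd).1
        rw [List.flatMap_cons, hi_append, hi_append, i1, i2, blockFaces_cons, Multiset.map_add,
          h.hi_map_faceOp .tgt hg k.lt_succ_self,
          h.hi_map_faceOp .tgt hg (show k < k + 2 by omega), ofList_toList, (bd .src b hb).2.1,
          (bd .src b hb).2.2]
        exact ⟨rfl, rfl⟩
    have hhere2 : hi (k + 2) (ofList (muB S E k c)) = (hi (k + 1) c).map muC := by
      rw [hi_hi (m := k + 1) (by omega), h.hi_muB c hc.1, filter_map_muC, ← hi_hi k.le_succ]
    have faces_head : ∀ s, blockFaces s (k + 1) (ofList (pre ++ (muB S E k c ++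
        L.flatMap fun b => (toList (bdry E .src k (k + 1) b)).map (faceOp S E .tgt k)))) =
        hi (k + 1) (ofList pre) + (((blockFaces s k c).map muC +
          (blockFaces s (k + 1) c).map (app (s.sign (k + 1)))) +
          (blockFaces .src (k + 1) (ofList L)).map (app (Side.tgt.sign k))) := by
      intro s
      rw [blockFaces_append, blockFaces_append, blockFaces_of_hi_succ s hpre',
        blockFaces_of_hi_succ s hafter12.2, hafter12.1, h.blockFaces_muB s hc.1]
    refine ⟨⟨⟨?_, ?_⟩, ?_⟩, ?_, ?_⟩
    · simp [h.ne_nil c hc.1]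
    · exact hpre.append ((h.path c hc.1).append hafter)
    · rw [hi_append, hi_append, hpre', hafter12.2, hhere2, zero_add, add_zero, Multiset.card_map]
      exact hc.2
    · rw [faces_head, blockFaces_cons, Multiset.map_add, add_assoc, Side.sign_succ .src]; rfl
    -- The constituent just swept joins the prefix through its target; `Side.sign_succ` matches the
    -- signs at order `k + 1` with those at order `k`.
    · have := ih hL (pre ++ (toList (bdry E .tgt k (k + 1) c)).map (faceOp S E .src k))
        (hpre.append hbefore) (by rw [hi_append, hpre', hbefore2, zero_add])
      rw [hi_append, hbefore1] at this
      convert this using 1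
      · rw [faces_head, Side.sign_succ, Side.sign_succ]
        simp only [Side.flip]
        abel
      · rw [blockFaces_cons, Multiset.map_add, Side.sign_succ]
        simp only [Side.flip]
        abel

/-- All five properties are proved together by induction on `k`, because `λ` and `ν` at order `k +
1` contain `μ` of order `k`, while `μ` at order `k + 1` contains all three operations of order `k`.
-/
theorem opSpec (hS : IsStandard S) (hE : IsBoundary E) (k : ℕ) : OpSpec S E k := by
  induction k with
  | zero =>
    have hmu : ∀ x : Cube n, muB S E 0 (Block.ofCube 0 x) = [Block.ofCube 0 (muC x)] :=
      fun _ => rfl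
    refine ⟨fun _ _ _ => trivial, fun s a _ => ?_, fun a _ => ?_, fun a _ => ?_, fun a _ => ?_⟩
    all_goals induction a using cube_rec with | cube a
    · rw [faceOp_zero]
      simp [hi_cube, extend, predFaces]
    · have h : ∀ s, extend s 0 (blockFaces s 0 (Block.ofCube 0 a)) =
          blockFaces s 0 (Block.ofCube 0 (muC a)) :=
        fun s => by
          rw [blockFaces_cube, blockFaces_cube, faces_muC_val]; rfl
      rw [h, h, hmu]
      exact Path.single ⟨trivial, (Multiset.card_le_card (Multiset.filter_le _ _)).trans (by rfl)⟩
    · rw [hmu, hi_cons, hi_nil, hi_cube, hi_cube, dim_muC]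
      simp
    · rw [hmu]
      exact List.cons_ne_nil _ _
  | succ k ih =>
    -- The `k`-faces of `S t k` on either side are its own `k`-cubes. Thickening it therefore leads
    -- from `extend .src k` to `extend .tgt k` of one and the same multiset, the segment missing
    -- from the path of signed copies.
    have hfr : ∀ s t, blockFaces s k (S t k) = frame n t k := fun s t => by
      rw [blockFaces_eq_hi s le_rfl, (hS t k).2, sumFaces_of_dim]
      exact fun x hx => dim_of_mem_faces (s := t) (x := full n) hx
    refine ⟨fun s a ha => ?_, fun s a ha => ?_, fun a ha => ?_, fun a ha => ?_, fun a ha => ?_⟩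
    · induction a using ofList_rec with | list a =>
      cases s with
      | src =>
        rw [faceOp_succ_src]
        refine ⟨List.append_ne_nil_of_left_ne_nil (ih.ne_nil _ (hS .src k).1) _, ?_⟩
        have h1 := ih.path _ (hS .src k).1
        rw [hfr, hfr] at h1
        rw [frame_succ, frame_succ]
        exact h1.append (ih.path_map .tgt ha.2)
      | tgt =>
        rw [faceOp_succ_tgt]
        refine ⟨List.append_ne_nil_of_right_ne_nil _ (ih.ne_nil _ (hS .tgt k).1), ?_⟩
        have h1 := ih.path _ (hS .tgt k).1
        rw [hfr, hfr] at h1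
        rw [frame_succ, frame_succ]
        exact (ih.path_map .src ha.2).append h1
    · induction a using ofList_rec with | list a =>
      have hg : ∀ b ∈ a, Globular (frame n) k b := fun b hb => (ha.2.mem b hb).1
      cases s with
      | src =>
        rw [faceOp_succ_src, hi_append, ih.hi_muB _ (hS .src k).1, (hS .src k).2,
          ih.hi_map_faceOp .tgt hg k.lt_succ_self, extend, Side.sign_succ]
        rfl
      | tgt =>
        rw [faceOp_succ_tgt, hi_append, ih.hi_muB _ (hS .tgt k).1, (hS .tgt k).2,
          ih.hi_map_faceOp .src hg k.lt_succ_self, extend, Side.sign_succ]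
        exact add_comm _ _
    · induction a using ofList_rec with | list a =>
      have := opSpec_sweep ih hE ha.2 [] (frame_succ n .src k) rfl
      rw [muB_succ]
      simp only [List.nil_append, List.map_id', hi_nil, zero_add] at this
      exact this
    · induction a using ofList_rec with | list a =>
      have hg := fun b hb => atom_bdry (E := E) hE (b := b) (hb := ha.2.mem b hb)
      have := hi_sweep (l := k + 2) (l' := k + 1)
        (before := fun b => (toList (bdry E .tgt k (k + 1) b)).map (faceOp S E .src k))
        (here := muB S E k)
        (after := fun b => (toList (bdry E .src k (k + 1) b)).map (faceOp S E .tgt k))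
        (Multiset.map muC) rfl (Multiset.map_add _) a (fun b hb => ?_) (fun b hb => ?_)
        (fun b hb => ?_) [] rfl
      · rw [muB_succ]
        simpa only [List.nil_append, List.map_id'] using this
      · rw [ih.hi_map_faceOp _ (fun c hc => ((hg b hb .tgt).1.mem c hc).1) (by omega),
          ofList_toList, (hg b hb .tgt).2.2]
        rfl
      · rw [ih.hi_map_faceOp _ (fun c hc => ((hg b hb .src).1.mem c hc).1) (by omega),
          ofList_toList, (hg b hb .src).2.2]
        rfl
      · rw [hi_hi (m := k + 1) (by omega), ih.hi_muB b (ha.2.mem b hb).1, filter_map_muC,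
          ← hi_hi k.le_succ]
    · induction a using ofList_rec with | list a =>
      rw [muB_succ]
      obtain ⟨b, a', rfl⟩ := List.exists_cons_of_ne_nil ha.1
      simp only [sweep, List.map_cons]
      exact List.cons_ne_nil _ _

end specs

/-! ### The sources and targets of the cubes are globular -/

theorem hi_ofCube {n : ℕ} (k l : ℕ) (x : Cube n) :
    hi l (Block.ofCube k x) = hi l (Block.ofCube 0 x) := by
  induction k with
  | zero => rfl
  | succ k ih =>
    change hi l (ofList [Block.ofCube k x]) = _
    rw [hi_cons, hi_nil, add_zero, ih]

theorem globular_ofCube {n : ℕ} (k : ℕ) (x : Cube n) :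
    Globular (fun t l => (faces t l x).val) k (Block.ofCube k x) := by
  induction k with
  | zero => trivial
  | succ k ih =>
    have : ∀ s, (faces s k x).val = blockFaces s k (Block.ofCube k x) := fun s => by
      rw [blockFaces_eq_hi s le_rfl, hi_ofCube, ← blockFaces_eq_hi s le_rfl, blockFaces_cube]
    refine ⟨List.cons_ne_nil _ _, ?_⟩
    simp only [this]
    refine Path.single ⟨by simpa only [this] using ih, ?_⟩
    rw [hi_ofCube]
    exact (Multiset.card_le_card (Multiset.filter_le _ _)).trans (by rfl)

theorem hi_blockMap {m n : ℕ} (f : Cube m → Cube n) (hf : ∀ x, dim (f x) = dim x) (k l : ℕ)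
    (a : Block m k) : hi l (Block.map f k a) = (hi l a).map f := by
  induction k with
  | zero =>
    induction a using cube_rec with | cube a =>
    change hi l (Block.ofCube 0 (f a)) = _
    rw [hi_cube, hi_cube, hf]
    split_ifs <;> simp
  | succ k ih =>
    induction a using ofList_rec with | list a =>
    exact hi_map l l _ (Multiset.map f) rfl (Multiset.map_add f) a fun b _ => ih b

theorem globular_blockMap {m n : ℕ} (f : Cube m → Cube n) (hf : ∀ x, dim (f x) = dim x)
    (hf' : ∀ s l x, (faces s l (f x)).val = (faces s l x).val.map f)
    {F : Side → ℕ → Multiset (Cube m)} (k : ℕ) (a : Block m k) (ha : Globular F k a) :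
    Globular (fun s l => (F s l).map f) k (Block.map f k a) := by
  induction k with
  | zero => trivial
  | succ k ih =>
    induction a using ofList_rec with | list a =>
    refine ⟨fun h => ha.1 (List.map_eq_nil_iff.1 h), ?_⟩
    refine ha.2.map _ (Multiset.map f) (fun b _ hb => ⟨ih b hb.1, ?_⟩) fun b _ hb s => ?_
    · rw [hi_blockMap f hf, Multiset.card_map]; exact hb.2
    · rw [blockFaces_eq_hi s le_rfl, hi_blockMap f hf, blockFaces_eq_hi s le_rfl]
      simp only [sumFaces, Multiset.bind_map, Multiset.map_bind, hf']

/-- The sources and targets of sub-cubes. -/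
def cubeBdry {n : ℕ} (s : Side) (k : ℕ) (x : Cube n) : Block n k :=
  Block.map (place x) k (std (dim x) s k)

theorem std_succ {n k : ℕ} (s : Side) (h : k ≤ n) :
    std (n + 1) s k = faceOp (std n) cubeBdry s k (std n s k) := by
  rw [std]
  exact stdStep_eq_faceOp _ _ s h

theorem std_of_le {n k : ℕ} (s : Side) (h : n ≤ k) : std n s k = Block.ofCube k (full n) := by
  cases n with
  | zero => rw [std]
  | succ n => rw [std]; exact if_pos h

theorem isBoundary_cubeBdry_of_le {n : ℕ} (h : ∀ m ≤ n, IsStandard (std m)) :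
    IsBoundary (cubeBdry (n := n)) := by
  intro s k x
  have key : ∀ t l, (frame (dim x) t l).map (place x) = (faces t l x).val := fun t l => by
    rw [frame, ← faces_place_val, place_full]
  obtain ⟨h1, h2⟩ := h (dim x) (dim_le x) s k
  refine ⟨?_, ?_⟩
  · simp only [← key]
    exact globular_blockMap _ (dim_place x) (fun s l z => faces_place_val s l x z) k _ h1
  · rw [cubeBdry, hi_blockMap _ (dim_place x), h2, key]

theorem isStandard_std (n : ℕ) : IsStandard (std n) := by
  induction n using Nat.strong_induction_on with
  | _ n ih =>
    intro s k
    by_cases hk : n ≤ k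
    · rw [std_of_le s hk]
      refine ⟨globular_ofCube k (full n), ?_⟩
      rw [hi_ofCube]
      by_cases h : n = k
      · subst h
        have h1 := faces_dim s (full n)
        rw [dim_full] at h1
        rw [frame, h1]
        simp [hi_cube, dim_full]
      · rw [frame, faces_eq_empty s (by rw [dim_full]; omega)]
        rw [hi_cube, dim_full, if_neg (by omega), Finset.empty_val]
    · obtain ⟨n, rfl⟩ : ∃ m, n = m + 1 := ⟨n - 1, by omega⟩
      have hS := ih n (by omega)
      -- Sub-cubes of the smaller cube have every dimension up to its own; hence the strong
      -- induction.
      have hE := isBoundary_cubeBdry_of_le fun m hm => ih m (Nat.lt_succ_of_le hm)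
      have := opSpec hS hE k
      rw [std_succ s (by omega), frame_succ]
      exact ⟨this.globular s _ (hS s k).1, by rw [this.hi_faceOp s _ (hS s k).1, (hS s k).2]⟩

theorem isBoundary_cubeBdry (n : ℕ) : IsBoundary (cubeBdry (n := n)) :=
  isBoundary_cubeBdry_of_le fun m _ => isStandard_std m


/-! ### Each set of `k` directions occurs once in a globular `k`-block -/

/-- The signed number of coordinates in which a face with directions in `T` is on the target
side. -/
def weight {n : ℕ} (T : Finset (Fin n)) (y : Cube n) : ℤ :=
  ∑ t ∈ T, if zeros y = T.erase t then
    (if y t = Side.src.sign (rankIn (T.erase t) t) then -1 else 1) else 0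

theorem sum_faces_ite {n : ℕ} (s : Side) {l : ℕ} (x : Cube n) {R : Finset (Fin n)}
    (hR : R.card = l) (f : Cube n → ℤ) :
    ∑ y ∈ faces s l x, (if zeros y = R then f y else 0) =
      if R ⊆ zeros x then f (face s x R) else 0 := by
  rw [← Finset.sum_filter]
  split_ifs with h
  · rw [show (faces s l x).filter (fun y => zeros y = R) = {face s x R} from ?_, sum_singleton]
    ext y
    rw [mem_filter, mem_singleton, mem_faces]
    constructor
    · rintro ⟨⟨R', h1, h2, rfl⟩, h3⟩
      rw [zeros_face] at h3
      rw [h3]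
    · rintro rfl
      exact ⟨⟨R, h, hR, rfl⟩, zeros_face s x R⟩
  · rw [show (faces s l x).filter (fun y => zeros y = R) = ∅ from ?_, sum_empty]
    rw [filter_eq_empty_iff]
    rintro y hy rfl
    exact h (zeros_subset_of_mem_faces hy)

theorem sum_weight {n : ℕ} (s : Side) {k : ℕ} {T : Finset (Fin n)} (hT : T.card = k + 1)
    (x : Cube n) : ∑ y ∈ faces s k x, weight T y =
      ∑ t ∈ T, if T.erase t ⊆ zeros x then
        (if face s x (T.erase t) t = Side.src.sign (rankIn (T.erase t) t) then -1 else 1) else 0 := by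
  simp only [weight]
  rw [sum_comm]
  refine sum_congr rfl fun t ht => ?_
  exact sum_faces_ite s x (by rw [card_erase_of_mem ht, hT]; rfl) _

/-- If `T` consists of zeros of `x`, then for each `t` in `T` the two faces with directions `T.erase
t` carry opposite signs at `t`, a difference of `2`. Otherwise each term cancels: either there is no
such face, or `t` is the one element of `T` that is not a zero and both faces carry the same symbol
`x t`. -/
theorem sum_weight_sub {n : ℕ} {k : ℕ} {T : Finset (Fin n)} (hT : T.card = k + 1) (x : Cube n) :
    ∑ y ∈ faces .tgt k x, weight T y - ∑ y ∈ faces .src k x, weight T y =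
      if T ⊆ zeros x then 2 * (k + 1 : ℤ) else 0 := by
  rw [sum_weight _ hT, sum_weight _ hT, ← sum_sub_distrib]
  have hsign : ∀ m, Side.tgt.sign m ≠ Side.src.sign m := fun m => by
    simp only [Side.sign]; split_ifs <;> decide
  split_ifs with h
  · rw [sum_congr rfl (g := fun _ => (2 : ℤ)), sum_const, hT]
    · simp; ring
    · intro t ht
      have hx : x t = 0 := mem_zeros.1 (h ht)
      have h' : T.erase t ⊆ zeros x := (erase_subset _ _).trans h
      simp [h', face, hx, hsign]
  · refine sum_eq_zero fun t ht => ?_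
    by_cases h' : T.erase t ⊆ zeros x
    · have hx : x t ≠ 0 := fun hx => h fun u hu => by
        by_cases hut : u = t
        · rw [hut]; exact mem_zeros.2 hx
        · exact h' (mem_erase.2 ⟨hut, hu⟩)
      simp [h', face, hx]
    · simp [h']

theorem sum_map_sumFaces {n : ℕ} (s : Side) (l : ℕ) (f : Cube n → ℤ) (L : List (Cube n)) :
    ((sumFaces s l (L : Multiset (Cube n))).map f).sum =
      (L.map fun x => ∑ y ∈ faces s l x, f y).sum := by
  simp only [sumFaces, Multiset.map_bind, Multiset.sum_bind, Multiset.map_coe, Multiset.sum_coe]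
  rfl

/-- Along the path, target weight minus source weight telescopes to the value for the full cube.
Each cube having all of `T` among its directions contributes exactly that amount and every other
cube contributes zero, so there is exactly one. -/
theorem countP_cubes {n k : ℕ} {a : Block n k} (ha : Globular (frame n) k a)
    {T : Finset (Fin n)} (hT : T.card = k) :
    (Block.cubes k a).countP (fun x => T ⊆ zeros x) = 1 := by
  cases k with
  | zero =>
    induction a using cube_rec with | cube x =>
    rw [card_eq_zero] at hT
    simp [cubes_zero, hT]
  | succ k =>
    induction a using ofList_rec with | list a =>
    have key : ∀ (A B : Multiset (Cube n)) (L : List (Block n k)) (p : Block n k → Prop),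
        Path p A B L → (B.map (weight T)).sum - (A.map (weight T)).sum =
          2 * (k + 1 : ℤ) * (Block.cubes (k + 1) (ofList L)).countP (fun x => T ⊆ zeros x) := by
      intro A B L p h
      induction L generalizing A with
      | nil => cases h; simp [cubes_ofList]
      | cons b L ih =>
        obtain ⟨-, rfl, h⟩ := h
        have h1 := ih _ h
        rw [cubes_ofList] at h1 ⊢
        rw [List.flatMap_cons, List.countP_append, Nat.cast_add, mul_add, ← h1]
        have h2 : ((blockFaces .tgt k b).map (weight T)).sum -
            ((blockFaces .src k b).map (weight T)).sum =
            2 * (k + 1 : ℤ) * (Block.cubes k b).countP (fun x => T ⊆ zeros x) := by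
          rw [blockFaces, blockFaces, sum_map_sumFaces, sum_map_sumFaces]
          generalize Block.cubes k b = L
          induction L with
          | nil => simp
          | cons x L ih =>
            have := sum_weight_sub hT x
            rw [List.map_cons, List.map_cons, List.sum_cons, List.sum_cons, List.countP_cons]
            by_cases hx : T ⊆ zeros x
            · simp only [hx, if_true, decide_true] at this ⊢
              push_cast
              linarith
            · simp only [hx, if_false, decide_false] at this ⊢
              simp only [Bool.false_eq_true, if_false, add_zero]
              linarith
        linarith
    have h1 := key _ _ _ _ ha.2
    have h2 := sum_weight_sub hT (full n)
    have hfull : T ⊆ zeros (full n) := fun t _ => mem_zeros.2 rfl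
    rw [if_pos hfull] at h2
    change (∑ y ∈ _, _) - (∑ y ∈ _, _) = _ at h1
    rw [h2, ofList_toList] at h1
    have h3 : (2 * ((k : ℤ) + 1)) ≠ 0 := by positivity
    have h4 := mul_left_cancel₀ h3 (h1.symm.trans (mul_one _).symm)
    exact_mod_cast h4

/-! ### The action of a list of cubes in one dimension -/

/-- Replace the source faces of `x` by its target faces. -/
def flipAt {n : ℕ} (l : ℕ) (V : Finset (Cube n)) (x : Cube n) : Finset (Cube n) :=
  (V \ faces .src l x) ∪ faces .tgt l x

/-- The source faces of each cube of a list are present when its turn comes. -/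
def Flippable {n : ℕ} (l : ℕ) : Finset (Cube n) → List (Cube n) → Prop
  | _, [] => True
  | V, x :: L => faces .src l x ⊆ V ∧ Flippable l (flipAt l V x) L

theorem flippable_append {n l : ℕ} {V : Finset (Cube n)} {L M : List (Cube n)} :
    Flippable l V (L ++ M) ↔ Flippable l V L ∧ Flippable l (L.foldl (flipAt l) V) M := by
  induction L generalizing V with
  | nil => simp [Flippable]
  | cons x L ih => simp [Flippable, ih, and_assoc]

theorem flipAt_of_dim_lt {n l : ℕ} (V : Finset (Cube n)) {x : Cube n} (h : dim x < l) :
    flipAt l V x = V := by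
  rw [flipAt, faces_eq_empty _ h, faces_eq_empty _ h, sdiff_empty, union_empty]

theorem flippable_of_dim_lt {n l : ℕ} (V : Finset (Cube n)) {L : List (Cube n)}
    (h : ∀ x ∈ L, dim x < l) : Flippable l V L ∧ L.foldl (flipAt l) V = V := by
  induction L with
  | nil => exact ⟨trivial, rfl⟩
  | cons x L ih =>
    have hx := h x List.mem_cons_self
    rw [Flippable, List.foldl_cons, flipAt_of_dim_lt V hx, faces_eq_empty _ hx]
    obtain ⟨h1, h2⟩ := ih fun y hy => h y (List.mem_cons_of_mem _ hy)
    exact ⟨⟨empty_subset _, h1⟩, h2⟩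

/-- An `l`-face of `x` whose directions were also directions of a later cube would give an `l`-set
counted twice. So applying `x` disturbs no face awaited by a later cube. The set `D` collects the
cubes of the level that share no direction set with the remaining cubes, such as target faces
already produced. -/
theorem flippable_of_countP {n l : ℕ} {L : List (Cube n)}
    (hL : ∀ T : Finset (Fin n), T.card = l → L.countP (fun x => T ⊆ zeros x) ≤ 1)
    (D : Finset (Cube n)) (hD : ∀ y ∈ D, ∀ x ∈ L, ¬ zeros y ⊆ zeros x) :
    Flippable l (D ∪ (sumFaces .src l (L : Multiset (Cube n))).toFinset) L ∧
      L.foldl (flipAt l) (D ∪ (sumFaces .src l (L : Multiset (Cube n))).toFinset) =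
        D ∪ (sumFaces .tgt l (L : Multiset (Cube n))).toFinset := by
  induction L generalizing D with
  | nil => exact ⟨trivial, rfl⟩
  | cons x L ih =>
    have hsum : ∀ s, (sumFaces s l ((x :: L : List (Cube n)) : Multiset (Cube n))).toFinset =
        faces s l x ∪ (sumFaces s l (L : Multiset (Cube n))).toFinset := fun s => by
      rw [← Multiset.cons_coe, sumFaces, Multiset.cons_bind, Multiset.toFinset_add,
        Finset.val_toFinset]
      rfl
    have hdisj : ∀ s, ∀ y ∈ faces s l x, ∀ x' ∈ L, ¬ zeros y ⊆ zeros x' := by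
      intro s y hy x' hx' hsub
      have h1 := hL (zeros y) (by rw [card_zeros, dim_of_mem_faces hy])
      rw [List.countP_cons_of_pos (by simpa using zeros_subset_of_mem_faces hy)] at h1
      have h2 : 0 < L.countP (fun x => decide (zeros y ⊆ zeros x)) :=
        List.countP_pos_iff.2 ⟨x', hx', by simpa using hsub⟩
      omega
    have hflip : flipAt l (D ∪ (faces .src l x ∪ (sumFaces .src l (L : Multiset (Cube n))).toFinset))
        x = (D ∪ faces .tgt l x) ∪ (sumFaces .src l (L : Multiset (Cube n))).toFinset := by
      have h1 : Disjoint D (faces .src l x) := by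
        rw [disjoint_left]
        exact fun y hy hy' => hD y hy x List.mem_cons_self (zeros_subset_of_mem_faces hy')
      have h2 : Disjoint (sumFaces .src l (L : Multiset (Cube n))).toFinset (faces .src l x) := by
        rw [disjoint_left]
        intro y hy hy'
        rw [Multiset.mem_toFinset, sumFaces, Multiset.mem_bind] at hy
        obtain ⟨x', hx', h⟩ := hy
        exact hdisj .src y hy' x' hx' (zeros_subset_of_mem_faces (s := .src) (l := l) (by simpa using h))
      rw [flipAt, union_sdiff_distrib, union_sdiff_distrib, sdiff_self, h1.sdiff_eq_left,
        h2.sdiff_eq_left]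
      ext y
      simp only [mem_union, bot_eq_empty, notMem_empty]
      tauto
    rw [Flippable, List.foldl_cons, hsum, hsum, hflip]
    obtain ⟨h1, h2⟩ := ih (fun T hT => (List.Sublist.countP_le (List.sublist_cons_self x L)).trans
      (hL T hT)) (D ∪ faces .tgt l x) fun y hy x' hx' => by
        rcases mem_union.1 hy with hy | hy
        · exact hD y hy x' (List.mem_cons_of_mem _ hx')
        · exact hdisj .tgt y hy x' hx'
    refine ⟨⟨fun y hy => mem_union_right _ (mem_union_left _ hy), h1⟩, ?_⟩
    rw [h2]
    ext y
    simp only [mem_union]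
    tauto

theorem Globular.flippable {n k : ℕ} {a : Block n k} (ha : Globular (frame n) k a) :
    Flippable k (blockFaces .src k a).toFinset (Block.cubes k a) ∧
      (Block.cubes k a).foldl (flipAt k) (blockFaces .src k a).toFinset =
        (blockFaces .tgt k a).toFinset := by
  have := flippable_of_countP (fun T hT => (countP_cubes ha hT).le) ∅ (by simp)
  rw [empty_union, empty_union] at this
  exact this

/-! ### The action of a globular block on piles -/

/-- All symbols of a word are applicable when their turn comes. -/
def Valid {n : ℕ} : PrePile n → List (Move n) → Prop
  | _, [] => True
  | v, m :: w => m.Applicable v ∧ Valid (m.act v) w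

theorem run_append {n : ℕ} (v : PrePile n) (w w' : List (Move n)) :
    run v (w ++ w') = run (run v w) w' := List.foldl_append

theorem valid_append {n : ℕ} {v : PrePile n} {w w' : List (Move n)} :
    Valid v (w ++ w') ↔ Valid v w ∧ Valid (run v w) w' := by
  induction w generalizing v with
  | nil => simp [Valid, run]
  | cons m w ih => simp [Valid, ih, run, and_assoc]

theorem act_cube {n : ℕ} (x : Cube n) (v : PrePile n) (j : ℕ) :
    (Move.cube x).act v j = flipAt j (v j) x := by
  simp only [Move.act]
  split_ifs with h
  · rw [faceSetAt_eq_faces _ _ h, faceSetAt_eq_faces _ _ h]; rfl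
  · rw [flipAt_of_dim_lt _ (by omega)]

theorem applicable_cube {n : ℕ} (x : Cube n) (v : PrePile n) :
    (Move.cube x).Applicable v ↔ ∀ j, faces .src j x ⊆ v j := by
  simp only [Move.Applicable]
  constructor
  · intro h j
    by_cases hj : j ≤ dim x
    · rw [← faceSetAt_eq_faces _ _ hj]; exact h j hj
    · rw [faces_eq_empty _ (by omega)]; exact empty_subset _
  · intro h j hj
    rw [faceSetAt_eq_faces _ _ hj]; exact h j

theorem act_star {n i : ℕ} (h : i ≤ n + 1) (v : PrePile n) (j : ℕ) :
    (Move.star i).act v j = if j < i then faces .src j (full n) else v j := by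
  simp only [Move.act]
  split_ifs with hj
  · rw [faceSet_eq_faces _ (by omega)]
  · rfl

theorem applicable_star {n i : ℕ} (h : i ≤ n + 1) (v : PrePile n) :
    (Move.star i).Applicable v ↔ ∀ j < i, v j = faces .tgt j (full n) := by
  simp only [Move.Applicable]
  refine forall₂_congr fun j hj => ?_
  rw [faceSet_eq_faces _ (by omega)]

/-- The piles on which a globular `k`-block can act. -/
structure Ready {n k : ℕ} (v : PrePile n) (a : Block n k) : Prop where
  low : ∀ l < k, v l = faces .src l (full n)
  high : ∀ l ≥ k, Flippable l (v l) (Block.cubes k a)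

/-- The piles on which a sequence of globular `k`-blocks beginning at `A` can act. -/
structure ReadyList {n k : ℕ} (v : PrePile n) (A : Multiset (Cube n)) (L : List (Block n k)) :
    Prop where
  low : ∀ l < k, v l = faces .src l (full n)
  mid : v k = A.toFinset
  high : ∀ l > k, Flippable l (v l) (Block.cubes (k + 1) (ofList L))

theorem Ready.list {n k : ℕ} {v : PrePile n} {L : List (Block n k)} (h : Ready v (ofList L)) :
    ReadyList v (frame n .src k) L where
  low l hl := h.low l (by omega)
  mid := by rw [h.low k k.lt_succ_self, frame, Finset.val_toFinset]
  high l hl := h.high l hl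

theorem ReadyList.head {n k : ℕ} {v : PrePile n} {A B : Multiset (Cube n)} {b : Block n k}
    {L : List (Block n k)} (h : ReadyList v A (b :: L)) (hL : Path (Atom n k) A B (b :: L)) :
    Ready v b where
  low := h.low
  high l hl := by
    rcases hl.lt_or_eq with hl | rfl
    · have := h.high l hl
      rw [cubes_ofList, List.flatMap_cons, flippable_append] at this
      exact this.1
    · rw [h.mid, ← hL.2.1]
      exact hL.1.1.flippable.1

/-- The effect of a block on a pile. -/
structure Runs {n k : ℕ} (v : PrePile n) (a : Block n k) : Prop where
  valid : Valid v (word k a)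
  low : ∀ l < k, run v (word k a) l = faces .tgt l (full n)
  high : ∀ l ≥ k, run v (word k a) l = (Block.cubes k a).foldl (flipAt l) (v l)

/-- The separator resets the levels below `k` to the sources; level `k` has advanced from the source
of `b` to its target, which is the source of the next term. -/
theorem ReadyList.next {n k : ℕ} (hk : k ≤ n + 1) {v : PrePile n} {A B : Multiset (Cube n)} {b c : Block n k}
    {L : List (Block n k)} (h : ReadyList v A (b :: c :: L))
    (hL : Path (Atom n k) A B (b :: c :: L)) (hb : Runs v b) :
    Valid v (word k b ++ [Move.star k]) ∧
      ReadyList (run v (word k b ++ [Move.star k])) (blockFaces .tgt k b) (c :: L) ∧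
      ∀ l > k, run v (word k b ++ [Move.star k]) l = (Block.cubes k b).foldl (flipAt l) (v l) := by
  have hrun : ∀ l, run v (word k b ++ [Move.star k]) l =
      if l < k then faces .src l (full n) else run v (word k b) l := fun l => by
    rw [run_append]; exact act_star hk _ l
  refine ⟨valid_append.2 ⟨hb.valid, (applicable_star hk _).2 hb.low, trivial⟩,
    ⟨fun l hl => ?_, ?_, fun l hl => ?_⟩, fun l hl => ?_⟩
  · rw [hrun, if_pos hl]
  · rw [hrun, if_neg (lt_irrefl _), hb.high k le_rfl, h.mid, ← hL.2.1, hL.1.1.flippable.2]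
  · have := h.high l hl
    rw [cubes_ofList, List.flatMap_cons, flippable_append] at this
    rw [hrun, if_neg hl.le.not_gt, hb.high l hl.le, cubes_ofList]
    exact this.2
  · rw [hrun, if_neg hl.le.not_gt, hb.high l hl.le]

theorem word_ofList_cons_cons {n k : ℕ} (b c : Block n k) (L : List (Block n k)) :
    word (k + 1) (ofList (b :: c :: L)) =
      (word k b ++ [Move.star k]) ++ word (k + 1) (ofList (c :: L)) := by
  change List.intercalate _ (word k b :: word k c :: _) = _
  rw [List.intercalate_cons_cons]
  rfl

theorem word_ofList_singleton {n k : ℕ} (b : Block n k) :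
    word (k + 1) (ofList [b]) = word k b := by
  change List.intercalate _ [word k b] = _
  rw [List.intercalate_singleton]

/-- Induction on the order. Within a `(k+1)`-block each constituent carries the levels below `k`
from source to target, the separator resets them, and level `k` moves along the path. The levels
above `k` see only the succession of cubes. -/
theorem Globular.runs {n k : ℕ} (hk : k ≤ n + 1) {a : Block n k} (ha : Globular (frame n) k a)
    {v : PrePile n} (hv : Ready v a) : Runs v a := by
  induction k generalizing v with
  | zero =>
    induction a using cube_rec with | cube x =>
    have hw : word 0 (Block.ofCube 0 x) = [Move.cube x] := rfl
    refine ⟨?_, fun l hl => absurd hl (Nat.not_lt_zero _), fun l _ => ?_⟩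
    · rw [hw]
      refine ⟨(applicable_cube x v).2 fun j => ?_, trivial⟩
      exact (hv.high j (Nat.zero_le _)).1
    · rw [hw]; exact act_cube x v l
  | succ k ih =>
    induction a using ofList_rec with | list a =>
    have key : ∀ (L : List (Block n k)) (A : Multiset (Cube n)) (v : PrePile n), L ≠ [] →
        Path (Atom n k) A (frame n .tgt k) L → ReadyList v A L → Runs v (ofList L) := by
      intro L
      induction L with
      | nil => exact fun _ _ h => absurd rfl h
      | cons b L ihL =>
        intro A v _ hL hv
        have hb := ih (by omega) hL.1.1 (hv.head hL)
        cases L with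
        | nil =>
          obtain ⟨h1, h2, h3⟩ := hb
          refine ⟨?_, fun l hl => ?_, fun l hl => ?_⟩
          · rwa [word_ofList_singleton]
          · rw [word_ofList_singleton]
            rcases Nat.lt_succ_iff_lt_or_eq.1 hl with hl | rfl
            · exact h2 l hl
            · rw [h3 l le_rfl, hv.mid, ← hL.2.1, hL.1.1.flippable.2, show blockFaces _ _ _ = _ from
                hL.2.2, frame, Finset.val_toFinset]
          · rw [word_ofList_singleton, h3 l (by omega), cubes_ofList, List.flatMap_singleton]
        | cons c L =>
          obtain ⟨h1, h2, h3⟩ := hv.next (by omega) hL hb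
          obtain ⟨i1, i2, i3⟩ := ihL _ _ (List.cons_ne_nil _ _) hL.2.2 h2
          refine ⟨?_, fun l hl => ?_, fun l hl => ?_⟩
          · rw [word_ofList_cons_cons]
            exact valid_append.2 ⟨h1, i1⟩
          · rw [word_ofList_cons_cons, run_append]
            exact i2 l hl
          · rw [word_ofList_cons_cons, run_append, i3 l hl, h3 l hl, cubes_ofList, cubes_ofList,
              List.flatMap_cons (x := b), List.foldl_append]
    exact key a _ v ha.1 ha.2 hv.list

-- The states of the pile in which sub-blocks are met

theorem Valid.run_of {n : ℕ} {p : PrePile n → Prop}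
    (hp : ∀ v (m : Move n), m.Applicable v → p v → p (m.act v)) {v : PrePile n} {w : List (Move n)}
    (h : Valid v w) (hv : p v) : p (run v w) := by
  induction w generalizing v with
  | nil => exact hv
  | cons m w ih => exact ih h.2 (hp v m h.1 hv)

/-- Each term of a sequence of globular blocks is met in some state of the pile. -/
theorem exists_ready {n k : ℕ} (hk : k ≤ n + 1) {p : PrePile n → Prop}
    (hp : ∀ v (m : Move n), m.Applicable v → p v → p (m.act v)) {A B : Multiset (Cube n)}
    {L M : List (Block n k)} {b : Block n k} (h : Path (Atom n k) A B (L ++ b :: M)) {v : PrePile n}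
    (hv : p v) (hr : ReadyList v A (L ++ b :: M)) :
    ∃ u, p u ∧ Ready u b ∧ u k = (blockFaces .src k b).toFinset := by
  induction L generalizing A v with
  | nil =>
    refine ⟨v, hv, hr.head h, ?_⟩
    rw [hr.mid, ← h.2.1]
  | cons c L ih =>
    have hc := h.1.1.runs hk (hr.head h)
    obtain ⟨d, L', hL'⟩ : ∃ d L', L ++ b :: M = d :: L' :=
      List.exists_cons_of_ne_nil (by simp)
    rw [List.cons_append, hL'] at h hr
    obtain ⟨h1, h2, -⟩ := hr.next hk h hc
    rw [← hL'] at h h2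
    exact ih h.2.2 (h1.run_of hp hv) h2

/-- Each full sub-block of a globular block is met in some state of the pile. -/
theorem IsFullSub.exists_ready {n j k : ℕ} {a : Block n j} {b : Block n k} (h : IsFullSub a k b)
    (hk : k ≤ n + 1) {p : PrePile n → Prop}
    (hp : ∀ v (m : Move n), m.Applicable v → p v → p (m.act v)) (hb : Globular (frame n) k b)
    {v : PrePile n} (hv : p v) (hr : Ready v b) :
    Globular (frame n) j a ∧ ∃ u, p u ∧ Ready u a := by
  induction h generalizing v with
  | refl => exact ⟨hb, v, hv, hr⟩
  | step b c hbc h ih =>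
    obtain ⟨L, M, rfl⟩ := List.append_of_mem hbc
    have hc : Path _ _ _ (L ++ b :: M) := hb.2
    obtain ⟨u, hu, hu', -⟩ := Cubical.exists_ready (by omega) hp hc hv (Ready.list hr)
    exact ih (by omega) (hc.mem b hbc).1 hu hu'

theorem IsFullSub.le {n j k : ℕ} {a : Block n j} {b : Block n k} (h : IsFullSub a k b) :
    j ≤ k := by
  induction h with
  | refl => exact le_rfl
  | step _ _ _ _ ih => omega

/-- The constituents of a globular block of lower order are atoms. -/
theorem IsFullSub.atom {n j k : ℕ} {a : Block n j} {b : Block n k} (h : IsFullSub a k b)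
    (hb : Globular (frame n) k b) (hjk : j < k) : Atom n j a := by
  induction h with
  | refl => exact absurd hjk (lt_irrefl _)
  | @step k b c hbc h ih =>
    have hc : Path (Atom n k) _ _ c := hb.2
    have hb' := hc.mem b hbc
    rcases Nat.lt_succ_iff_lt_or_eq.1 hjk with h' | rfl
    · exact ih hb'.1 h'
    · cases h with
      | refl => exact hb'
      | step _ _ _ h' => exact absurd h'.le (by omega)


/-! ### Comparison of cells -/

theorem cells_coe {n k : ℕ} {a : Block n k} (h : ∀ x ∈ hi k a, dim x = k) :
    (cells a : Multiset (Cube n)) = hi k a := by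
  rw [cells, hi, ← Multiset.filter_coe]
  refine Multiset.filter_congr fun x hx => ⟨fun h => h.ge, fun hx' => ?_⟩
  exact h x (Multiset.mem_filter.2 ⟨hx, hx'⟩)

theorem dim_of_mem_frame {n l : ℕ} {s : Side} {x : Cube n} (h : x ∈ frame n s l) : dim x = l :=
  dim_of_mem_faces (s := s) (x := full n) h

theorem hi_bd_of_lt {n j k : ℕ} (s : Side) (h : k < j) {a : Block n j}
    (ha : Globular (frame n) j a) :
    Globular (frame n) k (bd s k a) ∧ hi k (bd s k a) = frame n s k :=
  (bdry_spec (isBoundary_cubeBdry n) s k j a ha).1 h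

theorem hi_bd_self {n k : ℕ} (s : Side) {a : Block n k} (ha : Globular (frame n) k a) :
    Globular (frame n) k (bd s k a) ∧ hi k (bd s k a) = blockFaces s k a :=
  (bdry_spec (isBoundary_cubeBdry n) s k k a ha).2.1 rfl

/-- Below order `i` every globular block has the faces of the `n`-cube as its sources and targets,
so only order `i` can distinguish two cells. -/
theorem sameCell_of_blockFaces {n i : ℕ} {a b : Block n i} (ha : Globular (frame n) i a)
    (hb : Globular (frame n) i b) (h : ∀ s, blockFaces s i a = blockFaces s i b) :
    SameCell a b := by
  intro l hl s
  rw [← Multiset.coe_eq_coe]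
  rcases hl.lt_or_eq with hl | rfl
  · rw [cells_coe, cells_coe, (hi_bd_of_lt s hl ha).2, (hi_bd_of_lt s hl hb).2]
    · rw [(hi_bd_of_lt s hl hb).2]; exact fun x hx => dim_of_mem_frame hx
    · rw [(hi_bd_of_lt s hl ha).2]; exact fun x hx => dim_of_mem_frame hx
  · rw [cells_coe, cells_coe, (hi_bd_self s ha).2, (hi_bd_self s hb).2, h s]
    · rw [(hi_bd_self s hb).2]; exact fun x hx => dim_of_mem_blockFaces hx
    · rw [(hi_bd_self s ha).2]; exact fun x hx => dim_of_mem_blockFaces hx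

theorem sameCell_of_hi {n i : ℕ} {a b : Block n i} (ha : Globular (frame n) i a)
    (hb : Globular (frame n) i b) (h : hi i a = hi i b) :
    SameCell a b := by
  refine sameCell_of_blockFaces ha hb fun s => ?_
  rw [blockFaces_eq_hi s le_rfl, blockFaces_eq_hi s le_rfl, h]

theorem sameCell_bd_std {n i j k : ℕ} {s t : Side} (hij : i < j) (hjk : j < k) {a : Block n j}
    (ha : IsFullSub a k (std n s k)) : SameCell (bd t i a) (std n t i) := by
  have h1 := hi_bd_of_lt t hij (ha.atom (isStandard_std n s k).1 hjk).1
  have h2 := isStandard_std n t i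
  exact sameCell_of_hi h1.1 h2.1 (h1.2.trans h2.2.symm)

theorem path_infix {n k : ℕ} {p : Block n k → Prop} {A B : Multiset (Cube n)} {a b : Block n k}
    {L : List (Block n k)} (h : Path p A B L) (hab : [a, b] <:+: L) :
    p a ∧ p b ∧ blockFaces .src k b = blockFaces .tgt k a := by
  obtain ⟨l, r, rfl⟩ := hab
  rw [List.append_assoc] at h
  obtain ⟨C, -, h1, -, h2, h3, -⟩ := h.of_append
  exact ⟨h1, h2, h3⟩

theorem sameCell_of_path {n j : ℕ} {a b : Block n j} (ha : Atom n j a) (hb : Atom n j b)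
    (h : blockFaces .src j b = blockFaces .tgt j a) : SameCell (bd .src j b) (bd .tgt j a) := by
  have h1 := hi_bd_self .src hb.1
  have h2 := hi_bd_self .tgt ha.1
  exact sameCell_of_hi h1.1 h2.1 (by rw [h1.2, h2.2, h])


/-! ### The moment projections -/

/-- The moment `∑ᵢ pᵢ iᵗ`. -/
def moment {n : ℕ} (t : ℕ) : (Fin n → ℝ) →ₗ[ℝ] ℝ := ∑ i : Fin n, ((i : ℕ) : ℝ) ^ t • LinearMap.proj i

theorem moment_apply {n : ℕ} (t : ℕ) (p : Fin n → ℝ) :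
    moment t p = ∑ i, p i * ((i : ℕ) : ℝ) ^ t := by
  simp [moment, mul_comm]

/-- The projection to `ℝˡ` given by the first `l` moments. -/
def proj (n l : ℕ) : (Fin n → ℝ) →ₗ[ℝ] EuclideanSpace ℝ (Fin l) :=
  (WithLp.linearEquiv 2 ℝ (Fin l → ℝ)).symm.toLinearMap ∘ₗ LinearMap.pi fun t : Fin l => moment t

theorem proj_apply {n l : ℕ} (p : Fin n → ℝ) (t : Fin l) : proj n l p t = moment t p := rfl

theorem proj_eq_iff {n l : ℕ} {p q : Fin n → ℝ} :
    proj n l p = proj n l q ↔ ∀ t < l, moment t p = moment t q := by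
  constructor
  · intro h t ht
    simpa [proj_apply] using congrArg (fun z => z.ofLp ⟨t, ht⟩) h
  · intro h
    ext t
    rw [proj_apply, proj_apply, h t t.2]

theorem continuous_proj (n l : ℕ) : Continuous (proj n l) :=
  LinearMap.continuous_of_finiteDimensional _

/-- The values at `i` of the polynomial with roots in `R`. -/
def rootProd {n : ℕ} (R : Finset (Fin n)) (i : Fin n) : ℝ := ∏ r ∈ R, (((r : ℕ) : ℝ) - (i : ℕ))

theorem rootProd_of_mem {n : ℕ} {R : Finset (Fin n)} {i : Fin n} (h : i ∈ R) : rootProd R i = 0 :=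
  prod_eq_zero h (sub_self _)

/-- The factor of a root `r` is negative exactly when `r < i`. Thus the polynomial alternates in the
same way as the signs in a face with directions `R`. -/
theorem rootProd_pos {n : ℕ} {R : Finset (Fin n)} {i : Fin n} (h : i ∉ R) :
    0 < (-1) ^ rankIn R i * rootProd R i := by
  rw [rootProd, ← prod_filter_mul_prod_filter_not R (· < i), ← mul_assoc]
  refine mul_pos ?_ (prod_pos fun r hr => ?_)
  · rw [rankIn, ← prod_const, ← prod_mul_distrib]
    refine prod_pos fun r hr => ?_
    have : (r : ℕ) < i := (mem_filter.1 hr).2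
    have : ((r : ℕ) : ℝ) < (i : ℕ) := by exact_mod_cast this
    linarith
  · have h1 := (mem_filter.1 hr)
    have h2 : r ≠ i := fun h' => h (h' ▸ h1.1)
    have : (i : ℕ) < r := lt_of_le_of_ne (not_lt.1 h1.2) fun h3 => h2 (Fin.ext h3.symm)
    have : ((i : ℕ) : ℝ) < (r : ℕ) := by exact_mod_cast this
    linarith

theorem rootProd_ne_zero {n : ℕ} {R : Finset (Fin n)} {i : Fin n} (h : i ∉ R) : rootProd R i ≠ 0 :=
  fun h' => by simpa [h'] using rootProd_pos h

/-- As a polynomial in `i`, the root product has degree `R.card` and leading coefficient `(-1) ^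
R.card`; all lower coefficients meet vanishing moments. The shift `m` is what the induction on `R`
consumes. -/
theorem sum_mul_rootProd_aux {n : ℕ} (u : Fin n → ℝ) (R : Finset (Fin n)) (m : ℕ)
    (h : ∀ t, m ≤ t → t < m + R.card → moment t u = 0) :
    ∑ i, u i * ((i : ℕ) : ℝ) ^ m * rootProd R i = (-1) ^ R.card * moment (m + R.card) u := by
  induction R using Finset.induction_on generalizing m with
  | empty => simp [rootProd, moment_apply]
  | insert r R hr ih =>
    rw [card_insert_of_notMem hr] at h ⊢
    have h1 := ih m fun t ht ht' => h t ht (by omega)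
    have h2 := ih (m + 1) fun t ht ht' => h t (by omega) (by omega)
    rw [h (m + R.card) (by omega) (by omega), mul_zero] at h1
    have : ∀ i, u i * ((i : ℕ) : ℝ) ^ m * rootProd (insert r R) i =
        (r : ℕ) * (u i * ((i : ℕ) : ℝ) ^ m * rootProd R i) -
          u i * ((i : ℕ) : ℝ) ^ (m + 1) * rootProd R i := fun i => by
      rw [rootProd, prod_insert hr, ← rootProd]; ring
    simp only [this]
    rw [sum_sub_distrib, ← mul_sum, h1, h2, show m + 1 + R.card = m + (R.card + 1) by ring]
    ring

theorem sum_mul_rootProd {n : ℕ} {u : Fin n → ℝ} {R : Finset (Fin n)}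
    (h : ∀ t < R.card, moment t u = 0) :
    ∑ i, u i * rootProd R i = (-1) ^ R.card * moment R.card u := by
  have := sum_mul_rootProd_aux u R 0 fun t _ ht => h t (by omega)
  simpa using this

theorem sum_mul_rootProd_erase {n : ℕ} {u : Fin n → ℝ} {R : Finset (Fin n)}
    (hu : ∀ i ∉ R, u i = 0) (j : Fin n) :
    ∑ i, u i * rootProd (R.erase j) i = u j * rootProd (R.erase j) j := by
  refine sum_eq_single j (fun i _ hi => ?_) (by simp)
  by_cases h : i ∈ R
  · rw [rootProd_of_mem (mem_erase.2 ⟨hi, h⟩), mul_zero]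
  · rw [hu i h, zero_mul]

/-- Vandermonde independence: pairing `u` with the polynomial whose roots are `R.erase j` isolates
`u j`. -/
theorem eq_zero_of_moments {n : ℕ} {u : Fin n → ℝ} {R : Finset (Fin n)} (hu : ∀ i ∉ R, u i = 0)
    (h : ∀ t < R.card, moment t u = 0) : u = 0 := by
  funext j
  by_cases hj : j ∈ R
  · have hc : (R.erase j).card < R.card := card_erase_lt_of_mem hj
    have h1 := sum_mul_rootProd (R := R.erase j) fun t ht => h t (ht.trans hc)
    rw [h _ hc, mul_zero, sum_mul_rootProd_erase hu] at h1
    exact (mul_eq_zero.1 h1).resolve_right (rootProd_ne_zero (notMem_erase _ _))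
  · exact hu j hj

/-- Vectors supported in `J`. -/
def extendZero {n : ℕ} (J : Finset (Fin n)) : (J → ℝ) →ₗ[ℝ] (Fin n → ℝ) :=
  LinearMap.pi fun i => if h : i ∈ J then LinearMap.proj ⟨i, h⟩ else 0

theorem extendZero_of_mem {n : ℕ} {J : Finset (Fin n)} (w : J → ℝ) {i : Fin n} (h : i ∈ J) :
    extendZero J w i = w ⟨i, h⟩ := by simp [extendZero, h]

theorem extendZero_of_notMem {n : ℕ} {J : Finset (Fin n)} (w : J → ℝ) {i : Fin n} (h : i ∉ J) :
    extendZero J w i = 0 := by simp [extendZero, h]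

theorem extendZero_injective {n : ℕ} (J : Finset (Fin n)) : Function.Injective (extendZero J) := by
  intro w w' h
  funext ⟨i, hi⟩
  rw [← extendZero_of_mem w hi, h, extendZero_of_mem]

/-- The dependency between `l + 1` moment vectors alternates in sign. -/
theorem exists_alternating {n l : ℕ} {J : Finset (Fin n)} (hJ : J.card = l + 1) (c : ℝ) :
    ∃ u : Fin n → ℝ, (∀ i ∉ J, u i = 0) ∧ (∀ t < l, moment t u = 0) ∧
      (-1) ^ l * moment l u = c ∧ ∀ i ∈ J, u i * rootProd (J.erase i) i = c := by
  have hlt : Module.finrank ℝ (EuclideanSpace ℝ (Fin l)) < Module.finrank ℝ (J → ℝ) := by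
    simp [hJ]
  obtain ⟨w, hw, hw0⟩ := Submodule.exists_mem_ne_zero_of_ne_bot
    (LinearMap.ker_ne_bot_of_finrank_lt (f := proj n l ∘ₗ extendZero J) hlt)
  set u := extendZero J w with hu
  have hu0 : u ≠ 0 := fun h => hw0 (extendZero_injective J (by rw [← hu, h, map_zero]))
  have hsupp : ∀ i ∉ J, u i = 0 := fun i hi => extendZero_of_notMem w hi
  have hmom : ∀ t < l, moment t u = 0 := by
    have : proj n l u = proj n l 0 := by rw [map_zero]; exact hw
    simpa using proj_eq_iff.1 this
  -- Isolating one coordinate at a time gives the same number for every `i`, namely the top moment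
  -- up to sign; it is nonzero because `u` is, so `u` can be rescaled to reach `c`.
  have hval : ∀ i ∈ J, u i * rootProd (J.erase i) i = (-1) ^ l * moment l u := fun i hi => by
    have hc : (J.erase i).card = l := by rw [card_erase_of_mem hi, hJ]; rfl
    rw [← sum_mul_rootProd_erase hsupp, sum_mul_rootProd (by rwa [hc]), hc]
  have hne : (-1) ^ l * moment l u ≠ 0 := by
    intro h
    apply hu0
    funext i
    by_cases hi : i ∈ J
    · have := hval i hi
      rw [h] at this
      exact (mul_eq_zero.1 this).resolve_right (rootProd_ne_zero (notMem_erase _ _))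
    · exact hsupp i hi
  refine ⟨(c / ((-1) ^ l * moment l u)) • u, fun i hi => by simp [hsupp i hi],
    fun t ht => by rw [map_smul, hmom t ht, smul_zero], ?_, fun i hi => ?_⟩
  · rw [map_smul, smul_eq_mul, mul_left_comm, div_mul_cancel₀ _ hne]
  · rw [Pi.smul_apply, smul_eq_mul, mul_assoc, hval i hi, div_mul_cancel₀ _ hne]

/-! ### Faces as extremal sections -/

/-- The sign of a side as a real number. -/
def Side.val : Side → ℝ
  | .src => -1
  | .tgt => 1

theorem Side.sign_cast (s : Side) (k : ℕ) : ((s.sign k : SignType) : ℝ) = s.val * (-1) ^ k := by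
  by_cases h : Even k
  · cases s <;> simp [Side.sign, Side.val, h]
  · cases s <;> simp [Side.sign, Side.val, h, Nat.not_even_iff_odd.1 h]

theorem Side.val_mul_val (s : Side) : s.val * s.val = 1 := by cases s <;> norm_num [Side.val]

theorem sign_mul_self (s : Side) (k : ℕ) :
    ((s.sign k : SignType) : ℝ) * ((s.sign k : SignType) : ℝ) = 1 := by
  rw [Side.sign_cast, mul_mul_mul_comm, Side.val_mul_val, ← pow_add, ← two_mul, pow_mul]
  simp

theorem mem_body {n : ℕ} {x : Cube n} {p : Fin n → ℝ} :
    p ∈ body x ↔ (∀ i, p i ∈ Set.Icc (-1 : ℝ) 1) ∧ ∀ i, x i ≠ 0 → p i = (x i : ℝ) := by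
  simp only [body, Set.mem_ofPred_eq, forall_and]

theorem body_subset {n : ℕ} {x y : Cube n} (h : ∀ i, x i ≠ 0 → y i = x i) : body y ⊆ body x := by
  intro p hp
  rw [mem_body] at hp ⊢
  exact ⟨hp.1, fun i hi => by rw [hp.2 i (by rw [h i hi]; exact hi), h i hi]⟩

theorem body_face_subset {n : ℕ} {s : Side} {l : ℕ} {x y : Cube n} (h : y ∈ faces s l x) :
    body y ⊆ body x := body_subset (mem_faces_iff.1 h).2.1

theorem body_subset_full {n : ℕ} (x : Cube n) : body x ⊆ body (full n) :=
  body_subset fun _ h => absurd rfl h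

theorem mem_body_face {n : ℕ} {s : Side} {x : Cube n} {R : Finset (Fin n)} {p : Fin n → ℝ}
    (hp : p ∈ body x) :
    p ∈ body (face s x R) ↔ ∀ i ∈ zeros x, i ∉ R → p i = (s.sign (rankIn R i) : SignType) := by
  rw [mem_body] at hp ⊢
  constructor
  · rintro ⟨-, h⟩ i hi hR
    have e : face s x R i = s.sign (rankIn R i) := by
      rw [face, if_neg hR, if_pos (mem_zeros.1 hi)]
    rw [h i (by rw [e]; exact s.sign_ne_zero _), e]
  · refine fun h => ⟨hp.1, fun i hi => ?_⟩
    by_cases hR : i ∈ R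
    · exact absurd (by simp [face, hR]) hi
    · by_cases hx : x i = 0
      · rw [h i (mem_zeros.2 hx) hR, face, if_neg hR, if_pos hx]
      · rw [hp.2 i hx, face, if_neg hR, if_neg hx]

/-- The union of the `s`-faces of dimension `l` of a cube. -/
def facesBody {n : ℕ} (s : Side) (l : ℕ) (x : Cube n) : Set (Fin n → ℝ) :=
  {p | ∃ y ∈ faces s l x, p ∈ body y}

theorem mem_facesBody {n : ℕ} {s : Side} {l : ℕ} {x : Cube n} {p : Fin n → ℝ} :
    p ∈ facesBody s l x ↔ p ∈ body x ∧ ∃ R ⊆ zeros x, R.card = l ∧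
      ∀ i ∈ zeros x, i ∉ R → p i = (s.sign (rankIn R i) : SignType) := by
  constructor
  · rintro ⟨y, hy, hp⟩
    have hx := body_face_subset hy hp
    obtain ⟨R, h1, h2, rfl⟩ := mem_faces.1 hy
    exact ⟨hx, R, h1, h2, (mem_body_face hx).1 hp⟩
  · rintro ⟨hx, R, h1, h2, h⟩
    exact ⟨_, mem_faces.2 ⟨R, h1, h2, rfl⟩, (mem_body_face hx).2 h⟩

theorem facesBody_subset {n : ℕ} (s : Side) (l : ℕ) (x : Cube n) : facesBody s l x ⊆ body x :=
  fun _ hp => (mem_facesBody.1 hp).1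

/-- Off `R`, a free coordinate of `p` is the endpoint of the interval whose sign is `s.val` times
the sign of the root product. Moving away from it to `q i` can only lower the paired functional. -/
theorem support_term_nonneg {n : ℕ} {s : Side} {x : Cube n} {R : Finset (Fin n)}
    {p q : Fin n → ℝ} (hp : p ∈ body x) (hq : q ∈ body x)
    (hR : ∀ i ∈ zeros x, i ∉ R → p i = (s.sign (rankIn R i) : SignType)) (i : Fin n) :
    0 ≤ s.val * ((p i - q i) * rootProd R i) ∧
      (i ∉ R → s.val * ((p i - q i) * rootProd R i) = 0 → p i = q i) := by
  by_cases hi : i ∈ R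
  · simp [rootProd_of_mem hi, hi]
  · by_cases hx : x i = 0
    · have h1 := hR i (mem_zeros.2 hx) hi
      have h2 := sign_mul_self s (rankIn R i)
      have h3 := rootProd_pos hi
      have h4 := (mem_body.1 hq).1 i
      rw [← h1] at h2
      have h5 : s.val * ((p i - q i) * rootProd R i) =
          (p i * (p i - q i)) * ((-1) ^ rankIn R i * rootProd R i) := by
        have h6 : p i * (-1) ^ rankIn R i = s.val := by
          rw [h1, Side.sign_cast, mul_assoc, ← pow_add, ← two_mul, pow_mul]; simp
        rw [← h6]; ring
      have h7 : p i = 1 ∨ p i = -1 := mul_self_eq_one_iff.1 h2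
      rw [h5]
      refine ⟨mul_nonneg ?_ h3.le, fun _ h => ?_⟩
      · rcases h7 with h7 | h7 <;> rw [h7] <;> linarith [h4.1, h4.2]
      · have := (mul_eq_zero.1 h).resolve_right h3.ne'
        have h8 : p i ≠ 0 := by rcases h7 with h7 | h7 <;> rw [h7] <;> norm_num
        linarith [(mul_eq_zero.1 this).resolve_left h8]
    · have : p i = q i := by rw [(mem_body.1 hp).2 i hx, (mem_body.1 hq).2 i hx]
      simp [this]

/-- The points of `facesBody s l x` are the unique maximisers of a linear functional on the fibres
of the projection of `body x`. -/
theorem moment_le_of_mem_facesBody {n : ℕ} {s : Side} {l : ℕ} {x : Cube n} {p q : Fin n → ℝ}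
    (hp : p ∈ facesBody s l x) (hq : q ∈ body x) (h : proj n l p = proj n l q) :
    s.val * ((-1) ^ l * moment l q) ≤ s.val * ((-1) ^ l * moment l p) ∧
      (moment l q = moment l p → q = p) := by
  obtain ⟨hx, R, -, rfl, hR⟩ := mem_facesBody.1 hp
  have hm : ∀ t < R.card, moment t (p - q) = 0 := fun t ht => by
    rw [map_sub, proj_eq_iff.1 h t ht, sub_self]
  have h1 := sum_mul_rootProd hm
  -- Within a fibre the pairing with the root polynomial sees only the moment of order `R.card`. The
  -- gap of the functional is thus a sum of nonnegative terms, and if it vanishes then `p - q` is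
  -- supported in `R` and is zero by Vandermonde.
  have h2 : ∑ i, s.val * ((p i - q i) * rootProd R i) =
      s.val * ((-1) ^ R.card * moment R.card p) - s.val * ((-1) ^ R.card * moment R.card q) := by
    rw [← mul_sum, ← mul_sub, ← mul_sub, ← map_sub, ← h1]; rfl
  have h3 := support_term_nonneg hx hq hR
  refine ⟨?_, fun he => ?_⟩
  · rw [← sub_nonneg, ← h2]
    exact sum_nonneg fun i _ => (h3 i).1
  · rw [he, sub_self, sum_eq_zero_iff_of_nonneg fun i _ => (h3 i).1] at h2
    have h4 := eq_zero_of_moments (u := p - q) (R := R)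
      (fun i hi => sub_eq_zero.2 ((h3 i).2 hi (h2 i (mem_univ i)))) hm
    exact (sub_eq_zero.1 h4).symm

theorem facesBody_injOn {n : ℕ} (s : Side) (l : ℕ) (x : Cube n) :
    Set.InjOn (proj n l) (facesBody s l x) := by
  intro p hp q hq h
  obtain ⟨h1, h2⟩ := moment_le_of_mem_facesBody hp (facesBody_subset _ _ _ hq) h
  obtain ⟨h3, -⟩ := moment_le_of_mem_facesBody hq (facesBody_subset _ _ _ hp) h.symm
  have h4 := le_antisymm h1 h3
  have hne : s.val ≠ 0 := by cases s <;> norm_num [Side.val]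
  exact (h2 (mul_left_cancel₀ (by simp) (mul_left_cancel₀ hne h4))).symm

/-- A sign vector either agrees with a face pattern, or has many alternations. -/
theorem exists_pattern {n : ℕ} (s : Side) (P : Fin n → SignType → Prop) (Z : Finset (Fin n)) :
    ∀ l ≤ Z.card, (∃ R ⊆ Z, R.card = l ∧ ∀ i ∈ Z, i ∉ R → P i (s.sign (rankIn R i))) ∨
      ∃ J ⊆ Z, J.card = l + 1 ∧ ∀ i ∈ J, ¬ P i (s.sign (rankIn J i)) := by
  induction Z using Finset.induction_on_max with
  | empty =>
    intro l hl
    obtain rfl : l = 0 := by simpa using hl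
    exact .inl ⟨∅, by simp⟩
  | insert a Z hZ ih =>
    intro l hl
    have haZ : a ∉ Z := fun h => lt_irrefl _ (hZ a h)
    rw [card_insert_of_notMem haZ] at hl
    have hrank : ∀ R ⊆ Z, rankIn R a = R.card := fun R hR => by
      rw [rankIn, filter_true_of_mem fun i hi => hZ i (hR hi)]
    have hrank' : ∀ R, ∀ i ∈ Z, rankIn (insert a R) i = rankIn R i := fun R i hi => by
      rw [rankIn, filter_insert, if_neg (hZ i hi).not_gt]; rfl
    rcases hl.lt_or_eq with hl | rfl
    · by_cases hP : P a (s.sign l)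
      · rcases ih l (by omega) with ⟨R, h1, h2, h3⟩ | ⟨J, h1, h2, h3⟩
        · refine .inl ⟨R, h1.trans (subset_insert _ _), h2, fun i hi hR => ?_⟩
          rcases mem_insert.1 hi with rfl | hi
          · rwa [hrank R h1, h2]
          · exact h3 i hi hR
        · exact .inr ⟨J, h1.trans (subset_insert _ _), h2, h3⟩
      · cases l with
        | zero => exact .inr ⟨{a}, by simp, by simp, by simpa [rankIn, filter_singleton] using hP⟩
        | succ l =>
          rcases ih l (by omega) with ⟨R, h1, h2, h3⟩ | ⟨J, h1, h2, h3⟩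
          · refine .inl ⟨insert a R, insert_subset_insert a h1,
              by rw [card_insert_of_notMem fun h => haZ (h1 h), h2], fun i hi hR => ?_⟩
            rw [mem_insert, not_or] at hR
            have hi' := (mem_insert.1 hi).resolve_left hR.1
            rw [hrank' R i hi']
            exact h3 i hi' hR.2
          · refine .inr ⟨insert a J, insert_subset_insert a h1,
              by rw [card_insert_of_notMem fun h => haZ (h1 h), h2], fun i hi => ?_⟩
            rcases mem_insert.1 hi with rfl | hi
            · rw [rankIn, filter_insert, if_neg (lt_irrefl _), ← rankIn, hrank J h1, h2]
              exact hP
            · rw [hrank' J i (h1 hi)]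
              exact h3 i hi
    · exact .inl ⟨insert a Z, subset_rfl, card_insert_of_notMem haZ, fun i hi hi' => absurd hi hi'⟩

theorem isCompact_body {n : ℕ} (x : Cube n) : IsCompact (body x) := by
  have : body x = (Set.univ.pi fun _ => Set.Icc (-1 : ℝ) 1) ∩
      ⋂ i, {p | x i ≠ 0 → p i = (x i : ℝ)} := by
    ext p
    simp only [mem_body, Set.mem_inter_iff, Set.mem_univ_pi, Set.mem_iInter, Set.mem_ofPred_eq]
  rw [this]
  refine (isCompact_univ_pi fun _ => isCompact_Icc).inter_right (isClosed_iInter fun i => ?_)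
  by_cases h : x i = 0
  · simp [h]
  · simpa [h] using isClosed_eq (continuous_apply i) continuous_const

theorem convex_body {n : ℕ} (x : Cube n) : Convex ℝ (body x) := by
  intro p hp q hq a b ha hb hab
  rw [mem_body] at hp hq ⊢
  refine ⟨fun i => convex_Icc (-1 : ℝ) 1 (hp.1 i) (hq.1 i) ha hb hab, fun i hi => ?_⟩
  simp only [Pi.add_apply, Pi.smul_apply, smul_eq_mul]
  rw [hp.2 i hi, hq.2 i hi, ← add_mul, hab, one_mul]

/-- Take a maximiser of the signed moment of order `l` on the compact fibre. If it did not fit any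
face pattern, there would be `l + 1` coordinates along which an alternating dependency moves it
inside the cube, within the fibre, and increases the functional. -/
theorem exists_mem_facesBody {n : ℕ} (s : Side) {l : ℕ} {x : Cube n} (hl : l ≤ dim x)
    {p : Fin n → ℝ} (hp : p ∈ body x) : ∃ q ∈ facesBody s l x, proj n l q = proj n l p := by
  have hK : IsCompact (body x ∩ proj n l ⁻¹' {proj n l p}) :=
    (isCompact_body x).inter_right (isClosed_singleton.preimage (continuous_proj n l))
  obtain ⟨q, hq, hmax⟩ := hK.exists_isMaxOn ⟨p, hp, rfl⟩
    (f := fun q => s.val * ((-1) ^ l * moment l q))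
    (Continuous.continuousOn (by
      have : Continuous (moment (n := n) l) := LinearMap.continuous_of_finiteDimensional _
      fun_prop))
  refine ⟨q, ?_, hq.2⟩
  rcases exists_pattern s (fun i σ => q i = (σ : ℝ)) (zeros x) l hl with
    ⟨R, h1, h2, h3⟩ | ⟨J, h1, h2, h3⟩
  · exact mem_facesBody.2 ⟨hq.1, R, h1, h2, h3⟩
  exfalso
  -- With the constant `s.val`, a step `ε • u` raises the signed moment by exactly `ε`.
  obtain ⟨u, u1, u2, u3, u4⟩ := exists_alternating h2 s.val
  have hsmall : ∀ᶠ ε in nhdsWithin (0 : ℝ) (Set.Ioi 0), q + ε • u ∈ body x := by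
    have : ∀ i, ∀ᶠ ε in nhdsWithin (0 : ℝ) (Set.Ioi 0), q i + ε * u i ∈ Set.Icc (-1 : ℝ) 1 := by
      intro i
      have hqi := (mem_body.1 hq.1).1 i
      by_cases hi : i ∈ J
      · have hne := h3 i hi
        have h5 := rootProd_pos (notMem_erase i J)
        have hr : rankIn (J.erase i) i = rankIn J i := by
          rw [rankIn, rankIn, filter_erase, erase_eq_of_notMem (by simp)]
        rw [hr] at h5
        -- The direction `u i` points towards the endpoint `s.sign (rankIn J i)`, which `q i` has
        -- not reached by the choice of `J`; so there is room for a small step.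
        have h6 : 0 < u i * (s.sign (rankIn J i) : SignType) := by
          have h7 : u i * (s.sign (rankIn J i) : SignType) *
              ((-1) ^ rankIn J i * rootProd (J.erase i) i) = 1 := by
            rw [Side.sign_cast]
            calc _ = s.val * (u i * rootProd (J.erase i) i) *
                  ((-1) ^ rankIn J i * (-1) ^ rankIn J i) := by ring
              _ = 1 := by
                rw [u4 i hi, Side.val_mul_val, ← pow_add, ← two_mul, pow_mul]; simp
          exact pos_of_mul_pos_left (by rw [h7]; exact one_pos) h5.le
        have hcont : Filter.Tendsto (fun ε : ℝ => q i + ε * u i)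
            (nhdsWithin (0 : ℝ) (Set.Ioi 0)) (nhds (q i)) := by
          have : Continuous fun ε : ℝ => q i + ε * u i := by fun_prop
          simpa using (this.tendsto 0).mono_left nhdsWithin_le_nhds
        have hpos : ∀ᶠ ε in nhdsWithin (0 : ℝ) (Set.Ioi 0), 0 < ε := self_mem_nhdsWithin
        rcases mul_self_eq_one_iff.1 (sign_mul_self s (rankIn J i)) with h8 | h8
        · rw [h8] at hne h6
          have hlt : q i < 1 := lt_of_le_of_ne hqi.2 hne
          filter_upwards [hcont.eventually_lt_const hlt, hpos] with ε h9 h10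
          have := mul_pos h10 (by linarith : 0 < u i)
          exact ⟨by linarith [hqi.1], h9.le⟩
        · rw [h8] at hne h6
          have hlt : -1 < q i := lt_of_le_of_ne hqi.1 (Ne.symm hne)
          filter_upwards [hcont.eventually_const_lt hlt, hpos] with ε h9 h10
          have := mul_pos h10 (by linarith : 0 < - u i)
          exact ⟨h9.le, by linarith [hqi.2]⟩
      · exact .of_forall fun ε => by rw [u1 i hi, mul_zero, add_zero]; exact hqi
    filter_upwards [Filter.eventually_all.2 this] with ε hε
    rw [mem_body]
    refine ⟨hε, fun i hi => ?_⟩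
    have : i ∉ J := fun h => hi (mem_zeros.1 (h1 h))
    simp [u1 i this, (mem_body.1 hq.1).2 i hi]
  obtain ⟨ε, hε, hpos⟩ := (hsmall.and self_mem_nhdsWithin).exists
  have hproj : proj n l (q + ε • u) = proj n l p := by
    rw [← show proj n l q = _ from hq.2, proj_eq_iff]
    intro t ht
    rw [map_add, map_smul, u2 t ht, smul_zero, add_zero]
  have h4 := hmax ⟨hε, hproj⟩
  simp only [Set.mem_ofPred_eq, map_add, map_smul, smul_eq_mul] at h4
  have h5 : s.val * ((-1) ^ l * (moment l q + ε * moment l u)) =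
      s.val * ((-1) ^ l * moment l q) + ε := by
    calc _ = s.val * ((-1) ^ l * moment l q) + ε * (s.val * ((-1) ^ l * moment l u)) := by ring
      _ = _ := by rw [u3, Side.val_mul_val, mul_one]
  rw [h5] at h4
  have : (0 : ℝ) < ε := hpos
  linarith

/-! ### Interior and boundary of the projection of a cube -/

/-- Restricted to `l` of the free coordinates, the projection is a linear isomorphism onto `ℝˡ` by
Vandermonde, hence open, and these coordinates can be varied freely near `p`. -/
theorem proj_mem_interior {n l : ℕ} {x : Cube n} {p : Fin n → ℝ} (hp : p ∈ body x)
    {I : Finset (Fin n)} (hI : I ⊆ zeros x) (hl : l ≤ I.card)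
    (hin : ∀ i ∈ I, p i ∈ Set.Ioo (-1 : ℝ) 1) : proj n l p ∈ interior (proj n l '' body x) := by
  obtain ⟨J, hJI, hJ⟩ := exists_subset_card_eq hl
  set A := proj n l ∘ₗ extendZero J with hA
  have hinj : Function.Injective A := by
    rw [injective_iff_map_eq_zero]
    intro w hw
    apply extendZero_injective J
    rw [map_zero]
    refine eq_zero_of_moments (R := J) (fun i hi => extendZero_of_notMem w hi) fun t ht => ?_
    have : proj n l (extendZero J w) = proj n l 0 := by rw [map_zero]; exact hw
    rw [proj_eq_iff.1 this t (hJ ▸ ht), map_zero]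
  have hsurj : Function.Surjective A :=
    (LinearMap.injective_iff_surjective_of_finrank_eq_finrank (by simp [hJ])).1 hinj
  have hopen := A.isOpenMap_of_finiteDimensional hsurj
  let N : Set (J → ℝ) := ⋂ i : J, {w | p i + w i ∈ Set.Ioo (-1 : ℝ) 1}
  have hN : IsOpen N := isOpen_iInter_of_finite fun i =>
    isOpen_Ioo.preimage (by fun_prop : Continuous fun w : J → ℝ => p i + w i)
  refine mem_interior.2 ⟨(fun z => proj n l p + z) '' (A '' N), ?_,
    (Homeomorph.addLeft (proj n l p)).isOpenMap _ (hopen _ hN), ?_⟩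
  · rintro _ ⟨_, ⟨w, hw, rfl⟩, rfl⟩
    refine ⟨p + extendZero J w, ?_, by rw [map_add]; rfl⟩
    rw [mem_body] at hp ⊢
    refine ⟨fun i => ?_, fun i hi => ?_⟩
    · by_cases h : i ∈ J
      · rw [Pi.add_apply, extendZero_of_mem w h]
        exact Set.Ioo_subset_Icc_self (Set.mem_iInter.1 hw ⟨i, h⟩)
      · rw [Pi.add_apply, extendZero_of_notMem w h, add_zero]
        exact hp.1 i
    · have h : i ∉ J := fun h => hi (mem_zeros.1 (hI (hJI h)))
      rw [Pi.add_apply, extendZero_of_notMem w h, add_zero]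
      exact hp.2 i hi
  · refine ⟨0, ⟨0, ?_, map_zero A⟩, add_zero _⟩
    refine Set.mem_iInter.2 fun i => ?_
    simpa using hin i (hJI i.2)

/-- The points where two points of a cube differ are interior on the segment between them. -/
theorem segment_mem_Ioo {a b θ : ℝ} (ha : a ∈ Set.Icc (-1 : ℝ) 1) (hb : b ∈ Set.Icc (-1 : ℝ) 1)
    (hab : a ≠ b) (h0 : 0 < θ) (h1 : θ < 1) : (1 - θ) * a + θ * b ∈ Set.Ioo (-1 : ℝ) 1 := by
  obtain ⟨a1, a2⟩ := ha
  obtain ⟨b1, b2⟩ := hb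
  have h2 : 0 < 1 - θ := by linarith
  rcases lt_or_gt_of_ne hab with h | h
  · constructor
    · nlinarith
    · nlinarith
  · constructor
    · nlinarith
    · nlinarith

/-- Distinct points with equal first `l` moments differ in at least `l + 1` coordinates, and these
are all interior on the open segment. This gains one dimension: `m = l + 1` is allowed. -/
theorem proj_segment_mem_interior {n l m : ℕ} {x : Cube n} {p q : Fin n → ℝ} (hp : p ∈ body x)
    (hq : q ∈ body x) (hpq : proj n l p = proj n l q) (hne : p ≠ q) (hm : m ≤ l + 1) {θ : ℝ}
    (h0 : 0 < θ) (h1 : θ < 1) :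
    proj n m ((1 - θ) • p + θ • q) ∈ interior (proj n m '' body x) := by
  refine proj_mem_interior (I := univ.filter fun i => p i ≠ q i)
    (convex_body x hp hq (by linarith) h0.le (by ring)) (fun i hi => ?_) ?_ fun i hi => ?_
  · rw [mem_zeros]
    by_contra h
    exact (mem_filter.1 hi).2 (by rw [(mem_body.1 hp).2 i h, (mem_body.1 hq).2 i h])
  · by_contra! h
    refine hne (sub_eq_zero.1 (eq_zero_of_moments (R := univ.filter fun i => p i ≠ q i)
      (fun i hi => ?_) fun t ht => ?_))
    · simpa [sub_eq_zero] using hi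
    · rw [map_sub, proj_eq_iff.1 hpq t (by omega), sub_self]
  · exact segment_mem_Ioo ((mem_body.1 hp).1 i) ((mem_body.1 hq).1 i) (mem_filter.1 hi).2 h0 h1

theorem eq_of_proj_notMem_interior {n l : ℕ} {x : Cube n} {p q : Fin n → ℝ} (hp : p ∈ body x)
    (hq : q ∈ body x) (hpq : proj n l p = proj n l q)
    (h : proj n l p ∉ interior (proj n l '' body x)) : p = q := by
  by_contra hne
  apply h
  have := proj_segment_mem_interior (m := l) hp hq hpq hne (by omega) (θ := 1 / 2) (by norm_num)
    (by norm_num)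
  rwa [map_add, map_smul, map_smul, ← hpq, ← add_smul, show (1 : ℝ) - 1 / 2 + 1 / 2 = 1 by norm_num,
    one_smul] at this


/-! ### Sections of the projections -/

/-- `V` is the image of a section of the projection of the `n`-cube to `ℝˡ`. -/
structure IsSection {n : ℕ} (l : ℕ) (V : Set (Fin n → ℝ)) : Prop where
  subset : V ⊆ body (full n)
  injOn : Set.InjOn (proj n l) V
  image : proj n l '' V = proj n l '' body (full n)

theorem IsSection.exists_mem {n l : ℕ} {V : Set (Fin n → ℝ)} (h : IsSection l V) {p : Fin n → ℝ}
    (hp : p ∈ body (full n)) : ∃ q ∈ V, proj n l q = proj n l p := by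
  have : proj n l p ∈ proj n l '' V := h.image ▸ Set.mem_image_of_mem _ hp
  exact this

theorem isSection_facesBody {n l : ℕ} (s : Side) (hl : l ≤ n) :
    IsSection l (facesBody s l (full n)) where
  subset := facesBody_subset _ _ _
  injOn := facesBody_injOn s l _
  image := by
    refine (Set.image_mono (facesBody_subset _ _ _)).antisymm ?_
    rintro _ ⟨p, hp, rfl⟩
    exact exists_mem_facesBody s (by rwa [dim_full]) hp

theorem isClosed_image_body {n : ℕ} (l : ℕ) (x : Cube n) : IsClosed (proj n l '' body x) :=
  ((isCompact_body x).image (continuous_proj n l)).isClosed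

/-- Pairing with the root polynomial of `R` uses only the moments of order at most `l`, so it is a
functional on `ℝˡ⁺¹`. Up to the sign of `s` it attains its maximum over the projected cube at `p`,
and it is not constant because `R` misses some coordinate. -/
theorem proj_facesBody_notMem_interior {n l : ℕ} (s : Side) (hl : l < n) {p : Fin n → ℝ}
    (hp : p ∈ facesBody s l (full n)) :
    proj n (l + 1) p ∉ interior (proj n (l + 1) '' body (full n)) := by
  intro hint
  obtain ⟨hx, R, -, rfl, hR⟩ := mem_facesBody.1 hp
  obtain ⟨i, hi⟩ : ∃ i, i ∉ R := by
    by_contra! h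
    have : R = univ := eq_univ_of_forall h
    rw [this] at hl
    simp at hl
  -- Subtracting `ε • d` raises the signed functional by `ε` times the square of `rootProd R i`. The
  -- shifted point may leave the cube, but interiority supplies a point `q` of the cube with the
  -- same projection, beyond the maximum.
  set d : Fin n → ℝ := Pi.single i (-(s.val * rootProd R i)) with hd
  have hcont : Filter.Tendsto (fun ε : ℝ => proj n (R.card + 1) (p - ε • d))
      (nhds 0) (nhds (proj n (R.card + 1) p)) := by
    have : Continuous fun ε : ℝ => proj n (R.card + 1) (p - ε • d) :=
      (continuous_proj _ _).comp (by fun_prop)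
    simpa using this.tendsto 0
  have hev := (hcont.eventually (mem_interior_iff_mem_nhds.1 hint)).filter_mono
    (nhdsWithin_le_nhds (s := Set.Ioi 0))
  obtain ⟨ε, ⟨q, hq, hqe⟩, hε⟩ := (hev.and self_mem_nhdsWithin).exists
  have hε : (0 : ℝ) < ε := hε
  have hm : ∀ t < R.card + 1, moment t (p - q - ε • d) = 0 := fun t ht => by
    have := proj_eq_iff.1 hqe t ht
    rw [map_sub] at this
    rw [map_sub, map_sub, this]
    ring
  have h1 := sum_mul_rootProd (R := R) fun t ht => hm t (by omega)
  rw [hm _ (by omega), mul_zero] at h1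
  have h2 : ∑ j, (p - q - ε • d) j * rootProd R j =
      ∑ j, (p j - q j) * rootProd R j - ε * (d i * rootProd R i) := by
    rw [← sum_eq_single (s := univ) (f := fun j => d j * rootProd R j) i
      (fun j _ hj => by simp [hd, Pi.single_eq_of_ne hj]) (by simp), mul_sum, ← sum_sub_distrib]
    refine sum_congr rfl fun j _ => ?_
    simp only [Pi.sub_apply, Pi.smul_apply, smul_eq_mul]
    ring
  have h3 : 0 ≤ ∑ j, s.val * ((p j - q j) * rootProd R j) :=
    sum_nonneg fun j _ => (support_term_nonneg hx hq hR j).1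
  rw [← mul_sum, show ∑ j, (p j - q j) * rootProd R j = ε * (d i * rootProd R i) by linarith] at h3
  have h4 : s.val * (ε * (d i * rootProd R i)) = - (ε * (rootProd R i * rootProd R i)) := by
    have : d i = -(s.val * rootProd R i) := by simp [hd]
    rw [this]
    linear_combination (-ε * rootProd R i * rootProd R i) * s.val_mul_val
  rw [h4] at h3
  have h5 := mul_pos hε (mul_self_pos.2 (rootProd_ne_zero hi))
  linarith

/-- These faces project to the frontier, where fibres are single points, so every section contains
them. -/
theorem IsSection.facesBody_subset {n l : ℕ} {V : Set (Fin n → ℝ)} (h : IsSection (l + 1) V)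
    (s : Side) (hl : l < n) : facesBody s l (full n) ⊆ V := by
  intro p hp
  have hp' := Cubical.facesBody_subset _ _ _ hp
  obtain ⟨q, hq, hqp⟩ := h.exists_mem hp'
  rwa [eq_of_proj_notMem_interior hp' (h.subset hq) hqp.symm (proj_facesBody_notMem_interior s hl hp)]

/-- A point of the cube lies, for the moment of order `l`, between the source point `a` and the
target point `b` of its fibre over `ℝˡ`. If it is neither of them, it has the same projection to
`ℝˡ⁺¹` as an interior point of the segment from `a` to `b`, which projects to the interior. -/
theorem IsSection.frontier_eq {n l : ℕ} {V : Set (Fin n → ℝ)} (h : IsSection (l + 1) V)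
    (hl : l < n) : {p ∈ V | proj n (l + 1) p ∈ frontier (proj n (l + 1) '' body (full n))} =
      facesBody .src l (full n) ∪ facesBody .tgt l (full n) := by
  rw [(isClosed_image_body _ _).frontier_eq]
  ext p
  constructor
  · rintro ⟨hp, -, hint⟩
    have hx := h.subset hp
    obtain ⟨a, ha, ha'⟩ := exists_mem_facesBody .src (l := l) (by rw [dim_full]; omega) hx
    obtain ⟨b, hb, hb'⟩ := exists_mem_facesBody .tgt (l := l) (by rw [dim_full]; omega) hx
    have hxa := Cubical.facesBody_subset _ _ _ ha
    have hxb := Cubical.facesBody_subset _ _ _ hb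
    obtain ⟨ha1, ha2⟩ := moment_le_of_mem_facesBody ha hx ha'
    obtain ⟨hb1, hb2⟩ := moment_le_of_mem_facesBody hb hx hb'
    by_cases hpa : p = a
    · exact .inl (hpa ▸ ha)
    by_cases hpb : p = b
    · exact .inr (hpb ▸ hb)
    exfalso
    have hc : ((-1 : ℝ)) ^ l ≠ 0 := by simp
    simp only [Side.val] at ha1 hb1
    have h1 : (-1) ^ l * moment l a < (-1) ^ l * moment l p :=
      lt_of_le_of_ne (by linarith) fun he => hpa (ha2 (mul_left_cancel₀ hc he).symm)
    have h2 : (-1) ^ l * moment l p < (-1) ^ l * moment l b :=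
      lt_of_le_of_ne (by linarith) fun he => hpb (hb2 (mul_left_cancel₀ hc he))
    have h3 : moment l b - moment l a ≠ 0 := fun he => by
      rw [sub_eq_zero.1 he] at h2
      linarith
    -- The parameter at which the segment from `a` to `b` has the moment of order `l` of `p`; the
    -- lower moments agree anyway.
    set θ := (moment l p - moment l a) / (moment l b - moment l a) with hθ
    have hθ' : θ = ((-1) ^ l * moment l p - (-1) ^ l * moment l a) /
        ((-1) ^ l * moment l b - (-1) ^ l * moment l a) := by
      rw [← mul_sub, ← mul_sub, mul_div_mul_left _ _ hc]
    have h0 : 0 < θ := by rw [hθ']; exact div_pos (by linarith) (by linarith)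
    have h1' : θ < 1 := by rw [hθ', div_lt_one (by linarith)]; linarith
    have hab : a ≠ b := fun he => h3 (by rw [he, sub_self])
    have := proj_segment_mem_interior (m := l + 1) hxa hxb (ha'.trans hb'.symm) hab le_rfl h0 h1'
    apply hint
    convert this using 1
    rw [proj_eq_iff]
    intro t ht
    rw [map_add, map_smul, map_smul, smul_eq_mul, smul_eq_mul]
    rcases Nat.lt_succ_iff_lt_or_eq.1 ht with ht | rfl
    · rw [proj_eq_iff.1 ha' t ht, proj_eq_iff.1 hb' t ht]
      ring
    · have : θ * (moment t b - moment t a) = moment t p - moment t a := div_mul_cancel₀ _ h3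
      linarith
  · intro hp
    have key : ∀ s, p ∈ facesBody s l (full n) → p ∈ V ∧
        proj n (l + 1) p ∈ proj n (l + 1) '' body (full n) \
          interior (proj n (l + 1) '' body (full n)) := fun s hp =>
      ⟨h.facesBody_subset s hl hp, Set.mem_image_of_mem _ (Cubical.facesBody_subset _ _ _ hp),
        proj_facesBody_notMem_interior s hl hp⟩
    exact hp.elim (key _) (key _)

/-- The projection maps the compact set `V` bijectively onto a compact convex body with nonempty
interior, and such a body is carried to the unit ball, frontier to sphere, by a homeomorphism of
`ℝˡ`. -/
theorem IsSection.isDiskWithBoundary {n l : ℕ} {V : Set (Fin n → ℝ)} (h : IsSection l V)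
    (hV : IsCompact V) (hl : l ≤ n) :
    IsDiskWithBoundary l V {p ∈ V | proj n l p ∈ frontier (proj n l '' body (full n))} := by
  set Z := proj n l '' body (full n) with hZ
  have hZc : IsCompact Z := (isCompact_body _).image (continuous_proj n l)
  have h0 : (0 : Fin n → ℝ) ∈ body (full n) := by simp [mem_body, full]
  have hint : (interior Z).Nonempty := ⟨_, proj_mem_interior h0 (I := univ)
    (fun i _ => mem_zeros.2 rfl) (by simpa using hl) (by simp)⟩
  obtain ⟨g, -, g2, g3⟩ := exists_homeomorph_image_interior_closure_frontier_eq_unitBall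
    ((convex_body (full n)).linear_image (proj n l)) hint hZc.isBounded
  rw [← hZ, hZc.isClosed.closure_eq] at g2
  rw [← hZ] at g3
  have hmem : ∀ p : V, g (proj n l p) ∈ Metric.closedBall (0 : EuclideanSpace ℝ (Fin l)) 1 :=
    fun p => g2 ▸ Set.mem_image_of_mem _ (Set.mem_image_of_mem _ (h.subset p.2))
  let f : V → Metric.closedBall (0 : EuclideanSpace ℝ (Fin l)) 1 := fun p => ⟨g (proj n l p), hmem p⟩
  have hf : Function.Bijective f := by
    constructor
    · intro p q hpq
      exact Subtype.ext (h.injOn p.2 q.2 (g.injective (Subtype.ext_iff.1 hpq)))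
    · rintro ⟨z, hz⟩
      rw [← g2, hZ, ← h.image] at hz
      obtain ⟨_, ⟨p, hp, rfl⟩, rfl⟩ := hz
      exact ⟨⟨p, hp⟩, rfl⟩
  have hfc : Continuous f :=
    (g.continuous.comp ((continuous_proj n l).comp continuous_subtype_val)).subtype_mk _
  have : CompactSpace V := isCompact_iff_compactSpace.1 hV
  let e : V ≃ₜ Metric.closedBall (0 : EuclideanSpace ℝ (Fin l)) 1 :=
    Continuous.homeoOfEquivCompactToT2 (f := Equiv.ofBijective f hf) hfc
  have he : ∀ p, ((e p : Metric.closedBall (0 : EuclideanSpace ℝ (Fin l)) 1) :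
      EuclideanSpace ℝ (Fin l)) = g (proj n l p) := fun p => rfl
  refine ⟨e.symm, ?_⟩
  have hfr : ∀ z, z ∈ frontier Z ↔ ‖g z‖ = 1 := fun z => by
    rw [← mem_sphere_zero_iff_norm, ← g3, g.injective.mem_set_image]
  ext p
  constructor
  · rintro ⟨z, hz, rfl⟩
    refine ⟨(e.symm z).2, ?_⟩
    rw [hfr, ← he, e.apply_symm_apply]
    exact hz
  · rintro ⟨hp, hp'⟩
    refine ⟨e ⟨p, hp⟩, ?_, by simp⟩
    rw [Set.mem_ofPred_eq, he]
    exact (hfr _).1 hp'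

/-! ### The effect of a cube on a section -/

theorem pileBody_eq {n : ℕ} (v : PrePile n) (k : ℕ) : pileBody v k = ⋃ x ∈ v k, body x := by
  ext p; simp [pileBody]

theorem isCompact_pileBody {n : ℕ} (v : PrePile n) (k : ℕ) : IsCompact (pileBody v k) := by
  rw [pileBody_eq]
  exact (v k).isCompact_biUnion fun x _ => isCompact_body x

/-- The union of a finite set of sub-cubes. -/
def setBody {n : ℕ} (V : Finset (Cube n)) : Set (Fin n → ℝ) := {p | ∃ x ∈ V, p ∈ body x}

/-- The centre of a sub-cube. -/
def centre {n : ℕ} (x : Cube n) : Fin n → ℝ := fun i => (x i : ℝ)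

theorem centre_mem {n : ℕ} (x : Cube n) : centre x ∈ body x := by
  refine mem_body.2 ⟨fun i => ?_, fun _ _ => rfl⟩
  rw [centre]
  rcases SignType.trichotomy (x i) with h | h | h <;> rw [h] <;> simp

theorem signType_cast_inj {a b : SignType} (h : (a : ℝ) = b) : a = b := by
  rcases SignType.trichotomy a with rfl | rfl | rfl <;>
    rcases SignType.trichotomy b with rfl | rfl | rfl <;> norm_num at h <;> rfl

section flip
variable {n l : ℕ} {V : Finset (Cube n)} {x : Cube n}

theorem mem_facesBody_of_mem_body (hV : IsSection l (setBody V)) (hx : faces .src l x ⊆ V)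
    (hl : l ≤ dim x) {p : Fin n → ℝ} (hp : p ∈ setBody V) (hpx : p ∈ body x) :
    p ∈ facesBody .src l x := by
  obtain ⟨q, hq, hqp⟩ := exists_mem_facesBody .src hl hpx
  obtain ⟨y, hy, hqy⟩ := hq
  rw [← hV.injOn ⟨y, hx hy, hqy⟩ hp hqp]
  exact ⟨y, hy, hqy⟩

/-- The centre of `y` lies in some source face `z` of `x`. All coordinates of the centre are `0` or
`±1` as in `y`, so `y` is a sub-cube of `z`, and equal dimension forces equality. -/
theorem mem_faces_of_subcube (hV : IsSection l (setBody V)) (hdim : ∀ y ∈ V, dim y = l)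
    (hx : faces .src l x ⊆ V) (hl : l ≤ dim x) {y : Cube n} (hy : y ∈ V)
    (hyx : ∀ i, x i ≠ 0 → y i = x i) : y ∈ faces .src l x := by
  obtain ⟨z, hz, hc⟩ := mem_facesBody_of_mem_body hV hx hl ⟨y, hy, centre_mem y⟩
    (body_subset hyx (centre_mem y))
  have hne : ∀ i, z i ≠ 0 → y i = z i := fun i hi => signType_cast_inj ((mem_body.1 hc).2 i hi)
  have hsub : zeros y ⊆ zeros z := fun i hi => by
    rw [mem_zeros] at hi ⊢
    by_contra h
    exact h (hne i h ▸ hi)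
  have heq : zeros y = zeros z := eq_of_subset_of_card_le hsub (by
    rw [card_zeros, card_zeros, hdim y hy, dim_of_mem_faces hz])
  have : y = z := by
    funext i
    by_cases h : z i = 0
    · rw [h, ← mem_zeros, heq, mem_zeros, h]
    · exact hne i h
  rwa [this]

/-- Since `y` is not a source face, it is free in some coordinate `i` fixed in `x`. If `p` projected
to the interior of the image of `x`, moving `p` slightly inside `y` along `i` would keep the
projection over `x`; the section would then have two points over it, one in `x` and one outside. So
`p` lies over the frontier, where it is the only point of its fibre in `x`. -/
theorem mem_facesBody_tgt (hV : IsSection l (setBody V)) (hdim : ∀ y ∈ V, dim y = l)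
    (hx : faces .src l x ⊆ V) (hl : l ≤ dim x) {y : Cube n} (hy : y ∈ V)
    (hyx : y ∉ faces .src l x) {p : Fin n → ℝ} (hpy : p ∈ body y) (hpx : p ∈ body x) :
    p ∈ facesBody .tgt l x := by
  obtain ⟨i, hi, hi'⟩ : ∃ i, x i ≠ 0 ∧ y i ≠ x i := by
    by_contra! h
    exact hyx (mem_faces_of_subcube hV hdim hx hl hy h)
  have hpi := (mem_body.1 hpx).2 i hi
  have hyi : y i = 0 := by
    by_contra h
    exact hi' (signType_cast_inj (by rw [← (mem_body.1 hpy).2 i h, hpi]))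
  have hpne : p i ≠ 0 := by
    rw [hpi]
    rcases SignType.trichotomy (x i) with h | h | h
    · rw [h]; norm_num
    · exact absurd h hi
    · rw [h]; norm_num
  have hint : proj n l p ∉ interior (proj n l '' body x) := by
    intro hint
    have hcont : Filter.Tendsto (fun ε : ℝ => proj n l (p - ε • Pi.single i (p i)))
        (nhds 0) (nhds (proj n l p)) := by
      have : Continuous fun ε : ℝ => proj n l (p - ε • Pi.single i (p i)) :=
        (continuous_proj _ _).comp (by fun_prop)
      simpa using this.tendsto 0
    have hev := (hcont.eventually (mem_interior_iff_mem_nhds.1 hint)).filter_mono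
      (nhdsWithin_le_nhds (s := Set.Ioi 0))
    obtain ⟨ε, ⟨q, hq, hqe⟩, hε0, hε1⟩ :=
      (hev.and (Ioo_mem_nhdsGT (show (0 : ℝ) < 1 by norm_num))).exists
    set r := p - ε • Pi.single i (p i) with hr
    have hri : r i = (1 - ε) * p i := by simp [hr]; ring
    have hrj : ∀ j, j ≠ i → r j = p j := fun j hj => by simp [hr, Pi.single_eq_of_ne hj]
    have hry : r ∈ body y := by
      rw [mem_body] at hpy ⊢
      refine ⟨fun j => ?_, fun j hj => ?_⟩
      · by_cases hj : j = i
        · subst hj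
          rw [hri]
          have := hpy.1 j
          constructor <;> nlinarith [this.1, this.2]
        · rw [hrj j hj]; exact hpy.1 j
      · have : j ≠ i := fun h => hj (h ▸ hyi)
        rw [hrj j this]; exact hpy.2 j hj
    obtain ⟨q', ⟨z, hz, hqz⟩, hq''⟩ := exists_mem_facesBody .src hl hq
    have he := hV.injOn ⟨z, hx hz, hqz⟩ ⟨y, hy, hry⟩ (hq''.trans hqe)
    have h1 := (mem_body.1 (body_face_subset hz hqz)).2 i hi
    rw [he, hri, ← hpi] at h1
    have : ε * p i = 0 := by linarith
    exact (mul_ne_zero hε0.ne' hpne) this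
  obtain ⟨q, hq, hqp⟩ := exists_mem_facesBody .tgt hl hpx
  rwa [eq_of_proj_notMem_interior hpx (facesBody_subset _ _ _ hq) hqp.symm hint]

theorem setBody_flipAt (hV : IsSection l (setBody V)) (hdim : ∀ y ∈ V, dim y = l)
    (hx : faces .src l x ⊆ V) (hl : l ≤ dim x) :
    setBody (flipAt l V x) = (setBody V \ body x) ∪ facesBody .tgt l x := by
  ext p
  constructor
  · rintro ⟨y, hy, hp⟩
    rcases mem_union.1 hy with hy | hy
    · obtain ⟨hy, hy'⟩ := mem_sdiff.1 hy
      by_cases hpx : p ∈ body x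
      · exact .inr (mem_facesBody_tgt hV hdim hx hl hy hy' hp hpx)
      · exact .inl ⟨⟨y, hy, hp⟩, hpx⟩
    · exact .inr ⟨y, hy, hp⟩
  · rintro (⟨⟨y, hy, hp⟩, hpx⟩ | ⟨y, hy, hp⟩)
    · refine ⟨y, mem_union_left _ (mem_sdiff.2 ⟨hy, fun h => hpx (body_face_subset h hp)⟩), hp⟩
    · exact ⟨y, mem_union_right _ hy, hp⟩

/-- Source and target faces of `x` are both sections over the projection of `x`, and no other point
of the old section lies over that projection. -/
theorem isSection_flipAt (hV : IsSection l (setBody V)) (hdim : ∀ y ∈ V, dim y = l)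
    (hx : faces .src l x ⊆ V) (hl : l ≤ dim x) : IsSection l (setBody (flipAt l V x)) := by
  have hsrc : facesBody .src l x ⊆ setBody V := by
    rintro p ⟨y, hy, hp⟩
    exact ⟨y, hx hy, hp⟩
  have hmix : ∀ p ∈ setBody V \ body x, ∀ q ∈ facesBody .tgt l x, proj n l p ≠ proj n l q := by
    rintro p ⟨hp, hpx⟩ q hq he
    obtain ⟨q', hq', hqe⟩ := exists_mem_facesBody .src hl (facesBody_subset _ _ _ hq)
    have := hV.injOn hp (hsrc hq') (he.trans hqe.symm)
    rw [this] at hpx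
    exact hpx (facesBody_subset _ _ _ hq')
  rw [setBody_flipAt hV hdim hx hl]
  refine ⟨?_, ?_, ?_⟩
  · exact Set.union_subset (Set.sdiff_subset.trans hV.subset)
      ((facesBody_subset _ _ _).trans (body_subset_full x))
  · rintro p (hp | hp) q (hq | hq) he
    · exact hV.injOn hp.1 hq.1 he
    · exact absurd he (hmix p hp q hq)
    · exact absurd he.symm (hmix q hq p hp)
    · exact facesBody_injOn .tgt l x hp hq he
  · refine (Set.image_mono (Set.union_subset (Set.sdiff_subset.trans hV.subset)
      ((facesBody_subset _ _ _).trans (body_subset_full x)))).antisymm ?_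
    rintro _ ⟨p, hp, rfl⟩
    obtain ⟨q, hq, hqp⟩ := hV.exists_mem hp
    by_cases hqx : q ∈ body x
    · obtain ⟨r, hr, hrq⟩ := exists_mem_facesBody .tgt hl hqx
      exact ⟨r, .inr hr, hrq.trans hqp⟩
    · exact ⟨q, .inl ⟨hq, hqx⟩, hqp⟩

theorem card_flipAt (hV : IsSection l (setBody V)) (hdim : ∀ y ∈ V, dim y = l)
    (hx : faces .src l x ⊆ V) (hl : l ≤ dim x) : (flipAt l V x).card = V.card := by
  rw [flipAt, card_union_of_disjoint, card_sdiff_of_subset hx, card_faces, card_faces]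
  · have := card_le_card hx
    rw [card_faces] at this
    omega
  · rw [disjoint_left]
    intro y hy hy'
    obtain ⟨h1, h2⟩ := mem_sdiff.1 hy
    exact h2 (mem_faces_of_subcube hV hdim hx hl h1 (mem_faces_iff.1 hy').2.1)

theorem dim_flipAt (hdim : ∀ y ∈ V, dim y = l) : ∀ y ∈ flipAt l V x, dim y = l := by
  intro y hy
  rcases mem_union.1 hy with hy | hy
  · exact hdim y (mem_sdiff.1 hy).1
  · exact dim_of_mem_faces hy

end flip

/-- Add to `R` its largest missing zero of `x`: the ranks of the other missing zeros, all smaller,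
do not change. -/
theorem facesBody_mono {n l : ℕ} {s : Side} {x : Cube n} (hl : l < dim x) :
    facesBody s l x ⊆ facesBody s (l + 1) x := by
  intro p hp
  obtain ⟨hx, R, h1, h2, h3⟩ := mem_facesBody.1 hp
  have hne : (zeros x \ R).Nonempty := by
    rw [← card_pos, card_sdiff_of_subset h1, card_zeros]
    omega
  obtain ⟨hm, hm'⟩ := mem_sdiff.1 ((zeros x \ R).max'_mem hne)
  set m := (zeros x \ R).max' hne with hmdef
  refine mem_facesBody.2 ⟨hx, insert m R, insert_subset hm h1,
    by rw [card_insert_of_notMem hm', h2], fun i hi hiR => ?_⟩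
  rw [mem_insert, not_or] at hiR
  have hle : i ≤ m := le_max' _ _ (mem_sdiff.2 ⟨hi, hiR.2⟩)
  rw [rankIn, filter_insert, if_neg hle.not_gt]
  exact h3 i hi hiR.2

/-! ### Piles of sections -/

/-- A pile whose realizations are nested sections. -/
structure IsGoodPile {n : ℕ} (v : PrePile n) : Prop where
  isPile : IsPile v
  isSection : ∀ l ≤ n, IsSection l (setBody (v l))
  nested : ∀ l < n, setBody (v l) ⊆ setBody (v (l + 1))

theorem IsGoodPile.act_cube {n : ℕ} {v : PrePile n} (hv : IsGoodPile v) {x : Cube n}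
    (hx : (Move.cube x).Applicable v) : IsGoodPile ((Move.cube x).act v) := by
  rw [applicable_cube] at hx
  have hact : (Move.cube x).act v = fun l => flipAt l (v l) x := funext fun l => Cubical.act_cube x v l
  rw [hact]
  have hd := fun l hl => (hv.isPile l hl).2
  refine ⟨fun l hl => ⟨?_, dim_flipAt (hd l hl)⟩, fun l hl => ?_, fun l hl => ?_⟩
  · by_cases h : l ≤ dim x
    · rw [card_flipAt (hv.isSection l hl) (hd l hl) (hx l) h, (hv.isPile l hl).1]
    · rw [flipAt_of_dim_lt _ (by omega), (hv.isPile l hl).1]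
  · by_cases h : l ≤ dim x
    · exact isSection_flipAt (hv.isSection l hl) (hd l hl) (hx l) h
    · simp only [flipAt_of_dim_lt _ (not_le.1 h)]; exact hv.isSection l hl
  · by_cases h : l < dim x
    · simp only [setBody_flipAt (hv.isSection l hl.le) (hd l hl.le) (hx l) h.le,
        setBody_flipAt (hv.isSection (l + 1) hl) (hd (l + 1) hl) (hx (l + 1)) h]
      exact Set.union_subset_union (Set.sdiff_subset_sdiff_left (hv.nested l hl)) (facesBody_mono h)
    · simp only [flipAt_of_dim_lt (v (l + 1)) (show dim x < l + 1 by omega)]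
      rcases (not_lt.1 h).lt_or_eq with h | rfl
      · simp only [flipAt_of_dim_lt _ h]; exact hv.nested l hl
      -- In its own dimension a cube is its only source face and its only target face, so this level
      -- does not change.
      · have : flipAt (dim x) (v (dim x)) x = v (dim x) := by
          have h1 := hx (dim x)
          rw [faces_dim, singleton_subset_iff] at h1
          rw [flipAt, faces_dim, faces_dim, union_comm, ← insert_eq, sdiff_singleton_eq_erase,
            insert_erase h1]
        simp only [this]; exact hv.nested _ hl

theorem setBody_faces {n : ℕ} (s : Side) (l : ℕ) (x : Cube n) :
    setBody (faces s l x) = facesBody s l x := rfl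

/-- A level made of source or target faces of the `n`-cube lies in every section one dimension
higher, so nesting has to be checked only for the other levels. -/
theorem IsGoodPile.of_faces {n : ℕ} {v : PrePile n} (hp : IsPile v)
    (h : ∀ l ≤ n, IsSection l (setBody (v l)))
    (h' : ∀ l < n, (∃ s, v l = faces s l (full n)) ∨ setBody (v l) ⊆ setBody (v (l + 1))) :
    IsGoodPile v := by
  refine ⟨hp, h, fun l hl => ?_⟩
  rcases h' l hl with ⟨s, hs⟩ | h'
  · rw [hs]
    exact (h (l + 1) hl).facesBody_subset s hl
  · exact h'

theorem IsGoodPile.act_star {n : ℕ} {v : PrePile n} (hv : IsGoodPile v) (i : ℕ) :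
    IsGoodPile ((Move.star i).act v) := by
  have hact : ∀ l ≤ n, (Move.star i).act v l = if l < i then faces .src l (full n) else v l :=
    fun l hl => by simp only [Move.act, faceSet_eq_faces _ hl]
  refine .of_faces (fun l hl => ?_) (fun l hl => ?_) fun l hl => ?_
  · rw [hact l hl]
    split_ifs
    · exact ⟨by rw [card_faces, dim_full], fun y hy => dim_of_mem_faces hy⟩
    · exact hv.isPile l hl
  · rw [hact l hl]
    split_ifs
    · exact isSection_facesBody .src hl
    · exact hv.isSection l hl
  · rw [hact l hl.le, hact (l + 1) hl]
    by_cases h : l < i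
    · exact .inl ⟨.src, if_pos h⟩
    · rw [if_neg h, if_neg (by omega)]
      exact .inr (hv.nested l hl)

theorem IsGoodPile.act {n : ℕ} (v : PrePile n) (m : Move n) (hm : m.Applicable v)
    (hv : IsGoodPile v) : IsGoodPile (m.act v) := by
  cases m with
  | cube x => exact hv.act_cube hm
  | star i => exact hv.act_star i

theorem initialPile_apply {n k l : ℕ} (s : Side) (hl : l ≤ n) :
    initialPile n s k l = faces (if l = k then s else .src) l (full n) := by
  rw [initialPile]
  split_ifs with h
  · rw [← h, faceSet_eq_faces _ hl]
  · rw [faceSet_eq_faces _ hl]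

theorem isGoodPile_initialPile (n : ℕ) (s : Side) (k : ℕ) : IsGoodPile (initialPile n s k) := by
  refine .of_faces (fun l hl => ?_) (fun l hl => ?_) fun l hl => ?_
  · rw [initialPile_apply s hl]
    exact ⟨by rw [card_faces, dim_full], fun y hy => dim_of_mem_faces hy⟩
  · rw [initialPile_apply s hl]
    exact isSection_facesBody _ hl
  · exact .inl ⟨_, initialPile_apply s hl.le⟩

/-! ### Realizations of blocks -/

theorem mem_word {n k : ℕ} {a : Block n k} {m : Move n} (h : m ∈ word k a) :
    (∃ x ∈ Block.cubes k a, m = .cube x) ∨ ∃ i < k, m = .star i := by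
  induction k with
  | zero =>
    induction a using cube_rec with | cube x =>
    have hw : word 0 (Block.ofCube 0 x) = [Move.cube x] := rfl
    rw [hw, List.mem_singleton] at h
    exact .inl ⟨x, by simp [cubes_zero], h⟩
  | succ k ih =>
    induction a using ofList_rec with | list a =>
    induction a with
    | nil => exact absurd h List.not_mem_nil
    | cons b a iha =>
      have hb : m ∈ word k b → (∃ x ∈ Block.cubes (k + 1) (ofList (b :: a)), m = .cube x) ∨
          ∃ i < k + 1, m = .star i := fun h => by
        rcases ih h with ⟨x, hx, rfl⟩ | ⟨i, hi, rfl⟩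
        · exact .inl ⟨x, by rw [cubes_ofList, List.flatMap_cons]; exact List.mem_append_left _ hx, rfl⟩
        · exact .inr ⟨i, by omega, rfl⟩
      cases a with
      | nil =>
        rw [word_ofList_singleton] at h
        exact hb h
      | cons c a =>
        rw [word_ofList_cons_cons, List.mem_append, List.mem_append, List.mem_singleton] at h
        rcases h with (h | rfl) | h
        · exact hb h
        · exact .inr ⟨k, by omega, rfl⟩
        · rcases iha h with ⟨x, hx, rfl⟩ | h
          · rw [cubes_ofList] at hx
            exact .inl ⟨x, by
              rw [cubes_ofList, List.flatMap_cons]; exact List.mem_append_right _ hx, rfl⟩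
          · exact .inr h

theorem cube_mem_word {n k : ℕ} {a : Block n k} {x : Cube n} (h : x ∈ Block.cubes k a) :
    Move.cube x ∈ word k a := by
  induction k with
  | zero =>
    induction a using cube_rec with | cube y =>
    rw [cubes_zero, List.mem_singleton] at h
    subst h
    exact List.mem_singleton.2 rfl
  | succ k ih =>
    induction a using ofList_rec with | list a =>
    induction a with
    | nil => exact absurd h List.not_mem_nil
    | cons b a iha =>
      rw [cubes_ofList, List.flatMap_cons, List.mem_append] at h
      cases a with
      | nil =>
        rw [word_ofList_singleton]
        exact ih (by simpa using h)
      | cons c a =>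
        rw [word_ofList_cons_cons, List.mem_append, List.mem_append]
        rcases h with h | h
        · exact .inl (.inl (ih h))
        · exact .inr (iha h)

theorem dim_le_of_hi {n k l : ℕ} {a : Block n k} (h : hi (l + 1) a = 0) {x : Cube n}
    (hx : x ∈ Block.cubes k a) : dim x ≤ l := by
  rw [hi, Multiset.filter_eq_nil] at h
  have := h x hx
  omega

theorem IsFullSub.globular {n j k : ℕ} {a : Block n j} {b : Block n k} (h : IsFullSub a k b)
    (hb : Globular (frame n) k b) : Globular (frame n) j a := by
  induction h with
  | refl => exact hb
  | @step k b c hbc _ ih =>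
    have hc : Path (Atom n k) _ _ c := hb.2
    exact ih (hc.mem b hbc).1

theorem IsFullSub.eq_ofCube {n j k : ℕ} {a : Block n j} {b : Block n k} (h : IsFullSub a k b)
    {x : Cube n} (hb : b = Block.ofCube k x) : a = Block.ofCube j x := by
  induction h with
  | refl => exact hb
  | @step k b c hbc _ ih =>
    subst hb
    exact ih (List.mem_singleton.1 hbc)

/-- A globular `k`-block of dimension at most `k` acts trivially in dimension `k`, and all its
cubes lie in the `k`-th level of a pile on which it acts. -/
theorem body_subset_of_ready {n k : ℕ} (hk : k ≤ n) {a : Block n k} (ha : Globular (frame n) k a)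
    (hd : hi (k + 1) a = 0) {v : PrePile n} (hv : IsGoodPile v) (hr : Ready v a) {x : Cube n}
    (hx : x ∈ Block.cubes k a) : body x ⊆ setBody (v k) := by
  -- The induction runs over the remaining part of the word and the current state. Level `k` stays
  -- fixed, since no cube has dimension above `k` and a `k`-cube replaces itself. When the turn of
  -- `x` comes it belongs to the level of its own dimension, and nesting places it in level `k`.
  have key : ∀ (w : List (Move n)) (u : PrePile n), Valid u w → (∀ m ∈ w, m ∈ word k a) →
      IsGoodPile u → u k = v k → Move.cube x ∈ w → body x ⊆ setBody (v k) := by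
    intro w
    induction w with
    | nil => exact fun _ _ _ _ _ h => absurd h List.not_mem_nil
    | cons m w ih =>
      intro u hu hw hgood huk hmem
      rcases List.mem_cons.1 hmem with rfl | hmem
      · have h1 := (applicable_cube x u).1 hu.1 (dim x)
        rw [faces_dim, singleton_subset_iff] at h1
        have h2 : body x ⊆ setBody (u (dim x)) := fun p hp => ⟨x, h1, hp⟩
        have h3 : ∀ l, dim x ≤ l → l ≤ n → body x ⊆ setBody (u l) := by
          intro l hl
          induction l, hl using Nat.le_induction with
          | base => exact fun _ => h2
          | succ l hl ihl => exact fun h => (ihl (by omega)).trans (hgood.nested l (by omega))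
        rw [← huk]
        exact h3 k (dim_le_of_hi hd hx) hk
      · refine ih (m.act u) hu.2 (fun m hm => hw m (List.mem_cons_of_mem _ hm))
          (IsGoodPile.act u m hu.1 hgood) ?_ hmem
        rcases mem_word (hw m List.mem_cons_self) with ⟨y, hy, rfl⟩ | ⟨i, hi, rfl⟩
        · rw [act_cube]
          rcases (dim_le_of_hi hd hy).lt_or_eq with h | h
          · rw [flipAt_of_dim_lt _ h, huk]
          · subst h
            have h1 := (applicable_cube y u).1 hu.1 (dim y)
            rw [faces_dim, singleton_subset_iff] at h1
            rw [flipAt, faces_dim, faces_dim, union_comm, ← insert_eq, sdiff_singleton_eq_erase,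
              insert_erase h1, huk]
        · simp only [Move.act, if_neg hi.le.not_gt, huk]
  exact key (word k a) v (ha.runs (by omega) hr).valid (fun _ h => h) hv rfl (cube_mem_word hx)

theorem blockBody_eq {n k : ℕ} (hk : k ≤ n) {a : Block n k} (ha : Globular (frame n) k a)
    (hd : hi (k + 1) a = 0) {v : PrePile n} (hv : IsGoodPile v) (hr : Ready v a)
    (hvk : v k = (hi k a).toFinset) : blockBody a = setBody (v k) := by
  ext p
  constructor
  · rintro ⟨x, hx, hp⟩
    exact body_subset_of_ready hk ha hd hv hr hx hp
  · rintro ⟨x, hx, hp⟩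
    rw [hvk, Multiset.mem_toFinset, hi, Multiset.mem_filter] at hx
    exact ⟨x, hx.1, hp⟩

/-- A globular `k`-block of dimension at most `k` can act on a pile consisting of the source faces
below `k` and of its `k`-cubes. -/
theorem ready_of_dim_le {n k : ℕ} {a : Block n k} (ha : Globular (frame n) k a)
    (hd : hi (k + 1) a = 0) {v : PrePile n} (hlow : ∀ l < k, v l = faces .src l (full n))
    (hvk : v k = (hi k a).toFinset) : Ready v a := by
  refine ⟨hlow, fun l hl => ?_⟩
  rcases hl.lt_or_eq with hl | rfl
  · exact (flippable_of_dim_lt _ fun x hx => lt_of_le_of_lt (dim_le_of_hi hd hx) hl).1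
  · rw [hvk, ← blockFaces_of_hi_succ .src hd]
    exact ha.flippable.1

theorem hi_succ_std (n : ℕ) (s : Side) (k : ℕ) : hi (k + 1) (std n s k) = 0 := by
  refine hi_eq_zero_of_dim k.lt_succ_self fun x hx => ?_
  rw [(isStandard_std n s k).2] at hx
  exact dim_of_mem_frame hx

theorem initialPile_std {n k : ℕ} (s : Side) (hk : k ≤ n) :
    initialPile n s k k = (hi k (std n s k)).toFinset := by
  rw [initialPile_apply s hk, if_pos rfl, (isStandard_std n s k).2, frame, val_toFinset]

theorem ready_std {n k : ℕ} (s : Side) (hk : k ≤ n) : Ready (initialPile n s k) (std n s k) :=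
  ready_of_dim_le (isStandard_std n s k).1 (hi_succ_std n s k)
    (fun l hl => by rw [initialPile_apply s (by omega), if_neg hl.ne]) (initialPile_std s hk)

/-- The fillers of dimension below `k` add nothing to the union, so the block and the set of
`k`-faces have the same realization. -/
theorem blockBody_std {n k : ℕ} (s : Side) (hk : k ≤ n) :
    blockBody (std n s k) = facesBody s k (full n) := by
  rw [blockBody_eq hk (isStandard_std n s k).1 (hi_succ_std n s k) (isGoodPile_initialPile n s k)
    (ready_std s hk) (initialPile_std s hk), initialPile_apply s hk, if_pos rfl, setBody_faces]

theorem IsSection.isDisk_bdBody {n l : ℕ} {V : Finset (Cube n)} (h : IsSection l (setBody V))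
    (hl : l ≤ n) : IsDiskWithBoundary l (setBody V) (bdBody n l) := by
  have hc : IsCompact (setBody V) := isCompact_pileBody (fun _ => V) 0
  have h1 := h.isDiskWithBoundary hc hl
  cases l with
  | zero =>
    convert h1
    rw [bdBody, eq_comm, Set.eq_empty_iff_forall_notMem]
    rintro p ⟨hp, hp'⟩
    rw [(isClosed_image_body _ _).frontier_eq] at hp'
    -- In `ℝ⁰` every point of the image is interior, so the frontier is empty, in agreement with
    -- `bdBody n 0`.
    exact hp'.2 (proj_mem_interior (I := ∅) (h.subset hp) (empty_subset _) le_rfl (by simp))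
  | succ l =>
    rw [h.frontier_eq hl] at h1
    rwa [bdBody, blockBody_std .src (by omega), blockBody_std .tgt (by omega)]

theorem IsGoodPile.nestedDisks {n : ℕ} {v : PrePile n} (hv : IsGoodPile v) : NestedDisks v :=
  ⟨hv.nested, fun k hk => (hv.isSection k hk).isDisk_bdBody hk⟩

theorem isDisk_bd {n j k : ℕ} {a b : Block n j} {C : List (Block n j)}
    (hC : IsFullSub (j := j + 1) C k (std n .src k)) (hab : [a, b] <:+: C) :
    IsDisk j (blockBody (bd .src j b)) := by
  have hjk := hC.le
  -- Beyond dimension `n` the block is a single cube in nested one-term sequences and has no two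
  -- consecutive sub-blocks.
  by_cases hk : n < k
  · have hC' : C = [Block.ofCube j (full n)] := hC.eq_ofCube (std_of_le .src hk.le)
    have := hab.length_le
    simp [hC'] at this
  obtain ⟨hg, u, hu, hr⟩ := hC.exists_ready (by omega) IsGoodPile.act (isStandard_std n .src k).1
    (isGoodPile_initialPile n .src k) (ready_std .src (by omega))
  have hg : Path (Atom n j) _ _ C := hg.2
  obtain ⟨l, r, rfl⟩ := hab
  have e : l ++ [a, b] ++ r = (l ++ [a]) ++ b :: r := by simp
  rw [e] at hg
  have hr' : ReadyList u (frame n .src j) ((l ++ [a]) ++ b :: r) := by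
    rw [← e]; exact Ready.list hr
  -- In the state `w` in which the turn of `b` comes, level `j` is the set of source `j`-faces of
  -- `b`, that is, of the `j`-cubes of its `j`-source. The realization of this source is thus a
  -- level of a good pile.
  obtain ⟨w, hw, hwr, hwj⟩ := Cubical.exists_ready (by omega) IsGoodPile.act hg hu hr'
  have hb := (hg.mem b (by simp)).1
  obtain ⟨h1, h2⟩ := hi_bd_self .src hb
  have hd : hi (j + 1) (bd .src j b) = 0 := hi_eq_zero_of_dim j.lt_succ_self fun x hx => by
    rw [h2] at hx; exact dim_of_mem_blockFaces hx
  have hwj' : w j = (hi j (bd .src j b)).toFinset := by rw [hwj, h2]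
  rw [blockBody_eq (by omega) h1 hd hw (ready_of_dim_le h1 hd hwr.low hwj') hwj']
  obtain ⟨e, -⟩ := (hw.isSection j (by omega)).isDisk_bdBody (by omega)
  exact ⟨e⟩

end Cubical

-- The proposition

open Cubical in
theorem proposition6p2 (n : ℕ) :
    (∀ (s t : Side) (i j k : ℕ), i < j → j < k →
      ∀ α : Block n j, IsFullSub α k (std n s k) →
        SameCell (bd t i α) (std n t i)) ∧
    (∀ (j k : ℕ) (α β : Block n j) (C : List (Block n j)),
      IsFullSub (j := j + 1) C k (std n .src k) → [α, β] <:+: C →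
        SameCell (bd .src j β) (bd .tgt j α) ∧
        IsDisk j (blockBody (bd .src j β))) ∧
    (∀ (s : Side) (k : ℕ), k ≤ n →
      ∀ w : List (Move n), w <+: word k (std n s k) →
        (∀ m : Move n, w ++ [m] <+: word k (std n s k) →
          m.Applicable (run (initialPile n s k) w)) ∧
        IsPile (run (initialPile n s k) w) ∧
        NestedDisks (run (initialPile n s k) w)) := by
  refine ⟨fun s t i j k hij hjk α hα => sameCell_bd_std hij hjk hα,
    fun j k α β C hC hab => ⟨?_, isDisk_bd hC hab⟩, fun s k hk w hw => ?_⟩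
  · have hg : Path (Atom n j) _ _ C := (hC.globular (isStandard_std n .src k).1).2
    obtain ⟨h1, h2, h3⟩ := path_infix hg hab
    exact sameCell_of_path h1 h2 h3
  · have hvalid := ((isStandard_std n s k).1.runs (by omega) (ready_std s hk)).valid
    have hgood : IsGoodPile (run (initialPile n s k) w) := by
      obtain ⟨w', hw'⟩ := hw
      rw [← hw', valid_append] at hvalid
      exact hvalid.1.run_of IsGoodPile.act (isGoodPile_initialPile n s k)
    refine ⟨fun m hm => ?_, hgood.isPile, hgood.nestedDisks⟩
    obtain ⟨w', hw'⟩ := hm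
    rw [← hw', valid_append, valid_append] at hvalid
    exact hvalid.1.2.1
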